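/- A \emph{tree network} on $n \ge 1$ vertices is a rooted tree $T=(V,E)$ with $|V|=n$ whose edges have non-negative real lengths and whose vertices $v$ have real weights $w(v)\ge 0$; here every vertex has at most two children. A \emph{point} of $T$ is a vertex or a point on an edge, and $d(x,v)$ is the length of the path in $T$ between the point $x$ and the vertex $v$, prorated if $x$ lies inside an edge. For $1\le p\le n$, the \emph{weighted discrete $p$-center problem} asks for the smallest real $\alpha=\alpha^*$ for which there are $p$ points $c_1,\dots,c_p$ of $T$ such that every vertex $v$ satisfies $d(c_i,v)\,w(v)\le\alpha$ for at least one $i$, and for $p$ such points for $\alpha=\alpha^*$. For a constant $\kappa$, call $T$ \emph{$\kappa$-balanced} if every vertex is joined to the root by a path of at most $\kappa\log n$ edges. Theorem. There is an algorithm on a real RAM (unit-cost arithmetic and comparisons of real numbers, natural numbers for indices, indirect addressing) that solves the weighted discrete $p$-center problem on these networks, given $n$, $p$, the root, the parents of the vertices, the edge lengths and the weights, and whose running time on balanced networks is $$O\bigl(n\log n+p\log^2 n\,\log(n/p)\bigr).$$ That is, for every $\kappa$ there is a constant $C$ such that for all $1\le p\le n$ and all $\kappa$-balanced tree networks with $n$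 vertices, the algorithm stops with a correct output ($\alpha^*$ and $p$ centers that attain it) after at most $C\,(n\log n+p\log^2 n\log(n/p)+1)$ steps. -/

import Mathlib

/-! ### Rooted tree networks -/

/-- A rooted tree network on the vertices `0, …, n - 1`: every vertex other than the root is joined
to its parent by an edge of nonnegative length `len v`, and every vertex `v` has a weight `w v ≥ 0`.
The root is its own parent, and `len root = 0` is a mere convention (no edge belongs to it). -/
structure TreeNetwork (n : ℕ) where
  root : Fin n
  parent : Fin n → Fin n
  len : Fin n → ℝ
  w : Fin n → ℝ
  parent_root : parent root = root
  exists_iterate_parent : ∀ v, ∃ k : ℕ, parent^[k] v = root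
  len_root : len root = 0
  len_nonneg : ∀ v, 0 ≤ len v
  w_nonneg : ∀ v, 0 ≤ w v

namespace TreeNetwork

variable {n : ℕ} (T : TreeNetwork n)

/-- The underlying graph: the edges join the vertices other than the root to their parents. -/
def graph : SimpleGraph (Fin n) where
  Adj u v := u ≠ v ∧ (T.parent u = v ∨ T.parent v = u)
  symm := ⟨fun _ _ h => ⟨h.1.symm, h.2.symm⟩⟩
  loopless := ⟨fun _ h => h.1 rfl⟩

theorem reachable_root (v : Fin n) : T.graph.Reachable v T.root := by
  obtain ⟨k, hk⟩ := T.exists_iterate_parent v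
  induction k generalizing v with
  | zero => rw [show v = T.root from hk]
  | succ k ih =>
    rw [Function.iterate_succ_apply] at hk
    by_cases h : v = T.parent v
    · rw [← h] at hk
      exact ih v hk
    · have hadj : T.graph.Adj v (T.parent v) := ⟨h, Or.inl rfl⟩
      exact hadj.reachable.trans (ih _ hk)

theorem graph_connected : T.graph.Connected :=
  haveI : Nonempty (Fin n) := ⟨T.root⟩
  { preconnected := fun u v => (T.reachable_root u).trans (T.reachable_root v).symm }

theorem graph_isTree : T.graph.IsTree := by
  rw [SimpleGraph.isTree_iff_connected_and_card]
  refine ⟨T.graph_connected, le_antisymm ?_ T.graph_connected.card_vert_le_card_edgeSet_add_one⟩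
  have hsub : T.graph.edgeSet ⊆ (fun v => s(v, T.parent v)) '' {v | v ≠ T.root} := by
    intro e
    induction e using Sym2.ind with
    | _ u v =>
      intro h
      have h' : u ≠ v ∧ (T.parent u = v ∨ T.parent v = u) := h
      rcases h' with ⟨hne, h1 | h1⟩
      · refine ⟨u, ?_, by simp [h1]⟩
        rintro rfl
        exact hne (T.parent_root.symm.trans h1)
      · refine ⟨v, ?_, by simp [h1, Sym2.eq_swap]⟩
        rintro rfl
        exact hne (h1.symm.trans T.parent_root)
  have h1 : Nat.card T.graph.edgeSet ≤ ({v | v ≠ T.root} : Set (Fin n)).ncard :=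
    (Set.ncard_le_ncard hsub (Set.toFinite _)).trans (Set.ncard_image_le (Set.toFinite _))
  have h2 : ({v | v ≠ T.root} : Set (Fin n)).ncard + 1 = Nat.card (Fin n) := by
    have := Set.ncard_add_ncard_compl ({T.root} : Set (Fin n))
    rw [Set.ncard_singleton] at this
    rw [← this, add_comm]
    rfl
  omega

/-- The length of the edge joining two adjacent vertices. -/
def edgeLen (u v : Fin n) : ℝ :=
  if T.parent u = v then T.len u else T.len v

/-- The unique path between two vertices. -/
noncomputable def path (u v : Fin n) : T.graph.Walk u v :=
  (T.graph_isTree.existsUnique_path u v).choose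

/-- The distance between two vertices: the length of the path joining them. -/
noncomputable def vertexDist (u v : Fin n) : ℝ :=
  ((T.path u v).darts.map fun e => T.edgeLen e.fst e.snd).sum

/-- A point of the network: the point at distance `offset` from `vertex` on the edge that joins
`vertex` to its parent. The vertices are the points with offset `0` (for the root, the only offset);
a vertex other than the root is also the upper end of the edges to its children. -/
structure Point where
  vertex : Fin n
  offset : ℝ
  offset_nonneg : 0 ≤ offset
  offset_le : offset ≤ T.len vertex

/-- The distance from a point of the network to a vertex, with prorated edge lengths: a path leaves
the edge of the point through the lower end or through the upper end, whichever is shorter. -/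
noncomputable def dist (x : T.Point) (u : Fin n) : ℝ :=
  min (x.offset + T.vertexDist x.vertex u)
    (T.len x.vertex - x.offset + T.vertexDist (T.parent x.vertex) u)

/-- The points `c 0, …, c (p - 1)` form a `p`-center for `α`: every vertex is `α`-covered by at
least one of them. -/
def Covers {p : ℕ} (c : Fin p → T.Point) (α : ℝ) : Prop :=
  ∀ u, ∃ i, T.dist (c i) u * T.w u ≤ α

/-- The `α`-feasibility of the problem with `p` centers, which may lie on edges or at vertices. -/
def Feasible (p : ℕ) (α : ℝ) : Prop :=
  ∃ c : Fin p → T.Point, T.Covers c α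

/-- Every vertex has at most two children. -/
def IsBinary : Prop :=
  ∀ v, (Finset.univ.filter fun u => u ≠ T.root ∧ T.parent u = v).card ≤ 2

/-- The number of edges between a vertex and the root. -/
def depth (v : Fin n) : ℕ :=
  Nat.find (T.exists_iterate_parent v)

/-- The tree is balanced with constant `κ`: its height is at most `κ * log n`. -/
def IsBalanced (κ : ℝ) : Prop :=
  ∀ v, (T.depth v : ℝ) ≤ κ * Real.log n

end TreeNetwork

/-! ### A real RAM

Programs are structured programs over finitely many named, unbounded arrays of natural numbers
(for indices and counters) and of real numbers. A cell of index given by an expression is read or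
written at unit cost, as is each arithmetic operation and each comparison. There is no conversion
between real and natural numbers, and there are no real constants but the natural numbers. -/

namespace RealRAM

/-- The contents of the cells: `nat a i` and `real a i` are the `i`-th cells of the `a`-th array of
natural and of real numbers. -/
@[ext]
structure State where
  nat : ℕ → ℕ → ℕ
  real : ℕ → ℕ → ℝ

/-- Expressions for natural numbers; `get a i` reads the cell `i` of the array `a`. -/
inductive NExp where
  | lit (k : ℕ)
  | get (a : ℕ) (i : NExp)
  | add (e f : NExp)
  | sub (e f : NExp)
  | half (e : NExp)

/-- Expressions for real numbers; `get a i` reads the cell `i` of the array `a`. -/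
inductive RExp where
  | lit (k : ℕ)
  | get (a : ℕ) (i : NExp)
  | add (e f : RExp)
  | sub (e f : RExp)
  | mul (e f : RExp)
  | div (e f : RExp)

/-- Comparisons. -/
inductive Test where
  | natLt (e f : NExp)
  | natEq (e f : NExp)
  | realLt (e f : RExp)
  | realLe (e f : RExp)

/-- Programs. -/
inductive Prog where
  | skip
  | setNat (a : ℕ) (i e : NExp)
  | setReal (a : ℕ) (i : NExp) (e : RExp)
  | seq (P Q : Prog)
  | ite (b : Test) (P Q : Prog)
  | loop (b : Test) (P : Prog)

/-- The value of an expression; subtraction of natural numbers is truncated. -/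
def NExp.eval (s : State) : NExp → ℕ
  | .lit k => k
  | .get a i => s.nat a (i.eval s)
  | .add e f => e.eval s + f.eval s
  | .sub e f => e.eval s - f.eval s
  | .half e => e.eval s / 2

/-- The number of operations needed for the evaluation of an expression. -/
def NExp.cost : NExp → ℕ
  | .lit _ => 1
  | .get _ i => i.cost + 1
  | .add e f => e.cost + f.cost + 1
  | .sub e f => e.cost + f.cost + 1
  | .half e => e.cost + 1

/-- The value of an expression; a division by zero returns zero. -/
noncomputable def RExp.eval (s : State) : RExp → ℝ
  | .lit k => k
  | .get a i => s.real a (i.eval s)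
  | .add e f => e.eval s + f.eval s
  | .sub e f => e.eval s - f.eval s
  | .mul e f => e.eval s * f.eval s
  | .div e f => e.eval s / f.eval s

/-- The number of operations needed for the evaluation of an expression. -/
def RExp.cost : RExp → ℕ
  | .lit _ => 1
  | .get _ i => i.cost + 1
  | .add e f => e.cost + f.cost + 1
  | .sub e f => e.cost + f.cost + 1
  | .mul e f => e.cost + f.cost + 1
  | .div e f => e.cost + f.cost + 1

/-- The truth of a comparison. -/
def Test.Holds (s : State) : Test → Prop
  | .natLt e f => e.eval s < f.eval s
  | .natEq e f => e.eval s = f.eval s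
  | .realLt e f => e.eval s < f.eval s
  | .realLe e f => e.eval s ≤ f.eval s

/-- The number of operations needed for a comparison. -/
def Test.cost : Test → ℕ
  | .natLt e f => e.cost + f.cost + 1
  | .natEq e f => e.cost + f.cost + 1
  | .realLt e f => e.cost + f.cost + 1
  | .realLe e f => e.cost + f.cost + 1

/-- The state after writing `x` to the cell `i` of the array `a` of natural numbers. -/
def State.putNat (s : State) (a i x : ℕ) : State :=
  { s with nat := Function.update s.nat a (Function.update (s.nat a) i x) }

/-- The state after writing `x` to the cell `i` of the array `a` of real numbers. -/
noncomputable def State.putReal (s : State) (a i : ℕ) (x : ℝ) : State :=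
  { s with real := Function.update s.real a (Function.update (s.real a) i x) }

/-- `Run P s t s'`: the program `P`, started in the state `s`, stops after exactly `t` steps in the
state `s'`. -/
inductive Run : Prog → State → ℕ → State → Prop where
  | skip (s : State) : Run .skip s 1 s
  | setNat (s : State) (a : ℕ) (i e : NExp) :
      Run (.setNat a i e) s (i.cost + e.cost + 1) (s.putNat a (i.eval s) (e.eval s))
  | setReal (s : State) (a : ℕ) (i : NExp) (e : RExp) :
      Run (.setReal a i e) s (i.cost + e.cost + 1) (s.putReal a (i.eval s) (e.eval s))
  | seq {P Q : Prog} {s s' s'' : State} {t t' : ℕ} :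
      Run P s t s' → Run Q s' t' s'' → Run (.seq P Q) s (t + t') s''
  | ite_true {b : Test} {P Q : Prog} {s s' : State} {t : ℕ} :
      b.Holds s → Run P s t s' → Run (.ite b P Q) s (b.cost + t) s'
  | ite_false {b : Test} {P Q : Prog} {s s' : State} {t : ℕ} :
      ¬ b.Holds s → Run Q s t s' → Run (.ite b P Q) s (b.cost + t) s'
  | loop_true {b : Test} {P : Prog} {s s' s'' : State} {t t' : ℕ} :
      b.Holds s → Run P s t s' → Run (.loop b P) s' t' s'' →
        Run (.loop b P) s (b.cost + t + t') s''
  | loop_false {b : Test} {P : Prog} {s : State} :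
      ¬ b.Holds s → Run (.loop b P) s b.cost s

end RealRAM

/-! ### The weighted discrete `p`-center problem as a computational problem -/

namespace TreeNetwork

variable {n : ℕ} (T : TreeNetwork n)

/-- The entries of a list of `n` numbers, followed by zeros. -/
def padded {X : Type} [Zero X] (f : Fin n → X) (i : ℕ) : X :=
  if h : i < n then f ⟨i, h⟩ else 0

/-- The input of the problem: the first array of natural numbers holds `n`, `p` and the root, the
second one the parents; the first array of real numbers holds the weights of the vertices, the
second one the lengths of the edges to the parents. All other cells are zero. -/
noncomputable def input (p : ℕ) : RealRAM.State where
  nat a i :=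
    if a = 0 then (if i = 0 then n else if i = 1 then p else if i = 2 then (T.root : ℕ) else 0)
    else if a = 1 then padded (fun v => (T.parent v : ℕ)) i
    else 0
  real a i :=
    if a = 0 then padded T.w i
    else if a = 1 then padded T.len i
    else 0

/-- The output is a solution: the cell `0` of the third array of real numbers holds the
smallest `α` for which the problem is `α`-feasible, and the third array of natural numbers and the
fourth one of real numbers hold the vertices and the offsets of `p` points that form a `p`-center
for this `α`. -/
def IsSolution (p : ℕ) (s : RealRAM.State) : Prop :=
  IsLeast {α | T.Feasible p α} (s.real 2 0) ∧
    ∃ c : Fin p → T.Point, T.Covers c (s.real 2 0) ∧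
      ∀ i : Fin p, s.nat 2 i = ((c i).vertex : ℕ) ∧ s.real 3 i = (c i).offset

end TreeNetwork

/-! Fix a value `α`. A vertex is served within `α` exactly if some center lies within its reach: `α`
divided by its weight, or, for weight `0`, a bound for all distances (`dist_mul_le_iff`). The greedy
algorithm climbs from the leaves and keeps one number per vertex: a nonnegative number is a radius
within which a vertex of the subtree still needs a center, a negative one is minus the distance to a
center already placed. A parent keeps the candidate of least absolute value, where a center wins
ties (`Prec`). A center is placed as high as possible: where the need becomes zero on an edge, or at
the root. Each center has a witness, a vertex whose need caused it, and no point serves two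
witnesses; hence no solution has fewer centers (`IsGreedy.openCount_le`), and feasibility is decided
by counting (`IsGreedy.feasible_iff`). One such test takes linear time (`testProg_spec`).

The optimum is found by a parametric search. Reaches are affine in `α`, so the greedy algorithm can
be run on lines instead of numbers, simultaneously for all values in an open range whose lower end
is infeasible and whose upper end is feasible. The edge above a vertex can be resolved once none of
its four critical values lies in the range: the zeros of the sum and of the difference of the two
lines to be compared, and those of the lines at the two ends of the edge. A round tests the weighted
median of the known critical values in the range, shrinks the range to one side of it, and scans the
tree for what can now be resolved or activated (`roundProg_spec`). Once the root is resolved, the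
greedy algorithm opens the same vertices for all values of the range; so the least feasible value is
not inside, and it is the upper end (`SearchState.isLeast`).

To bound the number of rounds, a vertex of depth `d` gets weight `4 ^ d`. The potential counts four
times the weight of each inactive vertex and, for the others, the weight of each critical value in
the range. As deep vertices are heavy and each vertex has at most two children, the inactive
vertices weigh at most three times as much as the active ones (`sum_inactive_le`), and each active
vertex has a critical value in the range. So the critical values in the range carry at least a
thirteenth of the potential, and halving their weight multiplies the potential by at most `25 / 26`.
With height `D` this gives `O(log n + D)` rounds of linear cost. Sorting is paid once per critical
value, `O(n log n)` in total, and the whole algorithm takes `O(n (log n + D))` steps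
(`centerProg_run`). On balanced trees this is `O(n log n)`, so the first term of the claimed bound
already suffices. -/

namespace RealRAM

/-! ### A program logic for the real RAM -/

@[simp]
theorem State.putNat_nat (s : State) (a i x b j : ℕ) :
    (s.putNat a i x).nat b j = if b = a then (if j = i then x else s.nat b j) else s.nat b j := by
  unfold State.putNat
  by_cases h : b = a
  · subst h
    by_cases h' : j = i <;> simp [h']
  · simp [h]

@[simp]
theorem State.putNat_real (s : State) (a i x : ℕ) : (s.putNat a i x).real = s.real := rfl

@[simp]
theorem State.putReal_nat (s : State) (a i : ℕ) (x : ℝ) : (s.putReal a i x).nat = s.nat := rfl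

@[simp]
theorem State.putReal_real (s : State) (a i : ℕ) (x : ℝ) (b j : ℕ) :
    (s.putReal a i x).real b j =
      if b = a then (if j = i then x else s.real b j) else s.real b j := by
  unfold State.putReal
  by_cases h : b = a
  · subst h
    by_cases h' : j = i <;> simp [h']
  · simp [h]

theorem State.putNat_nat_of_ne (s : State) {a b : ℕ} (i x : ℕ) (h : b ≠ a) :
    (s.putNat a i x).nat b = s.nat b := by
  funext j
  simp [h]

theorem State.putReal_real_of_ne (s : State) {a b : ℕ} (i : ℕ) (x : ℝ) (h : b ≠ a) :
    (s.putReal a i x).real b = s.real b := by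
  funext j
  simp [h]

/-- The program writes to the given array of natural numbers. -/
def Prog.writesNat (a : ℕ) : Prog → Bool
  | .skip => false
  | .setNat b _ _ => a == b
  | .setReal _ _ _ => false
  | .seq P Q => P.writesNat a || Q.writesNat a
  | .ite _ P Q => P.writesNat a || Q.writesNat a
  | .loop _ P => P.writesNat a

/-- The program writes to the given array of real numbers. -/
def Prog.writesReal (a : ℕ) : Prog → Bool
  | .skip => false
  | .setNat _ _ _ => false
  | .setReal b _ _ => a == b
  | .seq P Q => P.writesReal a || Q.writesReal a
  | .ite _ P Q => P.writesReal a || Q.writesReal a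
  | .loop _ P => P.writesReal a

/-- The states agree on all arrays to which the program does not write. -/
def Frame (P : Prog) (s s' : State) : Prop :=
  (∀ a, P.writesNat a = false → s'.nat a = s.nat a) ∧
    ∀ a, P.writesReal a = false → s'.real a = s.real a

theorem Frame.refl (P : Prog) (s : State) : Frame P s s := ⟨fun _ _ => rfl, fun _ _ => rfl⟩

theorem Frame.trans {P : Prog} {s s' s'' : State} (h : Frame P s s') (h' : Frame P s' s'') :
    Frame P s s'' :=
  ⟨fun a ha => (h'.1 a ha).trans (h.1 a ha), fun a ha => (h'.2 a ha).trans (h.2 a ha)⟩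

/-- Writing is a computable syntactic property, so every later claim that an array is untouched has
the side condition `rfl`. -/
theorem Run.frame {P : Prog} {s s' : State} {t : ℕ} (h : Run P s t s') : Frame P s s' := by
  induction h with
  | skip s => exact Frame.refl _ _
  | setNat s a i e =>
    refine ⟨fun b hb => ?_, fun b _ => rfl⟩
    simp only [Prog.writesNat, beq_eq_false_iff_ne] at hb
    exact s.putNat_nat_of_ne _ _ hb
  | setReal s a i e =>
    refine ⟨fun b _ => rfl, fun b hb => ?_⟩
    simp only [Prog.writesReal, beq_eq_false_iff_ne] at hb
    exact s.putReal_real_of_ne _ _ hb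
  | seq _ _ ih ih' =>
    refine ⟨fun a ha => ?_, fun a ha => ?_⟩
    · simp only [Prog.writesNat, Bool.or_eq_false_iff] at ha
      exact (ih'.1 a ha.2).trans (ih.1 a ha.1)
    · simp only [Prog.writesReal, Bool.or_eq_false_iff] at ha
      exact (ih'.2 a ha.2).trans (ih.2 a ha.1)
  | ite_true _ _ ih =>
    refine ⟨fun a ha => ?_, fun a ha => ?_⟩
    · simp only [Prog.writesNat, Bool.or_eq_false_iff] at ha
      exact ih.1 a ha.1
    · simp only [Prog.writesReal, Bool.or_eq_false_iff] at ha
      exact ih.2 a ha.1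
  | ite_false _ _ ih =>
    refine ⟨fun a ha => ?_, fun a ha => ?_⟩
    · simp only [Prog.writesNat, Bool.or_eq_false_iff] at ha
      exact ih.1 a ha.2
    · simp only [Prog.writesReal, Bool.or_eq_false_iff] at ha
      exact ih.2 a ha.2
  | loop_true _ _ _ ih ih' =>
    exact ⟨fun a ha => (ih'.1 a ha).trans (ih.1 a ha), fun a ha => (ih'.2 a ha).trans (ih.2 a ha)⟩
  | loop_false _ => exact Frame.refl _ _

/-- The program stops after at most `B` steps, in a state with the property `Q`. -/
def Ends (P : Prog) (s : State) (B : ℕ) (Q : State → Prop) : Prop :=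
  ∃ t s', Run P s t s' ∧ t ≤ B ∧ Q s'

/-- The frame comes for free with each rule, so that specifications mention only the arrays that
change. -/
theorem Ends.mono {P : Prog} {s : State} {B B' : ℕ} {Q Q' : State → Prop} (h : Ends P s B Q)
    (hB : B ≤ B') (hQ : ∀ s', Frame P s s' → Q s' → Q' s') : Ends P s B' Q' := by
  obtain ⟨t, s', hr, ht, hq⟩ := h
  exact ⟨t, s', hr, ht.trans hB, hQ s' hr.frame hq⟩

theorem Ends.seq {P P' : Prog} {s : State} {B B' : ℕ} {Q R : State → Prop} (h : Ends P s B Q)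
    (h' : ∀ s', Frame P s s' → Q s' → Ends P' s' B' R) : Ends (.seq P P') s (B + B') R := by
  obtain ⟨t, s', hr, ht, hq⟩ := h
  obtain ⟨t', s'', hr', ht', hq'⟩ := h' s' hr.frame hq
  exact ⟨_, s'', hr.seq hr', by omega, hq'⟩

theorem Ends.ite {b : Test} {P P' : Prog} {s : State} {B : ℕ} {Q : State → Prop}
    (h : b.Holds s → Ends P s B Q) (h' : ¬ b.Holds s → Ends P' s B Q) :
    Ends (.ite b P P') s (b.cost + B) Q := by
  by_cases hb : b.Holds s
  · obtain ⟨t, s', hr, ht, hq⟩ := h hb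
    exact ⟨_, s', .ite_true hb hr, by omega, hq⟩
  · obtain ⟨t, s', hr, ht, hq⟩ := h' hb
    exact ⟨_, s', .ite_false hb hr, by omega, hq⟩

/-- The effect of a program without loops. -/
noncomputable def Prog.exec : Prog → State → State
  | .skip, s => s
  | .setNat a i e, s => s.putNat a (i.eval s) (e.eval s)
  | .setReal a i e, s => s.putReal a (i.eval s) (e.eval s)
  | .seq P Q, s => Q.exec (P.exec s)
  | .ite b P Q, s => open Classical in if b.Holds s then P.exec s else Q.exec s
  | .loop _ _, s => s

/-- A bound for the running time of a program without loops. -/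
def Prog.time : Prog → ℕ
  | .skip => 1
  | .setNat _ i e => i.cost + e.cost + 1
  | .setReal _ i e => i.cost + e.cost + 1
  | .seq P Q => P.time + Q.time
  | .ite b P Q => b.cost + max P.time Q.time
  | .loop _ _ => 0

/-- The program has no loops. -/
def Prog.loopFree : Prog → Bool
  | .skip => true
  | .setNat _ _ _ => true
  | .setReal _ _ _ => true
  | .seq P Q => P.loopFree && Q.loopFree
  | .ite _ P Q => P.loopFree && Q.loopFree
  | .loop _ _ => false

/-- Loop-free pieces are run by evaluating `exec` with `simp`; only loops need invariants. -/
theorem ends_exec {P : Prog} (hP : P.loopFree = true) (s : State) :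
    Ends P s P.time (fun s' => s' = P.exec s) := by
  induction P generalizing s with
  | skip => exact ⟨_, _, .skip s, le_rfl, rfl⟩
  | setNat a i e => exact ⟨_, _, .setNat s a i e, le_rfl, rfl⟩
  | setReal a i e => exact ⟨_, _, .setReal s a i e, le_rfl, rfl⟩
  | seq P Q ih ih' =>
    simp only [Prog.loopFree, Bool.and_eq_true] at hP
    refine (ih hP.1 s).seq fun s' _ hs' => ?_
    subst hs'
    exact ih' hP.2 _
  | ite b P Q ih ih' =>
    simp only [Prog.loopFree, Bool.and_eq_true] at hP
    refine Ends.ite (fun h => ?_) (fun h => ?_)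
    · refine (ih hP.1 s).mono (le_max_left _ _) fun s' _ hs' => ?_
      simp only [Prog.exec, h, if_true, hs']
    · refine (ih' hP.2 s).mono (le_max_right _ _) fun s' _ hs' => ?_
      simp only [Prog.exec, h, if_false, hs']
  | loop b P => simp [Prog.loopFree] at hP

theorem ends_of_exec {P : Prog} {s : State} {Q : State → Prop} {B : ℕ} (hP : P.loopFree = true)
    (hB : P.time ≤ B) (h : Q (P.exec s)) : Ends P s B Q :=
  (ends_exec hP s).mono hB fun s' _ hs' => by rwa [hs']

theorem exec_frame {P : Prog} (hP : P.loopFree = true) (s : State) : Frame P s (P.exec s) := by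
  obtain ⟨t, s', hr, _, rfl⟩ := ends_exec hP s
  exact hr.frame

theorem Test.cost_pos (b : Test) : 0 < b.cost := by
  cases b <;> simp [Test.cost]

/-- The rule for loops: the invariant has the remaining running time as a parameter. -/
theorem Ends.loop {b : Test} {P : Prog} {s₀ : State} (Inv : ℕ → State → Prop)
    (h : ∀ k s, Frame P s₀ s → Inv k s → b.Holds s →
      ∃ B, Ends P s B (fun s' => ∃ k', Inv k' s' ∧ k' + B + b.cost ≤ k))
    {k : ℕ} (h₀ : Inv k s₀) :
    Ends (.loop b P) s₀ (k + b.cost) (fun s' => (∃ k', Inv k' s') ∧ ¬ b.Holds s') := by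
  suffices H : ∀ s, Frame P s₀ s → Inv k s →
      Ends (.loop b P) s (k + b.cost) (fun s' => (∃ k', Inv k' s') ∧ ¬ b.Holds s') from
    H s₀ (Frame.refl _ _) h₀
  clear h₀
  induction k using Nat.strong_induction_on with
  | _ k ih =>
    intro s hf hs
    by_cases hb : b.Holds s
    · obtain ⟨B, t, s', hr, ht, k', hk', hle⟩ := h k s hf hs hb
      -- The test costs at least one step, so the remaining time strictly decreases and the
      -- induction applies.
      have := b.cost_pos
      obtain ⟨t', s'', hr', ht', hq⟩ := ih k' (by omega) s' (hf.trans hr.frame) hk'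
      exact ⟨_, s'', .loop_true hb hr hr', by omega, hq⟩
    · exact ⟨_, s, .loop_false hb, by omega, ⟨k, hs⟩, hb⟩

/-- The cell `0` of an array of natural numbers. -/
abbrev nv (a : ℕ) : NExp := .get a (.lit 0)

/-- The cell `0` of an array of real numbers. -/
abbrev rv (a : ℕ) : RExp := .get a (.lit 0)

/-- Assign to the cell `0` of an array of natural numbers. -/
abbrev setN (a : ℕ) (e : NExp) : Prog := .setNat a (.lit 0) e

/-- Assign to the cell `0` of an array of real numbers. -/
abbrev setR (a : ℕ) (e : RExp) : Prog := .setReal a (.lit 0) e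

/-- Execute the body for the values `0, …, lim - 1` of the counter `i`. -/
abbrev forUp (i : ℕ) (lim : NExp) (body : Prog) : Prog :=
  .seq (setN i (.lit 0))
    (.loop (.natLt (nv i) lim) (.seq body (setN i (.add (nv i) (.lit 1)))))

/-- Execute the body for the values `start - 1, …, 0` of the counter `i`. -/
abbrev forDown (i : ℕ) (start : NExp) (body : Prog) : Prog :=
  .seq (setN i start)
    (.loop (.natLt (.lit 0) (nv i)) (.seq (setN i (.sub (nv i) (.lit 1))) body))

/-- An iteration pays `c` for the body, `6` for the increment and `lim.cost + 3` for the test. The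
invariant is required of the state with the raised counter. -/
theorem ends_forUp {i : ℕ} {lim : NExp} {body : Prog} {s₀ : State} {N c : ℕ}
    (Inv : ℕ → State → Prop) (hi : body.writesNat i = false)
    (hlim : ∀ s, Frame (forUp i lim body) s₀ s → lim.eval s = N)
    (h : ∀ k < N, ∀ s, Frame (forUp i lim body) s₀ s → s.nat i 0 = k → Inv k s →
      Ends body s c (fun s' => Inv (k + 1) (s'.putNat i 0 (k + 1))))
    (h₀ : Inv 0 (s₀.putNat i 0 0)) :
    Ends (forUp i lim body) s₀ (N * (c + lim.cost + 9) + lim.cost + 6)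
      (fun s' => s'.nat i 0 = N ∧ Inv N s') := by
  have hF : ∀ s, Frame (.seq body (setN i (.add (nv i) (.lit 1)))) (s₀.putNat i 0 0) s →
      Frame (forUp i lim body) s₀ s := by
    intro s hs
    refine ⟨fun a ha => ?_, fun a ha => ?_⟩
    · have ha' := ha
      simp only [Prog.writesNat, Bool.or_eq_false_iff, beq_eq_false_iff_ne] at ha
      rw [hs.1 a (by simp [Prog.writesNat, ha]), State.putNat_nat_of_ne _ _ _ ha.1]
    · simp only [Prog.writesReal, Bool.or_eq_false_iff] at ha
      rw [hs.2 a (by simp [Prog.writesReal, ha]), State.putNat_real]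
  have key : Ends (forUp i lim body) s₀ (3 + (N * (c + lim.cost + 9) + (2 + lim.cost + 1)))
      (fun s' => s'.nat i 0 = N ∧ Inv N s') := by
    refine Ends.seq (ends_exec (P := setN i (.lit 0)) rfl s₀) fun s₁ _ hs₁ => ?_
    simp only [Prog.exec, NExp.eval] at hs₁
    subst hs₁
    refine (Ends.loop (fun m s => ∃ k ≤ N, s.nat i 0 = k ∧ Inv k s ∧ m = (N - k) * (c + lim.cost + 9))
      ?_ (k := N * (c + lim.cost + 9)) ⟨0, by omega, by simp, h₀, by simp⟩).mono ?_ ?_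
    · rintro m s hf ⟨k, hk, hik, hinv, rfl⟩ hb
      simp only [Test.Holds, NExp.eval] at hb
      rw [hlim s (hF s hf), hik] at hb
      refine ⟨c + 6, ?_⟩
      refine Ends.seq (B' := 6) (h k hb s (hF s hf) hik hinv) fun s' hf' hs' => ?_
      refine ends_of_exec rfl le_rfl ?_
      have hik' : s'.nat i 0 = k := by rw [hf'.1 i hi, hik]
      simp only [Prog.exec, NExp.eval, hik']
      refine ⟨_, ⟨k + 1, hb, by simp, hs', rfl⟩, ?_⟩
      simp only [Test.cost, NExp.cost]
      obtain ⟨d, rfl⟩ : ∃ d, N = k + 1 + d := ⟨N - (k + 1), by omega⟩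
      rw [show k + 1 + d - (k + 1) = d by omega, show k + 1 + d - k = d + 1 by omega]
      ring_nf
      omega
    · simp only [Test.cost, NExp.cost]
      omega
    · rintro s' hf ⟨⟨m, k, hk, hik, hinv, rfl⟩, hb⟩
      simp only [Test.Holds, NExp.eval] at hb
      rw [hlim s' (hF s' hf), hik] at hb
      obtain rfl : k = N := by omega
      exact ⟨hik, hinv⟩
  exact key.mono (by omega) fun s' _ hs' => hs'

theorem ends_forDown {i : ℕ} {start : NExp} {body : Prog} {s₀ : State} {N c : ℕ}
    (Inv : ℕ → State → Prop) (hi : body.writesNat i = false) (hN : start.eval s₀ = N)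
    (h : ∀ k < N, ∀ s, Frame (forDown i start body) s₀ s → s.nat i 0 = k + 1 → Inv (k + 1) s →
      Ends body (s.putNat i 0 k) c (Inv k))
    (h₀ : Inv N (s₀.putNat i 0 N)) :
    Ends (forDown i start body) s₀ (N * (c + 10) + start.cost + 6) (Inv 0) := by
  have hF : ∀ s, Frame (.seq (setN i (.sub (nv i) (.lit 1))) body) (s₀.putNat i 0 N) s →
      Frame (forDown i start body) s₀ s := by
    intro s hs
    refine ⟨fun a ha => ?_, fun a ha => ?_⟩
    · simp only [Prog.writesNat, Bool.or_eq_false_iff, beq_eq_false_iff_ne] at ha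
      rw [hs.1 a (by simp [Prog.writesNat, ha]), State.putNat_nat_of_ne _ _ _ ha.1]
    · simp only [Prog.writesReal, Bool.or_eq_false_iff] at ha
      rw [hs.2 a (by simp [Prog.writesReal, ha]), State.putNat_real]
  have key : Ends (forDown i start body) s₀ ((start.cost + 2) + (N * (c + 10) + 4)) (Inv 0) := by
    refine Ends.seq ((ends_exec (P := setN i start) rfl s₀).mono
      (by simp only [Prog.time, NExp.cost]; omega) fun _ _ h => h) fun s₁ _ hs₁ => ?_
    simp only [Prog.exec, NExp.eval, hN] at hs₁
    subst hs₁
    refine (Ends.loop (fun m s => ∃ k ≤ N, s.nat i 0 = k ∧ Inv k s ∧ m = k * (c + 10))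
      ?_ (k := N * (c + 10)) ⟨N, le_rfl, by simp, h₀, by simp⟩).mono ?_ ?_
    · rintro m s hf ⟨k, hk, hik, hinv, rfl⟩ hb
      simp only [Test.Holds, NExp.eval] at hb
      obtain ⟨k, rfl⟩ : ∃ k', k = k' + 1 := ⟨k - 1, by omega⟩
      refine ⟨6 + c, ?_⟩
      refine Ends.seq (ends_exec (P := setN i (.sub (nv i) (.lit 1))) rfl s) fun s' _ hs' => ?_
      simp only [Prog.exec, NExp.eval, hik, Nat.add_sub_cancel] at hs'
      subst hs'
      refine (h k (by omega) s (hF s hf) hik hinv).mono le_rfl fun s' hf' hs' => ?_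
      refine ⟨_, ⟨k, by omega, ?_, hs', rfl⟩, ?_⟩
      · rw [hf'.1 i hi]
        simp
      · simp only [Test.cost, NExp.cost]
        ring_nf
        omega
    · simp only [Test.cost, NExp.cost]
      omega
    · rintro s' hf ⟨⟨m, k, hk, hik, hinv, rfl⟩, hb⟩
      simp only [Test.Holds, NExp.eval, hik] at hb
      obtain rfl : k = 0 := by omega
      exact hinv
  exact key.mono (by omega) fun s' _ hs' => hs'

end RealRAM

namespace TreeNetwork

variable {n : ℕ} (T : TreeNetwork n)

/-! ### The tree metric -/

/-- The vertex `u` lies in the subtree rooted at `z`. -/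
def Below (z u : Fin n) : Prop := ∃ k : ℕ, T.parent^[k] u = z

theorem below_refl (u : Fin n) : T.Below u u := ⟨0, rfl⟩

theorem below_root (u : Fin n) : T.Below T.root u := T.exists_iterate_parent u

theorem below_parent (u : Fin n) : T.Below (T.parent u) u := ⟨1, rfl⟩

variable {T}

theorem Below.trans {z u v : Fin n} (h : T.Below z u) (h' : T.Below u v) : T.Below z v := by
  obtain ⟨k, rfl⟩ := h
  obtain ⟨l, rfl⟩ := h'
  exact ⟨k + l, Function.iterate_add_apply _ _ _ _⟩

theorem Below.eq_or_below_parent {z u : Fin n} (h : T.Below z u) :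
    z = u ∨ T.Below z (T.parent u) := by
  obtain ⟨k, hk⟩ := h
  cases k with
  | zero => exact Or.inl hk.symm
  | succ k => exact Or.inr ⟨k, hk⟩

theorem below_of_parent {z u : Fin n} (h : T.Below z (T.parent u)) : T.Below z u :=
  h.trans (T.below_parent u)

theorem iterate_parent_root (k : ℕ) : T.parent^[k] T.root = T.root :=
  Function.iterate_fixed T.parent_root k

theorem eq_root_of_below {z : Fin n} (h : T.Below z T.root) : z = T.root := by
  obtain ⟨k, hk⟩ := h
  rw [← hk, iterate_parent_root]

/-- Going around the cycle often enough takes at least as many steps as the way to the root, which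
is never left again. -/
theorem eq_root_of_iterate {u : Fin n} {k : ℕ} (hk : 0 < k) (h : T.parent^[k] u = u) :
    u = T.root := by
  obtain ⟨m, hm⟩ := T.exists_iterate_parent u
  have h1 : T.parent^[k * (m + 1)] u = u := by
    rw [Function.iterate_mul]
    exact Function.iterate_fixed h _
  have h2 : m ≤ k * (m + 1) := by nlinarith
  obtain ⟨d, hd⟩ := Nat.exists_eq_add_of_le h2
  rw [hd, add_comm, Function.iterate_add_apply, hm, iterate_parent_root] at h1
  exact h1.symm

theorem parent_ne {u : Fin n} (h : u ≠ T.root) : T.parent u ≠ u :=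
  fun h' => h (eq_root_of_iterate (k := 1) one_pos h')

theorem Below.antisymm {u v : Fin n} (h : T.Below u v) (h' : T.Below v u) : u = v := by
  obtain ⟨k, hk⟩ := h
  obtain ⟨l, hl⟩ := h'
  rcases Nat.eq_zero_or_pos (k + l) with h0 | h0
  · obtain rfl : k = 0 := by omega
    exact hk.symm
  · have h1 : T.parent^[k + l] u = u := by rw [Function.iterate_add_apply, hl, hk]
    have hu := eq_root_of_iterate h0 h1
    rw [← hl, hu, iterate_parent_root]

theorem not_below_parent {u : Fin n} (h : u ≠ T.root) : ¬ T.Below u (T.parent u) :=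
  fun h' => parent_ne h ((T.below_parent u).antisymm h')

theorem Below.total {a b u : Fin n} (h : T.Below a u) (h' : T.Below b u) :
    T.Below a b ∨ T.Below b a := by
  obtain ⟨k, rfl⟩ := h
  obtain ⟨l, rfl⟩ := h'
  rcases le_total k l with hkl | hkl
  · obtain ⟨d, rfl⟩ := Nat.exists_eq_add_of_le hkl
    exact Or.inr ⟨d, by rw [add_comm, Function.iterate_add_apply]⟩
  · obtain ⟨d, rfl⟩ := Nat.exists_eq_add_of_le hkl
    exact Or.inl ⟨d, by rw [add_comm, Function.iterate_add_apply]⟩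

theorem depth_parent {u : Fin n} (h : u ≠ T.root) : T.depth u = T.depth (T.parent u) + 1 := by
  unfold depth
  have h0 : ¬ T.parent^[0] u = T.root := h
  rw [Nat.find_comp_succ (T.exists_iterate_parent u)
    (by obtain ⟨k, hk⟩ := T.exists_iterate_parent (T.parent u); exact ⟨k, hk⟩) h0]
  rfl

theorem depth_eq_zero {u : Fin n} : T.depth u = 0 ↔ u = T.root := by
  unfold depth
  rw [Nat.find_eq_zero]
  rfl

/-- The edge from `u` to its parent is the only one that leaves the subtree of `u`. -/
theorem parent_mem_support {u a b : Fin n} (p : T.graph.Walk a b) (ha : T.Below u a)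
    (hb : ¬ T.Below u b) : T.parent u ∈ p.support := by
  induction p with
  | nil => exact absurd ha hb
  | @cons a c b hadj p ih =>
    rw [SimpleGraph.Walk.support_cons, List.mem_cons]
    by_cases hc : T.Below u c
    · exact Or.inr (ih hc hb)
    · have h' : a ≠ c ∧ (T.parent a = c ∨ T.parent c = a) := hadj
      rcases h'.2 with h1 | h1
      · rcases ha.eq_or_below_parent with h2 | h2
        · subst h2
          rw [h1]
          exact Or.inr p.start_mem_support
        · rw [h1] at h2
          exact absurd h2 hc
      · rw [← h1] at ha
        exact absurd (below_of_parent ha) hc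

theorem path_isPath (u v : Fin n) : (T.path u v).IsPath :=
  (T.graph_isTree.existsUnique_path u v).choose_spec.1

theorem eq_path {u v : Fin n} {p : T.graph.Walk u v} (hp : p.IsPath) : p = T.path u v :=
  (T.graph_isTree.existsUnique_path u v).choose_spec.2 p hp

theorem vertexDist_eq {u v : Fin n} {p : T.graph.Walk u v} (hp : p.IsPath) :
    T.vertexDist u v = (p.darts.map fun e => T.edgeLen e.fst e.snd).sum := by
  rw [eq_path hp, vertexDist]

theorem vertexDist_self (u : Fin n) : T.vertexDist u u = 0 := by
  rw [vertexDist_eq SimpleGraph.Walk.IsPath.nil]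
  rfl

theorem edgeLen_comm {u v : Fin n} (h : T.graph.Adj u v) : T.edgeLen u v = T.edgeLen v u := by
  have h' : u ≠ v ∧ (T.parent u = v ∨ T.parent v = u) := h
  have h2 : ¬ (T.parent u = v ∧ T.parent v = u) := by
    rintro ⟨h1, h2⟩
    exact h'.1 (Below.antisymm ⟨1, h2⟩ ⟨1, h1⟩)
  unfold edgeLen
  rcases h'.2 with h1 | h1
  · rw [if_pos h1, if_neg fun h3 => h2 ⟨h1, h3⟩]
  · rw [if_pos h1, if_neg fun h3 => h2 ⟨h3, h1⟩]

theorem vertexDist_comm (u v : Fin n) : T.vertexDist u v = T.vertexDist v u := by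
  rw [vertexDist_eq (path_isPath u v), vertexDist_eq (path_isPath u v).reverse,
    SimpleGraph.Walk.darts_reverse, List.map_reverse, List.sum_reverse, List.map_map]
  congr 1
  refine List.map_congr_left fun d _ => ?_
  exact edgeLen_comm d.adj

theorem vertexDist_nonneg (u v : Fin n) : 0 ≤ T.vertexDist u v := by
  refine List.sum_nonneg fun x hx => ?_
  obtain ⟨d, _, rfl⟩ := List.mem_map.1 hx
  unfold edgeLen
  split_ifs
  · exact T.len_nonneg _
  · exact T.len_nonneg _

/-- The path from the parent to `y` avoids `u`: after a visit of `u` it would have to return through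
the parent. So it can be prolonged by the edge of `u`. -/
theorem vertexDist_step {u y : Fin n} (h : ¬ T.Below u y) :
    T.vertexDist u y = T.len u + T.vertexDist (T.parent u) y := by
  have hu : u ≠ T.root := by
    rintro rfl
    exact h (T.below_root y)
  have hne := parent_ne hu
  have hadj : T.graph.Adj u (T.parent u) := ⟨hne.symm, Or.inl rfl⟩
  have hp := path_isPath (T := T) (T.parent u) y
  have hu' : u ∉ (T.path (T.parent u) y).support := by
    intro hmem
    have h1 := parent_mem_support ((T.path (T.parent u) y).dropUntil u hmem) (T.below_refl u) h
    have h2 := (T.path (T.parent u) y).take_spec hmem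
    have h3 := hp
    rw [← h2] at h3
    have h4 := h3.support_nodup
    rw [SimpleGraph.Walk.support_append, List.nodup_append] at h4
    have h5 : T.parent u ∈ ((T.path (T.parent u) y).dropUntil u hmem).support.tail := by
      rw [← SimpleGraph.Walk.cons_tail_support, List.mem_cons] at h1
      exact h1.resolve_left hne
    exact h4.2.2 _ (SimpleGraph.Walk.start_mem_support _) _ h5 rfl
  have hc : (SimpleGraph.Walk.cons hadj (T.path (T.parent u) y)).IsPath :=
    (SimpleGraph.Walk.cons_isPath_iff _ _).2 ⟨hp, hu'⟩
  rw [vertexDist_eq hc, vertexDist_eq hp, SimpleGraph.Walk.darts_cons, List.map_cons,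
    List.sum_cons]
  congr 1
  unfold edgeLen
  rw [if_pos rfl]

/-- A path that leaves the subtree of `u` runs through the edge above `u`. -/
theorem vertexDist_cross {u y z : Fin n} (hy : T.Below u y) (hz : ¬ T.Below u z) :
    T.vertexDist y z = T.vertexDist y u + T.len u + T.vertexDist (T.parent u) z := by
  obtain ⟨k, hk⟩ := hy
  induction k generalizing y with
  | zero =>
    obtain rfl : y = u := hk
    rw [vertexDist_self, vertexDist_step hz, zero_add]
  | succ k ih =>
    by_cases hyu : y = u
    · subst hyu
      rw [vertexDist_self, vertexDist_step hz, zero_add]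
    · have h1 : T.Below u (T.parent y) := ⟨k, hk⟩
      have h2 : ¬ T.Below y z := fun h => hz ((below_of_parent h1).trans h)
      have h3 : ¬ T.Below y u := fun h => hyu (h.antisymm (below_of_parent h1))
      rw [vertexDist_step h2, vertexDist_step h3, ih hk]
      ring

theorem vertexDist_parent {u y : Fin n} (hu : u ≠ T.root) (hy : T.Below u y) :
    T.vertexDist y (T.parent u) = T.vertexDist y u + T.len u := by
  rw [vertexDist_cross hy (not_below_parent hu), vertexDist_self, add_zero]

/-- Triangle inequalities along a single edge are all that is needed to show that the greedy centers
cover. -/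
theorem vertexDist_le_parent_add (y u : Fin n) :
    T.vertexDist y u ≤ T.vertexDist y (T.parent u) + T.len u := by
  have hl := T.len_nonneg u
  by_cases hu : u = T.root
  · rw [hu, T.parent_root, ← hu]
    linarith
  by_cases hy : T.Below u y
  · rw [vertexDist_parent hu hy]
    linarith
  · rw [vertexDist_comm, vertexDist_step hy, vertexDist_comm y]
    linarith

theorem vertexDist_parent_le_add (y u : Fin n) :
    T.vertexDist y (T.parent u) ≤ T.vertexDist y u + T.len u := by
  have hl := T.len_nonneg u
  by_cases hu : u = T.root
  · rw [hu, T.parent_root, ← hu]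
    linarith
  by_cases hy : T.Below u y
  · rw [vertexDist_parent hu hy]
  · rw [vertexDist_comm y u, vertexDist_step hy, vertexDist_comm _ y]
    linarith

theorem point_ext {x y : T.Point} (hv : x.vertex = y.vertex) (ho : x.offset = y.offset) :
    x = y := by
  cases x
  cases y
  subst hv ho
  rfl

theorem dist_le_parent_add (x : T.Point) (u : Fin n) :
    T.dist x u ≤ T.dist x (T.parent u) + T.len u := by
  unfold dist
  have h1 := T.vertexDist_le_parent_add x.vertex u
  have h2 := T.vertexDist_le_parent_add (T.parent x.vertex) u
  rw [← min_add_add_right]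
  exact min_le_min (by linarith) (by linarith)

theorem dist_parent_le_add (x : T.Point) (u : Fin n) :
    T.dist x (T.parent u) ≤ T.dist x u + T.len u := by
  unfold dist
  have h1 := T.vertexDist_parent_le_add x.vertex u
  have h2 := T.vertexDist_parent_le_add (T.parent x.vertex) u
  rw [← min_add_add_right]
  exact min_le_min (by linarith) (by linarith)

theorem dist_vertex_le (x : T.Point) : T.dist x x.vertex ≤ x.offset := by
  unfold dist
  rw [vertexDist_self, add_zero]
  exact min_le_left _ _

theorem dist_parent_vertex_le (x : T.Point) :
    T.dist x (T.parent x.vertex) ≤ T.len x.vertex - x.offset := by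
  unfold dist
  rw [vertexDist_self, add_zero]
  exact min_le_right _ _

theorem dist_nonneg (x : T.Point) (u : Fin n) : 0 ≤ T.dist x u := by
  have h1 := x.offset_nonneg
  have h2 := x.offset_le
  have h3 := T.vertexDist_nonneg x.vertex u
  have h4 := T.vertexDist_nonneg (T.parent x.vertex) u
  exact le_min (by linarith) (by linarith)

variable (T) in
/-- A bound for all distances in the network. -/
noncomputable def totalLen : ℝ := ∑ v, (T.len v + T.len v)

/-- The way to the root uses each edge at most once. -/
theorem vertexDist_root_le (v : Fin n) : T.vertexDist v T.root ≤ ∑ u, T.len u := by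
  have h1 : ∀ d (v : Fin n), T.depth v = d →
      T.vertexDist v T.root = ∑ i ∈ Finset.range d, T.len (T.parent^[i] v) := by
    intro d
    induction d with
    | zero =>
      intro v hv
      rw [depth_eq_zero.1 hv, vertexDist_self]
      rfl
    | succ d ih =>
      intro v hv
      have hv' : v ≠ T.root := by
        intro h
        rw [depth_eq_zero.2 h] at hv
        omega
      have hd : T.depth (T.parent v) = d := by
        have := depth_parent hv'
        omega
      rw [vertexDist_step fun h => hv' (eq_root_of_below h), ih _ hd, Finset.sum_range_succ', add_comm]
      rfl
  rw [h1 _ v rfl]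
  have hinj : Set.InjOn (fun i => T.parent^[i] v) (Finset.range (T.depth v) : Set ℕ) := by
    -- A repeated vertex would lie on a cycle of `parent`, hence be the root before the depth is
    -- reached.
    have aux : ∀ i j, i < j → j < T.depth v → T.parent^[i] v ≠ T.parent^[j] v := by
      intro i j hij hj h
      obtain ⟨d, rfl⟩ := Nat.exists_eq_add_of_lt hij
      have h2 : T.parent^[d + 1] (T.parent^[i] v) = T.parent^[i] v := by
        rw [← Function.iterate_add_apply, show d + 1 + i = i + d + 1 by ring, ← h]
      have h3 := eq_root_of_iterate (Nat.succ_pos d) h2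
      exact Nat.find_min (T.exists_iterate_parent v) (m := i) (by unfold depth at hj; omega) h3
    intro i hi j hj h
    simp only [Finset.coe_range, Set.mem_Iio] at hi hj
    rcases lt_trichotomy i j with h' | h' | h'
    · exact absurd h (aux i j h' hj)
    · exact h'
    · exact absurd h.symm (aux j i h' hi)
  rw [← Finset.sum_image (f := T.len) hinj]
  exact Finset.sum_le_sum_of_subset_of_nonneg (Finset.subset_univ _) fun u _ _ => T.len_nonneg u

theorem vertexDist_le_root (u v : Fin n) :
    T.vertexDist u v ≤ T.vertexDist u T.root + T.vertexDist v T.root := by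
  obtain ⟨k, hk⟩ := T.exists_iterate_parent v
  induction k generalizing v with
  | zero =>
    obtain rfl : v = T.root := hk
    rw [vertexDist_self, add_zero]
  | succ k ih =>
    by_cases hv : v = T.root
    · rw [hv, vertexDist_self, add_zero]
    · have h1 := ih (T.parent v) hk
      have h2 := T.vertexDist_le_parent_add u v
      rw [vertexDist_step (u := v) fun h => hv (eq_root_of_below h)]
      linarith

/-- The detour through the root uses each edge at most twice, which is why `totalLen` doubles the
lengths. -/
theorem dist_le_totalLen (x : T.Point) (u : Fin n) : T.dist x u ≤ T.totalLen := by
  have h0 : T.totalLen = ∑ v, T.len v + ∑ v, T.len v := by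
    rw [totalLen, Finset.sum_add_distrib]
  have h1 := vertexDist_le_root (T := T) (T.parent x.vertex) u
  have h2 := vertexDist_root_le (T := T) u
  have h3 := vertexDist_root_le (T := T) x.vertex
  have h4 := x.offset_nonneg
  refine (min_le_right _ _).trans ?_
  by_cases hv : x.vertex = T.root
  · have h5 := T.len_root
    rw [hv] at h3
    rw [hv, T.parent_root] at h1 ⊢
    linarith
  · have h5 := vertexDist_step (u := x.vertex) fun h => hv (eq_root_of_below h)
    linarith

theorem totalLen_nonneg : 0 ≤ T.totalLen :=
  Finset.sum_nonneg fun v _ => add_nonneg (T.len_nonneg v) (T.len_nonneg v)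

end TreeNetwork

/-! ### The greedy algorithm for a fixed value -/

/-- The linear order by absolute values, where a negative number precedes its absolute value. -/
def Prec (a b : ℝ) : Prop := (0 ≤ a + b ∧ a ≤ b) ∨ (a + b < 0 ∧ b ≤ a)

theorem Prec.refl (a : ℝ) : Prec a a := by
  rcases le_or_gt 0 (a + a) with h | h
  · exact Or.inl ⟨h, le_rfl⟩
  · exact Or.inr ⟨h, le_rfl⟩

theorem Prec.of_not {a b : ℝ} (h : ¬ Prec a b) : Prec b a := by
  unfold Prec at *
  push Not at h
  rcases le_or_gt 0 (a + b) with h' | h'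
  · exact Or.inl ⟨by linarith, (h.1 h').le⟩
  · exact Or.inr ⟨by linarith, (h.2 h').le⟩

theorem Prec.trans {a b c : ℝ} (h : Prec a b) (h' : Prec b c) : Prec a c := by
  unfold Prec at *
  rcases le_or_gt 0 (a + c) with h3 | h3 <;> rcases h with h | h <;> rcases h' with h' | h' <;>
    first
    | exact Or.inl ⟨by linarith, by linarith⟩
    | exact Or.inr ⟨by linarith, by linarith⟩

theorem Prec.abs_le {a b : ℝ} (h : Prec a b) : |a| ≤ |b| := by
  rcases h with h | h
  · rw [abs_of_nonneg (show 0 ≤ b by linarith)]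
    exact _root_.abs_le.2 ⟨by linarith, h.2⟩
  · rw [abs_of_neg (show b < 0 by linarith)]
    exact _root_.abs_le.2 ⟨by linarith, by linarith⟩

/-- Transport over an edge: the distance to the center behind `b` grows, while a need below this
distance shrinks. For positive `b` the rule fails, since `a` may be minus a distance that outgrows
the shrinking need. -/
theorem Prec.sub {a b l : ℝ} (h : Prec a b) (hb : b < 0) (hl : 0 ≤ l) : Prec (a - l) (b - l) := by
  rcases h with h | h
  · exact absurd h.2 (by linarith)
  · exact Or.inr ⟨by linarith, by linarith⟩

/-- The inequality is strict because a center wins ties against a need. -/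
theorem Prec.lt_neg {a b : ℝ} (h : Prec a b) (hb : b < 0) : a < -b := by
  rcases h with h | h <;> linarith

namespace TreeNetwork

variable {n : ℕ} {T : TreeNetwork n}

theorem bottomUp_induction {P : Fin n → Prop}
    (h : ∀ v, (∀ u, u ≠ T.root → T.parent u = v → P u) → P v) (v : Fin n) : P v := by
  set D := Finset.univ.sup T.depth with hD
  have hle : ∀ u, T.depth u ≤ D := fun u => Finset.le_sup (Finset.mem_univ u)
  induction hm : D - T.depth v using Nat.strong_induction_on generalizing v with
  | _ m ih =>
    refine h v fun u hu huv => ih (D - T.depth u) ?_ u rfl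
    have h1 := depth_parent hu
    rw [huv] at h1
    have h2 := hle u
    omega

theorem topDown_induction {P : Fin n → Prop} (hroot : P T.root)
    (h : ∀ v, v ≠ T.root → P (T.parent v) → P v) (v : Fin n) : P v := by
  induction hm : T.depth v generalizing v with
  | zero => rwa [depth_eq_zero.1 hm]
  | succ m ih =>
    by_cases hv : v = T.root
    · rwa [hv]
    · have h1 := depth_parent hv
      exact h v hv (ih _ (by omega))

/-- The outcome of the greedy algorithm for the reaches `ρ`: at every vertex, a nonnegative number
is the distance within which the vertices of the subtree still need a center, a negative one is
minus the distance to a center in the subtree. -/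
structure IsGreedy (T : TreeNetwork n) (ρ s : Fin n → ℝ) : Prop where
  prec_reach : ∀ v, Prec (s v) (ρ v)
  prec_child : ∀ u, u ≠ T.root → Prec (s (T.parent u)) (s u - T.len u)
  eq_or : ∀ v, s v = ρ v ∨ ∃ u, u ≠ T.root ∧ T.parent u = v ∧ s v = s u - T.len u

variable (T) in
/-- The greedy algorithm places a center at the root or on the edge above the vertex. -/
def Opens (s : Fin n → ℝ) (v : Fin n) : Prop := 0 ≤ s v ∧ (v = T.root ∨ s v - T.len v < 0)

/-- The center that belongs to a vertex. -/
noncomputable def openPoint {s : Fin n → ℝ} {v : Fin n} (h : T.Opens s v) : T.Point where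
  vertex := v
  offset := if v = T.root then 0 else s v
  offset_nonneg := by
    split_ifs
    · exact le_rfl
    · exact h.1
  offset_le := by
    split_ifs with hv
    · exact T.len_nonneg v
    · have := h.2.resolve_left hv
      linarith

theorem openPoint_near {s : Fin n → ℝ} {v : Fin n} (h : T.Opens s v) :
    T.dist (openPoint h) v ≤ s v := by
  refine (dist_vertex_le (openPoint h)).trans ?_
  unfold openPoint
  split_ifs
  · exact h.1
  · exact le_rfl

/-- A negative value stems from a child. Either the child has a negative value as well, or the
center on the edge above it, at offset `s u`, has distance `len u - s u` from the upper end. -/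
theorem IsGreedy.exists_near_of_neg {ρ s : Fin n → ℝ} (hg : T.IsGreedy ρ s) (hρ : ∀ v, 0 ≤ ρ v)
    (v : Fin n) : s v < 0 → ∃ z, ∃ h : T.Opens s z, T.dist (openPoint h) v ≤ - s v := by
  refine bottomUp_induction (T := T) (P := fun v => s v < 0 → ∃ z, ∃ h : T.Opens s z,
    T.dist (openPoint h) v ≤ - s v) (fun v ih hv => ?_) v
  rcases hg.eq_or v with h | ⟨u, hu, rfl, h⟩
  · exact absurd (hρ v) (by linarith)
  · rcases lt_or_ge (s u) 0 with h' | h'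
    · obtain ⟨z, hz, hd⟩ := ih u hu rfl h'
      exact ⟨z, hz, by linarith [dist_parent_le_add (openPoint hz) u]⟩
    · have hz : T.Opens s u := ⟨h', Or.inr (by linarith)⟩
      refine ⟨u, hz, (dist_parent_vertex_le (openPoint hz)).trans ?_⟩
      simp only [openPoint, if_neg hu]
      linarith

/-- From the root downwards: a need that is not met on the edge above `v` is handed to the parent,
whose value has no larger absolute value. The center near the parent then serves `v` too. -/
theorem IsGreedy.exists_near {ρ s : Fin n → ℝ} (hg : T.IsGreedy ρ s) (hρ : ∀ v, 0 ≤ ρ v)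
    (v : Fin n) : ∃ z, ∃ h : T.Opens s z, T.dist (openPoint h) v ≤ |s v| := by
  refine topDown_induction (T := T) (P := fun v => ∃ z, ∃ h : T.Opens s z,
    T.dist (openPoint h) v ≤ |s v|) ?_ (fun v hv ih => ?_) v
  · rcases lt_or_ge (s T.root) 0 with h | h
    · rw [abs_of_neg h]
      exact hg.exists_near_of_neg hρ _ h
    · rw [abs_of_nonneg h]
      exact ⟨_, ⟨h, Or.inl rfl⟩, openPoint_near _⟩
  · rcases lt_or_ge (s v) 0 with h | h
    · rw [abs_of_neg h]
      exact hg.exists_near_of_neg hρ _ h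
    · rw [abs_of_nonneg h]
      rcases lt_or_ge (s v - T.len v) 0 with h' | h'
      · exact ⟨v, ⟨h, Or.inr h'⟩, openPoint_near _⟩
      · obtain ⟨z, hz, hd⟩ := ih
        have h1 := (hg.prec_child v hv).abs_le
        rw [abs_of_nonneg h'] at h1
        exact ⟨z, hz, by linarith [dist_le_parent_add (openPoint hz) v]⟩

theorem IsGreedy.exists_cover {ρ s : Fin n → ℝ} (hg : T.IsGreedy ρ s) (hρ : ∀ v, 0 ≤ ρ v)
    (v : Fin n) : ∃ z, ∃ h : T.Opens s z, T.dist (openPoint h) v ≤ ρ v := by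
  obtain ⟨z, hz, hd⟩ := hg.exists_near hρ v
  have h1 := (hg.prec_reach v).abs_le
  rw [abs_of_nonneg (hρ v)] at h1
  exact ⟨z, hz, hd.trans h1⟩

/-- The need of the subtree of `v` is the one of its vertex `u`. -/
structure IsWitness (T : TreeNetwork n) (ρ s : Fin n → ℝ) (v u : Fin n) : Prop where
  below : T.Below v u
  eq : ∀ z, T.Below z u → T.Below v z → s z = ρ u - T.vertexDist u z
  nonneg : ∀ z, T.Below z u → T.Below v z → 0 ≤ s z

/-- Descend to a child that determines the value until a vertex with its own reach is met; the
values do not decrease on the way down and stay nonnegative. -/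
theorem IsGreedy.exists_witness {ρ s : Fin n → ℝ} (hg : T.IsGreedy ρ s) (v : Fin n) :
    0 ≤ s v → ∃ u, T.IsWitness ρ s v u := by
  refine bottomUp_induction (T := T) (P := fun v => 0 ≤ s v → ∃ u, T.IsWitness ρ s v u)
    (fun v ih hv => ?_) v
  rcases hg.eq_or v with h | ⟨c, hc, rfl, h⟩
  · refine ⟨v, T.below_refl v, fun z h1 h2 => ?_, fun z h1 h2 => ?_⟩
    · rw [h1.antisymm h2, vertexDist_self, h, sub_zero]
    · rwa [h1.antisymm h2]
  · have hl := T.len_nonneg c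
    obtain ⟨u, hu⟩ := ih c hc rfl (by linarith)
    have key : ∀ z, T.Below z u → T.Below (T.parent c) z → z = T.parent c ∨ T.Below c z := by
      intro z h1 h2
      rcases h1.total hu.below with h3 | h3
      · rcases h3.eq_or_below_parent with h4 | h4
        · exact Or.inr (h4 ▸ T.below_refl _)
        · exact Or.inl (h4.antisymm h2)
      · exact Or.inr h3
    refine ⟨u, (T.below_parent c).trans hu.below, fun z h1 h2 => ?_, fun z h1 h2 => ?_⟩
    · rcases key z h1 h2 with rfl | h3
      · rw [h, vertexDist_parent hc hu.below, hu.eq c hu.below (T.below_refl c)]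
        ring
      · exact hu.eq z h1 h3
    · rcases key z h1 h2 with rfl | h3
      · exact hv
      · exact hu.nonneg z h1 h3

/-- A witness cannot be served from a center that the greedy algorithm has taken into account. -/
theorem IsWitness.lt_of_prec {ρ s : Fin n → ℝ} (hg : T.IsGreedy ρ s) {v u : Fin n}
    (hu : T.IsWitness ρ s v u) {z : Fin n} (hz : T.Below v z) {c : ℝ} (hc : 0 < c)
    (h : Prec (s z) (-c)) : ρ u < c + T.vertexDist z u := by
  obtain ⟨k, hk⟩ := hz
  induction k generalizing z c with
  | zero =>
    obtain rfl : z = v := hk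
    have h1 := h.lt_neg (by linarith)
    rw [hu.eq z hu.below (T.below_refl z)] at h1
    rw [vertexDist_comm]
    linarith
  | succ k ih =>
    -- At an ancestor of `u`, the value is the remaining reach of `u`, and it is less than the
    -- distance `c` to the center. Elsewhere one climbs an edge, which adds the same length to the
    -- distance to the center and to the walk towards `u`.
    by_cases hz : T.Below z u
    · have h1 := h.lt_neg (by linarith)
      rw [hu.eq z hz ⟨k + 1, hk⟩] at h1
      rw [vertexDist_comm]
      linarith
    · have hzr : z ≠ T.root := by
        rintro rfl
        exact hz (T.below_root u)
      have hl := T.len_nonneg z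
      have h1 := (hg.prec_child z hzr).trans (h.sub (by linarith) hl)
      rw [show -c - T.len z = -(c + T.len z) by ring] at h1
      have h2 := ih (by linarith) h1 hk
      rw [vertexDist_step hz]
      linarith

theorem IsWitness.center_below {ρ s : Fin n → ℝ} {v u : Fin n} (hu : T.IsWitness ρ s v u)
    (hv : T.Opens s v) {x : T.Point} (hx : T.dist x u ≤ ρ u) :
    T.Below v x.vertex ∧ (v ≠ T.root → x.vertex = v → x.offset ≤ s v) := by
  by_cases hvr : v = T.root
  · exact ⟨hvr ▸ T.below_root _, fun h => absurd hvr h⟩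
  have h1 := hv.2.resolve_left hvr
  have h2 := hu.eq v hu.below (T.below_refl v)
  have h3 := x.offset_nonneg
  have h4 := x.offset_le
  -- To leave the subtree, one covers the whole edge above `v`, while only `s v` of the reach of `u`
  -- is left at `v`, less than the length of this edge.
  have key : ∀ y, ¬ T.Below v y → ρ u < T.vertexDist y u := by
    intro y hy
    rw [vertexDist_comm, vertexDist_cross hu.below hy]
    linarith [T.vertexDist_nonneg (T.parent v) y]
  constructor
  · by_contra hb
    have h5 := key _ hb
    have h6 := key _ fun h => hb (below_of_parent h)
    exact absurd hx (not_le.2 (lt_min (by linarith) (by linarith)))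
  · rintro _ hxv
    have h6 := key _ (not_below_parent hvr)
    rw [← hxv] at h6
    rcases min_le_iff.1 hx with h | h
    · rw [hxv, vertexDist_comm] at h
      linarith
    · linarith

/-- If the witness `u` of the upper vertex lies below `v'`, its need is nonnegative at the parent of
`v'`, whereas the value at `v'` minus the length of the edge is negative. Otherwise `u` is out of
reach of the greedy center above `v'`, and `x`, which serves `u'`, is no higher than this center,
hence no closer to `u`. -/
theorem IsGreedy.center_ne {ρ s : Fin n → ℝ} (hg : T.IsGreedy ρ s) {v v' u u' : Fin n}
    (hv' : T.Opens s v') (hne : v ≠ v') (hb : T.Below v v')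
    (hu : T.IsWitness ρ s v u) (hu' : T.IsWitness ρ s v' u') {x : T.Point}
    (hx : T.dist x u ≤ ρ u) (hx' : T.dist x u' ≤ ρ u') : False := by
  have hvr : v' ≠ T.root := by
    intro h
    rw [h] at hb hne
    exact hne (eq_root_of_below hb)
  have hneg := hv'.2.resolve_left hvr
  have hbp : T.Below v (T.parent v') := hb.eq_or_below_parent.resolve_left hne
  obtain ⟨hxb, hxo⟩ := hu'.center_below hv' hx'
  by_cases hbu : T.Below v' u
  · have h1 := hu.nonneg (T.parent v') ((T.below_parent v').trans hbu) hbp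
    rw [hu.eq (T.parent v') ((T.below_parent v').trans hbu) hbp, vertexDist_parent hvr hbu] at h1
    have h2 := hu.eq v' hbu hb
    linarith
  · have h1 := hu.lt_of_prec hg hbp (c := T.len v' - s v') (by linarith)
      (by rw [neg_sub]; exact hg.prec_child v' hvr)
    have h2 := x.offset_nonneg
    have h3 := hv'.1
    have h4 := T.vertexDist_nonneg
    refine absurd hx (not_le.2 (h1.trans_le (le_min ?_ ?_)))
    · rw [vertexDist_cross hxb hbu]
      linarith [h4 x.vertex v']
    · rcases hxb.eq_or_below_parent with h | h
      · have := hxo hvr h.symm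
        rw [← h] at *
        linarith
      · rw [vertexDist_cross h hbu]
        linarith [h4 (T.parent x.vertex) v', x.offset_le]

open Classical in
variable (T) in
/-- The number of centers of the greedy algorithm. -/
noncomputable def openCount (s : Fin n → ℝ) : ℕ := (Finset.univ.filter (T.Opens s)).card

/-- Send each open vertex to a given center that serves its witness. The vertex of that center lies
below the open vertex, so two open vertices with the same center would be comparable, which
`IsGreedy.center_ne` excludes. -/
theorem IsGreedy.openCount_le {ρ s : Fin n → ℝ} (hg : T.IsGreedy ρ s) {p : ℕ}
    (c : Fin p → T.Point) (hc : ∀ u, ∃ i, T.dist (c i) u ≤ ρ u) : T.openCount s ≤ p := by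
  classical
  have h1 : ∀ v : {v // T.Opens s v}, ∃ i : Fin p, ∃ u, T.IsWitness ρ s v u ∧
      T.dist (c i) u ≤ ρ u := by
    rintro ⟨v, hv⟩
    obtain ⟨u, hu⟩ := hg.exists_witness v hv.1
    obtain ⟨i, hi⟩ := hc u
    exact ⟨i, u, hu, hi⟩
  choose f g hw hd using h1
  have hinj : Function.Injective f := by
    rintro ⟨v, hv⟩ ⟨v', hv'⟩ h
    by_contra hne
    have hne' : v ≠ v' := fun h => hne (Subtype.ext h)
    have hx := hd ⟨v, hv⟩
    have hx' := hd ⟨v', hv'⟩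
    rw [← h] at hx'
    have hb := ((hw ⟨v, hv⟩).center_below hv hx).1
    have hb' := ((hw ⟨v', hv'⟩).center_below hv' hx').1
    rcases hb.total hb' with h2 | h2
    · exact hg.center_ne hv' hne' h2 (hw ⟨v, hv⟩) (hw ⟨v', hv'⟩) hx hx'
    · exact hg.center_ne hv hne'.symm h2 (hw ⟨v', hv'⟩) (hw ⟨v, hv⟩) hx' hx
  have h2 := Fintype.card_le_of_injective f hinj
  rw [Fintype.card_fin, Fintype.card_subtype] at h2
  exact h2

/-! ### Reaches -/

variable (T) in
/-- The slope of the reach of a vertex. -/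
noncomputable def reachSlope (v : Fin n) : ℝ := if T.w v ≤ 0 then 0 else 1 / T.w v

variable (T) in
/-- The intercept of the reach of a vertex: a vertex of weight `0` may be served from anywhere. -/
noncomputable def reachIcpt (v : Fin n) : ℝ := if T.w v ≤ 0 then T.totalLen else 0

variable (T) in
/-- The distance within which a vertex needs a center. -/
noncomputable def reach (α : ℝ) (v : Fin n) : ℝ := T.reachSlope v * α + T.reachIcpt v

theorem reach_nonneg {α : ℝ} (hα : 0 ≤ α) (v : Fin n) : 0 ≤ T.reach α v := by
  unfold reach reachSlope reachIcpt
  have := T.totalLen_nonneg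
  split_ifs with h
  · linarith
  · push Not at h
    positivity

/-- Dividing by the weight turns the weighted condition into a plain radius that is affine in `α`,
as the symbolic run requires. For weight `0` the radius `totalLen` imposes no condition. -/
theorem dist_mul_le_iff {α : ℝ} (hα : 0 ≤ α) (x : T.Point) (v : Fin n) :
    T.dist x v * T.w v ≤ α ↔ T.dist x v ≤ T.reach α v := by
  unfold reach reachSlope reachIcpt
  split_ifs with h
  · have h0 : T.w v = 0 := le_antisymm h (T.w_nonneg v)
    simp only [h0, mul_zero, hα, zero_mul, zero_add, true_iff]
    exact dist_le_totalLen x v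
  · push Not at h
    rw [add_zero, one_div_mul_eq_div, le_div_iff₀ h]

theorem IsGreedy.feasible_iff {α : ℝ} (hα : 0 ≤ α) {s : Fin n → ℝ}
    (hg : T.IsGreedy (T.reach α) s) {p : ℕ} :
    T.Feasible p α ↔ T.openCount s ≤ p := by
  classical
  constructor
  · rintro ⟨c, hc⟩
    refine hg.openCount_le c fun u => ?_
    obtain ⟨i, hi⟩ := hc u
    exact ⟨i, (dist_mul_le_iff hα _ _).1 hi⟩
  · intro h
    set S := Finset.univ.filter (T.Opens s) with hS
    have hcov := hg.exists_cover fun v => reach_nonneg hα v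
    -- If fewer than `p` centers are opened, the remaining indices repeat this one.
    obtain ⟨z₀, hz₀, _⟩ := hcov T.root
    let e := S.equivFin
    refine ⟨fun i => if hi : (i : ℕ) < S.card then
      openPoint (Finset.mem_filter.1 (e.symm ⟨i, hi⟩).2).2 else openPoint hz₀, fun u => ?_⟩
    obtain ⟨z, hz, hd⟩ := hcov u
    have hzS : z ∈ S := Finset.mem_filter.2 ⟨Finset.mem_univ z, hz⟩
    refine ⟨⟨e ⟨z, hzS⟩, (e ⟨z, hzS⟩).2.trans_le h⟩, ?_⟩
    rw [dist_mul_le_iff hα]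
    simp only [Fin.is_lt, dif_pos, Fin.eta, Equiv.symm_apply_apply]
    exact hd

/-! ### Feasible values and existence of the optimum -/

theorem Feasible.mono {p : ℕ} {α β : ℝ} (h : T.Feasible p α) (hαβ : α ≤ β) : T.Feasible p β := by
  obtain ⟨c, hc⟩ := h
  refine ⟨c, fun u => ?_⟩
  obtain ⟨i, hi⟩ := hc u
  exact ⟨i, hi.trans hαβ⟩

theorem Feasible.nonneg {p : ℕ} {α : ℝ} (h : T.Feasible p α) : 0 ≤ α := by
  obtain ⟨c, hc⟩ := h
  obtain ⟨i, hi⟩ := hc T.root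
  exact (mul_nonneg (dist_nonneg _ _) (T.w_nonneg _)).trans hi

/-- All centers at the root; this value is the first upper end of the search range. -/
theorem feasible_totalLen_mul {p : ℕ} (hp : 1 ≤ p) : T.Feasible p (T.totalLen * ∑ v, T.w v) := by
  refine ⟨fun _ => ⟨T.root, 0, le_rfl, T.len_nonneg _⟩, fun u => ⟨⟨0, hp⟩, ?_⟩⟩
  exact mul_le_mul (dist_le_totalLen _ _)
    (Finset.single_le_sum (fun v _ => T.w_nonneg v) (Finset.mem_univ u)) (T.w_nonneg u)
    T.totalLen_nonneg

variable (T) in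
-- The cost of a tuple of centers, a maximum over the vertices of minima over the centers, is
-- continuous on a compact set and attains its minimum.
theorem exists_isLeast_feasible {p : ℕ} (hp : 1 ≤ p) : ∃ α, IsLeast {α | T.Feasible p α} α := by
  have : Nonempty (Fin p) := ⟨⟨0, hp⟩⟩
  have : Nonempty (Fin n) := ⟨T.root⟩
  let g : Fin n → (Fin n × ℝ) → ℝ := fun u x =>
    min (x.2 + T.vertexDist x.1 u) (T.len x.1 - x.2 + T.vertexDist (T.parent x.1) u) * T.w u
  let F : (Fin p → Fin n × ℝ) → ℝ := fun c =>
    Finset.univ.sup' Finset.univ_nonempty fun u =>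
      Finset.univ.inf' Finset.univ_nonempty fun i => g u (c i)
  have hcg : ∀ u, Continuous (g u) := by
    intro u
    have h1 : ∀ f : Fin n → ℝ, Continuous fun x : Fin n × ℝ => f x.1 := fun f =>
      (continuous_of_discreteTopology (f := f)).comp continuous_fst
    have h2 := h1 fun y => T.vertexDist y u
    have h3 := h1 fun y => T.vertexDist (T.parent y) u
    have h4 := h1 T.len
    exact ((continuous_snd.add h2).min ((h4.sub continuous_snd).add h3)).mul continuous_const
  have hcF : Continuous F := by
    refine Continuous.finset_sup'_apply _ fun u _ => ?_
    exact Continuous.finset_inf'_apply _ fun i _ => (hcg u).comp (continuous_apply i)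
  -- The closed edges as disjoint segments; their common ends need not be identified.
  let K : Set (Fin n × ℝ) := ⋃ v : Fin n, {v} ×ˢ Set.Icc 0 (T.len v)
  have hK : IsCompact K := isCompact_iUnion fun v => isCompact_singleton.prod isCompact_Icc
  have hmem : ∀ x : Fin n × ℝ, x ∈ K ↔ 0 ≤ x.2 ∧ x.2 ≤ T.len x.1 := by
    rintro ⟨v, o⟩
    simp [K]
  have hKK : IsCompact (Set.univ.pi fun _ : Fin p => K) := isCompact_univ_pi fun _ => hK
  have hne : (Set.univ.pi fun _ : Fin p => K).Nonempty :=
    ⟨fun _ => (T.root, 0), fun i _ => (hmem _).2 ⟨le_rfl, T.len_nonneg _⟩⟩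
  obtain ⟨c, hc, hmin⟩ := hKK.exists_isMinOn hne hcF.continuousOn
  have hF : ∀ (c : Fin p → Fin n × ℝ) (α : ℝ), F c ≤ α ↔ ∀ u, ∃ i, g u (c i) ≤ α := by
    intro c α
    simp [F, Finset.sup'_le_iff, Finset.inf'_le_iff]
  refine ⟨F c, ?_, ?_⟩
  · refine ⟨fun i => ⟨(c i).1, (c i).2, ((hmem _).1 (hc i trivial)).1,
      ((hmem _).1 (hc i trivial)).2⟩, ?_⟩
    exact (hF c _).1 le_rfl
  · rintro α ⟨d, hd⟩
    refine le_trans (hmin (show (fun i => ((d i).vertex, (d i).offset)) ∈ _ from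
      fun i _ => (hmem _).2 ⟨(d i).offset_nonneg, (d i).offset_le⟩)) ?_
    exact (hF _ α).2 hd

end TreeNetwork

namespace TreeNetwork

variable {n : ℕ} (T : TreeNetwork n)

/-! ### The input arrays -/

/-- The array of the parents. -/
def parN : ℕ → ℕ := padded fun v => (T.parent v : ℕ)

/-- The array of the lengths. -/
def lenN : ℕ → ℝ := padded T.len

/-- The array of the weights. -/
def wN : ℕ → ℝ := padded T.w

/-- The array of the reaches. -/
noncomputable def reachN (α : ℝ) : ℕ → ℝ := padded (T.reach α)

/-- The root as a natural number. -/
def rootN : ℕ := T.root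

theorem padded_val {X : Type} [Zero X] (f : Fin n → X) (v : Fin n) : padded f v = f v := by
  simp [padded]

theorem rootN_lt : T.rootN < n := T.root.2

theorem parN_lt (v : ℕ) : T.parN v < n := by
  unfold parN padded
  split_ifs
  · exact Fin.is_lt _
  · exact (Nat.zero_le _).trans_lt T.root.2

theorem parN_rootN : T.parN T.rootN = T.rootN := by
  unfold parN rootN
  rw [padded_val, T.parent_root]

theorem lenN_rootN : T.lenN T.rootN = 0 := by
  unfold lenN rootN
  rw [padded_val, T.len_root]

theorem lenN_nonneg (v : ℕ) : 0 ≤ T.lenN v := by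
  unfold lenN padded
  split_ifs
  · exact T.len_nonneg _
  · exact le_rfl

theorem parN_ne {v : ℕ} (hv : v < n) (h : v ≠ T.rootN) : T.parN v ≠ v := by
  intro h'
  have h1 : T.parN ((⟨v, hv⟩ : Fin n) : ℕ) = T.parent ⟨v, hv⟩ := padded_val _ _
  refine T.parent_ne (u := ⟨v, hv⟩) (fun h2 => h ?_) (Fin.ext (h1.symm.trans h'))
  exact congrArg Fin.val h2

/-! ### Partial results of the greedy algorithm -/

/-- A partial result of the greedy algorithm, for all values from `X`: the edges above the vertices
from `R` have been taken into account. -/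
structure Partial (X : Set ℝ) (acc : ℕ → ℝ → ℝ) (R : ℕ → Prop) : Prop where
  prec_reach : ∀ v < n, ∀ α ∈ X, Prec (acc v α) (T.reachN α v)
  prec_child : ∀ u < n, R u → u ≠ T.rootN → ∀ α ∈ X,
    Prec (acc (T.parN u) α) (acc u α - T.lenN u)
  eq_or : ∀ v < n, (∀ α ∈ X, acc v α = T.reachN α v) ∨
    ∃ u < n, R u ∧ u ≠ T.rootN ∧ T.parN u = v ∧ ∀ α ∈ X, acc v α = acc u α - T.lenN u

variable {T}

/-- The parent must not have been taken into account before its child, for its changed value would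
no longer match what was passed on. The last hypothesis asks for the same winner for all of `X`:
this is what makes symbolic runs possible. -/
theorem Partial.step {X : Set ℝ} {acc : ℕ → ℝ → ℝ} {R : ℕ → Prop} (h : T.Partial X acc R)
    {v : ℕ} (hv : v < n) (hR : v ≠ T.rootN → ¬ R (T.parN v)) {f : ℝ → ℝ}
    (h1 : ∀ α ∈ X, Prec (f α) (acc (T.parN v) α))
    (h2 : ∀ α ∈ X, Prec (f α) (acc v α - T.lenN v))
    (h3 : (∀ α ∈ X, f α = acc (T.parN v) α) ∨ ∀ α ∈ X, f α = acc v α - T.lenN v) :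
    T.Partial X (Function.update acc (T.parN v) f) (fun u => R u ∨ u = v) := by
  by_cases hvr : v = T.rootN
  -- The loop at the root has length `0`, so both candidates are the old value and nothing changes.
  · have key : ∀ u, ∀ α ∈ X, Function.update acc (T.parN v) f u α = acc u α := by
      intro u α hα
      rw [hvr, parN_rootN, Function.update_apply]
      split_ifs with hu
      · subst hu
        rcases h3 with h3 | h3
        · rw [h3 α hα, hvr, parN_rootN]
        · rw [h3 α hα, hvr, lenN_rootN, sub_zero]
      · rfl
    refine ⟨fun u hu α hα => ?_, fun u hu hRu hur α hα => ?_, fun u hu => ?_⟩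
    · rw [key u α hα]
      exact h.prec_reach u hu α hα
    · rw [key _ α hα, key _ α hα]
      exact h.prec_child u hu (hRu.resolve_right fun h' => hur (h'.trans hvr)) hur α hα
    · rcases h.eq_or u hu with h4 | ⟨x, hx, hRx, hxr, hxp, h4⟩
      · exact Or.inl fun α hα => (key u α hα).trans (h4 α hα)
      · exact Or.inr ⟨x, hx, Or.inl hRx, hxr, hxp, fun α hα => by
          rw [key _ α hα, key _ α hα, h4 α hα]⟩
  · have hR' := hR hvr
    have hpv := T.parN_ne hv hvr
    have key : ∀ u, R u ∨ u = v → Function.update acc (T.parN v) f u = acc u := by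
      intro u hu
      refine Function.update_of_ne ?_ _ _
      rintro rfl
      rcases hu with hu | hu
      · exact hR' hu
      · exact hpv hu
    refine ⟨fun u hu α hα => ?_, fun u hu hRu hur α hα => ?_, fun u hu => ?_⟩
    · rw [Function.update_apply]
      split_ifs with huv
      · rw [huv]
        exact (h1 α hα).trans (h.prec_reach _ (T.parN_lt v) α hα)
      · exact h.prec_reach u hu α hα
    · rw [key u hRu, Function.update_apply]
      split_ifs with hup
      · rcases hRu with hRu | hRu
        · have := h.prec_child u hu hRu hur α hα
          rw [hup] at this
          exact (h1 α hα).trans this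
        · rw [hRu]
          exact h2 α hα
      · exact h.prec_child u hu (hRu.resolve_right fun h' => hup (by rw [h'])) hur α hα
    · by_cases huv : u = T.parN v
      · rw [huv, Function.update_self]
        rcases h3 with h3 | h3
        · rcases h.eq_or _ (T.parN_lt v) with h4 | ⟨x, hx, hRx, hxr, hxp, h4⟩
          · exact Or.inl fun α hα => (h3 α hα).trans (h4 α hα)
          · exact Or.inr ⟨x, hx, Or.inl hRx, hxr, hxp, fun α hα => by
              rw [key x (Or.inl hRx), h3 α hα, h4 α hα]⟩
        · exact Or.inr ⟨v, hv, Or.inr rfl, hvr, rfl, fun α hα => by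
            rw [key v (Or.inr rfl), h3 α hα]⟩
      · rw [Function.update_of_ne huv]
        rcases h.eq_or u hu with h4 | ⟨x, hx, hRx, hxr, hxp, h4⟩
        · exact Or.inl h4
        · exact Or.inr ⟨x, hx, Or.inl hRx, hxr, hxp, fun α hα => by
            rw [key x (Or.inl hRx), h4 α hα]⟩

theorem Partial.isGreedy {X : Set ℝ} {acc : ℕ → ℝ → ℝ} {R : ℕ → Prop} (h : T.Partial X acc R)
    (hR : ∀ v < n, R v) {α : ℝ} (hα : α ∈ X) : T.IsGreedy (T.reach α) fun v => acc v α := by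
  have hp : ∀ v : Fin n, T.parN v = T.parent v := fun v => padded_val _ v
  have hl : ∀ v : Fin n, T.lenN v = T.len v := fun v => padded_val _ v
  have hr : ∀ v : Fin n, T.reachN α v = T.reach α v := fun v => padded_val _ v
  have hroot : ∀ v : Fin n, v ≠ T.root → (v : ℕ) ≠ T.rootN := fun v hv h => hv (Fin.ext h)
  refine ⟨fun v => ?_, fun u hu => ?_, fun v => ?_⟩
  · rw [← hr]
    exact h.prec_reach v v.2 α hα
  · have := h.prec_child u u.2 (hR _ u.2) (hroot u hu) α hα
    rwa [hp, hl] at this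
  · rcases h.eq_or v v.2 with h1 | ⟨u, hu, _, hur, huv, h1⟩
    · exact Or.inl ((h1 α hα).trans (hr v))
    · refine Or.inr ⟨⟨u, hu⟩, fun h' => hur (congrArg Fin.val h'), Fin.ext ?_, ?_⟩
      · rw [← hp]
        exact huv
      · rw [h1 α hα, ← hl]

variable (T) in
/-- An enumeration of the vertices in which the parents precede their children. -/
structure IsOrder (ord : ℕ → ℕ) : Prop where
  lt : ∀ i < n, ord i < n
  inj : ∀ i < n, ∀ j < n, ord i = ord j → i = j
  surj : ∀ v < n, ∃ i < n, ord i = v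
  par : ∀ i < n, ord i ≠ T.rootN → ∃ j < i, ord j = T.parN (ord i)

variable (T) in
/-- The condition for a center above a vertex. -/
def OpensN (S : ℕ → ℝ) (v : ℕ) : Prop := 0 ≤ S v ∧ (v = T.rootN ∨ S v - T.lenN v < 0)

theorem opensN_iff {S : ℕ → ℝ} (v : Fin n) : T.OpensN S v ↔ T.Opens (fun u => S u) v := by
  unfold OpensN Opens rootN lenN
  rw [padded_val, Fin.ext_iff]

open Classical in
theorem IsOrder.sum_opensN {ord : ℕ → ℕ} (ho : T.IsOrder ord) (S : ℕ → ℝ) :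
    (∑ i ∈ Finset.Ico 0 n, if T.OpensN S (ord i) then 1 else 0) = T.openCount fun u => S u := by
  rw [← Finset.card_filter, openCount]
  refine Finset.card_bij (fun i hi => ⟨ord i, ho.lt i ?_⟩) ?_ ?_ ?_
  · simp only [Finset.mem_filter, Finset.mem_Ico] at hi
    omega
  · intro i hi
    simp only [Finset.mem_filter, Finset.mem_Ico] at hi
    exact Finset.mem_filter.2 ⟨Finset.mem_univ _, (opensN_iff ⟨ord i, ho.lt i hi.1.2⟩).1 hi.2⟩
  · intro i hi j hj h
    simp only [Finset.mem_filter, Finset.mem_Ico] at hi hj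
    exact ho.inj i hi.1.2 j hj.1.2 (congrArg Fin.val h)
  · intro v hv
    obtain ⟨i, hi, hiv⟩ := ho.surj v v.2
    refine ⟨i, ?_, Fin.ext hiv⟩
    simp only [Finset.mem_filter, Finset.mem_Ico, Finset.mem_univ, true_and] at hv ⊢
    exact ⟨⟨Nat.zero_le i, hi⟩, by rw [hiv]; exact (opensN_iff v).2 hv⟩

end TreeNetwork

open RealRAM

/-! ### The greedy test as a program

The arrays of natural numbers are: `0` the input, `1` the parents, `2` the vertices of the centers,
`3` the order of the vertices, `4` marks, `5` the weights of the tasks, `6` their status, `7` the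
blocks, `8` the entries, `9` a copy of the entries; those from `10` on are used as registers. The
arrays of real numbers are: `0` the weights, `1` the lengths, `2` the value of the solution, `3` the
offsets of the centers, `4` and `5` the slopes and intercepts of the reaches, `6` the state of the
greedy test, `7` and `8` the slopes and intercepts of the symbolic state, `9` the critical values;
those from `10` on are used as registers. -/

infixr:60 ";;" => Prog.seq

/-- Add a center on the edge above the current vertex. -/
def recordCenter (off : RExp) : Prog :=
  .setNat 2 (nv 15) (nv 13) ;; .setReal 3 (nv 15) off ;; setN 15 (.add (nv 15) (.lit 1))

/-- Load the current vertex, its parent and the two values of its edge. -/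
def testLoad : Prog :=
  setN 13 (.get 3 (nv 12)) ;; setN 14 (.get 1 (nv 13)) ;; setR 16 (.get 6 (nv 13)) ;;
    setR 17 (.sub (rv 16) (.get 1 (nv 13)))

/-- Place a center if the current vertex needs one. -/
def testPlace : Prog :=
  .ite (.realLe (.lit 0) (rv 16))
    (.ite (.natEq (nv 13) (.get 0 (.lit 2))) (recordCenter (.lit 0))
      (.ite (.realLt (rv 17) (.lit 0)) (recordCenter (rv 16)) .skip))
    .skip

/-- Update the state of the parent. -/
def testCombine : Prog :=
  setR 18 (.get 6 (nv 14)) ;;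
  .ite (.realLe (.lit 0) (.add (rv 18) (rv 17)))
    (.ite (.realLe (rv 18) (rv 17)) .skip (.setReal 6 (nv 14) (rv 17)))
    (.ite (.realLe (rv 17) (rv 18)) .skip (.setReal 6 (nv 14) (rv 17)))

/-- The greedy test for the value in register `12`; the number of centers goes to register `15`. -/
def testProg : Prog :=
  forUp 12 (.get 0 (.lit 0))
    (.setReal 6 (nv 12) (.add (.mul (.get 4 (nv 12)) (rv 12)) (.get 5 (nv 12)))) ;;
  setN 15 (.lit 0) ;;
  forDown 12 (.get 0 (.lit 0)) (testLoad ;; testPlace ;; testCombine)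

open Classical in
/-- The smaller one of two numbers for the order `Prec`. -/
noncomputable def minPrec (a b : ℝ) : ℝ := if Prec a b then a else b

theorem minPrec_prec_left (a b : ℝ) : Prec (minPrec a b) a := by
  unfold minPrec
  split_ifs with h
  · exact Prec.refl a
  · exact Prec.of_not h

theorem minPrec_prec_right (a b : ℝ) : Prec (minPrec a b) b := by
  unfold minPrec
  split_ifs with h
  · exact h
  · exact Prec.refl b

theorem minPrec_eq_or (a b : ℝ) : minPrec a b = a ∨ minPrec a b = b := by
  unfold minPrec
  split_ifs
  · exact Or.inl rfl
  · exact Or.inr rfl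

theorem putNat_nat_self (s : State) (a i x : ℕ) :
    (s.putNat a i x).nat a = Function.update (s.nat a) i x := by
  funext j
  simp [Function.update_apply]

theorem testCombine_exec (s : State) :
    (testCombine.exec s).real 6 = Function.update (s.real 6) (s.nat 14 0)
      (minPrec (s.real 6 (s.nat 14 0)) (s.real 17 0)) := by
  simp only [testCombine, Prog.exec, Test.Holds, NExp.eval, RExp.eval, minPrec, Prec]
  funext j
  by_cases h1 : 0 ≤ s.real 6 (s.nat 14 0) + s.real 17 0 <;>
    by_cases h2 : s.real 6 (s.nat 14 0) ≤ s.real 17 0 <;>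
      by_cases h3 : s.real 17 0 ≤ s.real 6 (s.nat 14 0) <;>
        by_cases h4 : j = s.nat 14 0 <;>
          simp [h1, h2, h3, h4]

theorem testPlace_exec_of_opens (s : State)
    (h : 0 ≤ s.real 16 0 ∧ (s.nat 13 0 = s.nat 0 2 ∨ s.real 17 0 < 0)) :
    (testPlace.exec s).nat 15 0 = s.nat 15 0 + 1 ∧
    (testPlace.exec s).nat 2 = Function.update (s.nat 2) (s.nat 15 0) (s.nat 13 0) ∧
    (testPlace.exec s).real 3 = Function.update (s.real 3) (s.nat 15 0)
      (if s.nat 13 0 = s.nat 0 2 then 0 else s.real 16 0) := by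
  simp only [testPlace, recordCenter, Prog.exec, Test.Holds, NExp.eval, RExp.eval]
  by_cases h1 : s.nat 13 0 = s.nat 0 2
  · refine ⟨by simp [h, h1], ?_, ?_⟩ <;> funext j <;> simp [h, h1, Function.update_apply]
  · have h2 := h.2.resolve_left h1
    refine ⟨by simp [h, h1, h2], ?_, ?_⟩ <;> funext j <;> simp [h, h1, h2, Function.update_apply]

theorem testPlace_exec_of_not_opens (s : State)
    (h : ¬ (0 ≤ s.real 16 0 ∧ (s.nat 13 0 = s.nat 0 2 ∨ s.real 17 0 < 0))) :
    testPlace.exec s = s := by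
  simp only [testPlace, recordCenter, Prog.exec, Test.Holds, NExp.eval, RExp.eval]
  by_cases h0 : 0 ≤ s.real 16 0
  · have h1 : ¬ s.nat 13 0 = s.nat 0 2 := fun h' => h ⟨h0, Or.inl h'⟩
    have h2 : ¬ s.real 17 0 < 0 := fun h' => h ⟨h0, Or.inr h'⟩
    simp [h1, h2]
  · simp [h0]

/-! ### Correctness of the greedy test -/

namespace TreeNetwork

variable {n : ℕ} (T : TreeNetwork n)

/-- The input arrays are intact. -/
structure HasInput (p : ℕ) (s : State) : Prop where
  n_eq : s.nat 0 0 = n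
  p_eq : s.nat 0 1 = p
  root_eq : s.nat 0 2 = T.rootN
  par_eq : s.nat 1 = T.parN
  w_eq : s.real 0 = T.wN
  len_eq : s.real 1 = T.lenN

/-- All cells of the output arrays for the centers hold points of the network. -/
def ValidOut (s : State) : Prop :=
  ∀ i, s.nat 2 i < n ∧ 0 ≤ s.real 3 i ∧ s.real 3 i ≤ T.lenN (s.nat 2 i)

/-- The arrays `4` and `5` hold the reaches of the vertices. -/
def HasReach (s : State) : Prop :=
  ∀ v < n, ∀ α, s.real 4 v * α + s.real 5 v = T.reachN α v

open Classical in
/-- The invariant of the main loop of the greedy test. -/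
structure TestInv (ord : ℕ → ℕ) (α : ℝ) (k : ℕ) (s : State) : Prop where
  part : T.Partial {α} (fun v _ => s.real 6 v) fun u => ∃ i, k ≤ i ∧ i < n ∧ ord i = u
  count : s.nat 15 0 = ∑ i ∈ Finset.Ico k n, if T.OpensN (s.real 6) (ord i) then 1 else 0
  center : ∀ i, k ≤ i → i < n → T.OpensN (s.real 6) (ord i) → ∃ c < s.nat 15 0,
    s.nat 2 c = ord i ∧ s.real 3 c = if ord i = T.rootN then 0 else s.real 6 (ord i)
  valid : T.ValidOut s

variable {T}

theorem TestInv.step {ord : ℕ → ℕ} (ho : T.IsOrder ord) {α : ℝ} {k : ℕ} (hk : k < n)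
    {s s' : State} (h : T.TestInv ord α (k + 1) s)
    (h6 : s'.real 6 = Function.update (s.real 6) (T.parN (ord k))
      (minPrec (s.real 6 (T.parN (ord k))) (s.real 6 (ord k) - T.lenN (ord k))))
    (hop : T.OpensN (s.real 6) (ord k) → s'.nat 15 0 = s.nat 15 0 + 1 ∧
      s'.nat 2 = Function.update (s.nat 2) (s.nat 15 0) (ord k) ∧
      s'.real 3 = Function.update (s.real 3) (s.nat 15 0)
        (if ord k = T.rootN then 0 else s.real 6 (ord k)))
    (hnop : ¬ T.OpensN (s.real 6) (ord k) → s'.nat 15 0 = s.nat 15 0 ∧ s'.nat 2 = s.nat 2 ∧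
      s'.real 3 = s.real 3) :
    T.TestInv ord α k s' := by
  classical
  -- Only the parent of the current vertex changes, and it comes earlier in the order; at the root
  -- the update is void. So the values used for the centers recorded so far are final.
  have hp : ∀ i, k ≤ i → i < n → s'.real 6 (ord i) = s.real 6 (ord i) := by
    intro i hki hi
    rw [h6, Function.update_apply]
    split_ifs with hip
    · by_cases hr : ord k = T.rootN
      · rw [hr, lenN_rootN, sub_zero]
        rw [hr] at hip
        rw [hip, parN_rootN]
        rcases minPrec_eq_or (s.real 6 T.rootN) (s.real 6 T.rootN) with h' | h' <;> exact h'
      · obtain ⟨j, hj, hjp⟩ := ho.par k hk hr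
        have := ho.inj i hi j (by omega) (hip.trans hjp.symm)
        omega
    · rfl
  have hopen : ∀ i, k ≤ i → i < n → (T.OpensN (s'.real 6) (ord i) ↔ T.OpensN (s.real 6) (ord i)) := by
    intro i hki hi
    unfold OpensN
    rw [hp i hki hi]
  refine ⟨?_, ?_, ?_, ?_⟩
  · have h1 := h.part.step (v := ord k) (ho.lt k hk) (f := fun _ =>
      minPrec (s.real 6 (T.parN (ord k))) (s.real 6 (ord k) - T.lenN (ord k)))
      (fun hr ⟨i, hki, hi, hip⟩ => by
        obtain ⟨j, hj, hjp⟩ := ho.par k hk hr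
        have := ho.inj i hi j (by omega) (hip.trans hjp.symm)
        omega)
      (fun _ _ => minPrec_prec_left _ _) (fun _ _ => minPrec_prec_right _ _)
      ((minPrec_eq_or _ _).imp (fun h _ _ => h) fun h _ _ => h)
    convert h1 using 1
    · funext v a
      rw [h6, Function.update_apply, Function.update_apply]
      split_ifs <;> rfl
    · funext u
      refine propext ⟨?_, ?_⟩
      · rintro ⟨i, hki, hi, rfl⟩
        rcases Nat.eq_or_lt_of_le hki with h' | h'
        · exact Or.inr (by rw [h'])
        · exact Or.inl ⟨i, h', hi, rfl⟩
      · rintro (⟨i, hki, hi, rfl⟩ | rfl)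
        · exact ⟨i, by omega, hi, rfl⟩
        · exact ⟨k, le_rfl, hk, rfl⟩
  · rw [Finset.sum_eq_sum_Ico_succ_bot hk]
    have h1 : ∀ i ∈ Finset.Ico (k + 1) n, (if T.OpensN (s'.real 6) (ord i) then 1 else 0) =
        if T.OpensN (s.real 6) (ord i) then 1 else 0 := by
      intro i hi
      rw [Finset.mem_Ico] at hi
      rw [if_congr (hopen i (by omega) hi.2) rfl rfl]
    rw [Finset.sum_congr rfl h1, ← h.count, if_congr (hopen k le_rfl hk) rfl rfl]
    by_cases hop' : T.OpensN (s.real 6) (ord k)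
    · rw [if_pos hop', (hop hop').1, add_comm]
    · rw [if_neg hop', (hnop hop').1, zero_add]
  · intro i hki hi hio
    rw [hopen i hki hi] at hio
    rw [hp i hki hi]
    by_cases hop' : T.OpensN (s.real 6) (ord k)
    · obtain ⟨e1, e2, e3⟩ := hop hop'
      rcases Nat.eq_or_lt_of_le hki with h' | h'
      · refine ⟨s.nat 15 0, by omega, ?_, ?_⟩
        · rw [e2, Function.update_self, h']
        · rw [e3, Function.update_self, h']
      · obtain ⟨c, hc, hc2, hc3⟩ := h.center i h' hi hio
        refine ⟨c, by omega, ?_, ?_⟩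
        · rw [e2, Function.update_of_ne (by omega), hc2]
        · rw [e3, Function.update_of_ne (by omega), hc3]
    · obtain ⟨e1, e2, e3⟩ := hnop hop'
      rcases Nat.eq_or_lt_of_le hki with h' | h'
      · exact absurd (h' ▸ hio) hop'
      · rw [e1, e2, e3]
        exact h.center i h' hi hio
  · intro i
    by_cases hop' : T.OpensN (s.real 6) (ord k)
    · obtain ⟨e1, e2, e3⟩ := hop hop'
      rw [e2, e3]
      by_cases hi : i = s.nat 15 0
      · subst hi
        simp only [Function.update_self]
        refine ⟨ho.lt k hk, ?_, ?_⟩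
        · split_ifs
          · exact le_rfl
          · exact hop'.1
        · split_ifs with hr
          · exact T.lenN_nonneg _
          · linarith [hop'.2.resolve_left hr]
      · simp only [Function.update_of_ne hi]
        exact h.valid i
    · obtain ⟨e1, e2, e3⟩ := hnop hop'
      rw [e2, e3]
      exact h.valid i

theorem testProg_inv {ord : ℕ → ℕ} (ho : T.IsOrder ord) {p : ℕ} {s : State}
    (hin : T.HasInput p s) (hre : T.HasReach s) (hv : T.ValidOut s) (hord : s.nat 3 = ord) :
    Ends testProg s (200 * n + 50) (T.TestInv ord (s.real 12 0) 0) := by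
  have key : Ends testProg s ((n * (20 + 2 + 9) + 2 + 6) + (3 + (n * (100 + 10) + 2 + 6)))
      (T.TestInv ord (s.real 12 0) 0) := by
    refine Ends.seq (ends_forUp (c := 20) (N := n) (fun k s' => ∀ v < k, s'.real 6 v =
      s.real 4 v * s.real 12 0 + s.real 5 v) rfl (fun s' hf => ?_) (fun k hk s' hf hi hinv => ?_)
      (fun v hv => by omega)) fun s₁ hf₁ ⟨_, h₁⟩ => ?_
    · simp only [NExp.eval]
      rw [hf.1 0 rfl, hin.n_eq]
    · refine ends_of_exec rfl (by decide) ?_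
      intro v hv
      simp only [Prog.exec, NExp.eval, RExp.eval, State.putNat_real, State.putReal_real, if_true, hi]
      rw [hf.2 12 rfl, hf.2 4 rfl, hf.2 5 rfl]
      split_ifs with hvk
      · rw [hvk]
      · exact hinv v (by omega)
    · refine Ends.seq (ends_exec (P := setN 15 (.lit 0)) rfl s₁) fun s₂ hf₂ h₂ => ?_
      have hs6 : s₂.real 6 = s₁.real 6 := hf₂.2 6 rfl
      have hn2 : s₂.nat 2 = s.nat 2 := (hf₂.1 2 rfl).trans (hf₁.1 2 rfl)
      have hr3 : s₂.real 3 = s.real 3 := (hf₂.2 3 rfl).trans (hf₁.2 3 rfl)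
      have h15 : s₂.nat 15 0 = 0 := by
        rw [h₂]
        simp [Prog.exec, NExp.eval]
      refine ends_forDown (c := 100) (N := n) (T.TestInv ord (s.real 12 0)) rfl ?_ ?_ ?_
      · simp only [NExp.eval]
        rw [hf₂.1 0 rfl, hf₁.1 0 rfl, hin.n_eq]
      · intro k hk s₃ hf₃ hk₃ hinv
        have e3 : s₃.nat 3 = ord := by rw [hf₃.1 3 rfl, hf₂.1 3 rfl, hf₁.1 3 rfl, hord]
        have e1 : s₃.nat 1 = T.parN := by rw [hf₃.1 1 rfl, hf₂.1 1 rfl, hf₁.1 1 rfl, hin.par_eq]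
        have e0 : s₃.nat 0 2 = T.rootN := by rw [hf₃.1 0 rfl, hf₂.1 0 rfl, hf₁.1 0 rfl, hin.root_eq]
        have er : s₃.real 1 = T.lenN := by rw [hf₃.2 1 rfl, hf₂.2 1 rfl, hf₁.2 1 rfl, hin.len_eq]
        have eL : (testLoad.exec (s₃.putNat 12 0 k)).nat 13 0 = ord k ∧
            (testLoad.exec (s₃.putNat 12 0 k)).nat 14 0 = T.parN (ord k) ∧
            (testLoad.exec (s₃.putNat 12 0 k)).real 16 0 = s₃.real 6 (ord k) ∧
            (testLoad.exec (s₃.putNat 12 0 k)).real 17 0 =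
              s₃.real 6 (ord k) - T.lenN (ord k) := by
          simp [testLoad, Prog.exec, NExp.eval, RExp.eval, e1, e3, er]
        have hL := exec_frame (P := testLoad) rfl (s₃.putNat 12 0 k)
        refine ends_of_exec rfl (by decide) ?_
        simp only [Prog.exec]
        set s₄ := testLoad.exec (s₃.putNat 12 0 k) with hs₄
        have hP := exec_frame (P := testPlace) rfl s₄
        have eC := testCombine_exec (testPlace.exec s₄)
        have hC := exec_frame (P := testCombine) rfl (testPlace.exec s₄)
        obtain ⟨e13, e14, e16, e17⟩ := eL
        have e2' : s₄.nat 2 = s₃.nat 2 := by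
          rw [hL.1 2 rfl, State.putNat_nat_of_ne _ _ _ (by decide)]
        have e15' : s₄.nat 15 = s₃.nat 15 := by
          rw [hL.1 15 rfl, State.putNat_nat_of_ne _ _ _ (by decide)]
        have e0' : s₄.nat 0 2 = T.rootN := by
          rw [hL.1 0 rfl, State.putNat_nat_of_ne _ _ _ (by decide), e0]
        have e3' : s₄.real 3 = s₃.real 3 := hL.2 3 rfl
        refine hinv.step ho hk ?_ ?_ ?_
        · rw [eC, hP.2 6 rfl, hP.1 14 rfl, hP.2 17 rfl, e14, e17, hL.2 6 rfl]
          rfl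
        · intro hop
          have := testPlace_exec_of_opens s₄ (by rw [e16, e13, e0', e17]; exact hop)
          rw [e2', e3', e15', e13, e16, e0'] at this
          rw [hC.1 15 rfl, hC.1 2 rfl, hC.2 3 rfl]
          exact this
        · intro hop
          have := testPlace_exec_of_not_opens s₄ (by rw [e16, e13, e0', e17]; exact hop)
          rw [hC.1 15 rfl, hC.1 2 rfl, hC.2 3 rfl, this, e15', e2', e3']
          exact ⟨rfl, rfl, rfl⟩
      · have e6 : ∀ v < n, s₂.real 6 v = T.reachN (s.real 12 0) v := by
          intro v hv
          rw [hs6, h₁ v hv, hre v hv]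
        refine ⟨⟨fun v hv α hα => ?_, fun u _ ⟨i, hi, hi', _⟩ => by omega, fun v hv => ?_⟩, ?_, ?_, ?_⟩
        · rw [Set.mem_singleton_iff.1 hα, State.putNat_real, e6 v hv]
          exact Prec.refl _
        · refine Or.inl fun α hα => ?_
          rw [Set.mem_singleton_iff.1 hα, State.putNat_real, e6 v hv]
        · simp [h15]
        · intro i hi hi'
          omega
        · intro i
          rw [State.putNat_nat_of_ne _ _ _ (by decide), State.putNat_real, hn2, hr3]
          exact hv i
  exact key.mono (by omega) fun _ _ h => h

/-- The greedy test decides feasibility and finds centers. -/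
theorem testProg_spec {ord : ℕ → ℕ} (ho : T.IsOrder ord) {p : ℕ} {s : State}
    (hin : T.HasInput p s) (hre : T.HasReach s) (hv : T.ValidOut s) (hord : s.nat 3 = ord)
    (hα : 0 ≤ s.real 12 0) :
    Ends testProg s (200 * n + 50) (fun s' => T.ValidOut s' ∧
      (s'.nat 15 0 ≤ p ↔ T.Feasible p (s.real 12 0)) ∧
      (s'.nat 15 0 ≤ p → ∃ c : Fin p → T.Point, T.Covers c (s.real 12 0) ∧
        ∀ i : Fin p, s'.nat 2 i = ((c i).vertex : ℕ) ∧ s'.real 3 i = (c i).offset)) := by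
  refine (testProg_inv ho hin hre hv hord).mono le_rfl fun s' _ h => ?_
  have hg : T.IsGreedy (T.reach (s.real 12 0)) fun v => s'.real 6 v :=
    h.part.isGreedy (fun v hv => by
      obtain ⟨i, hi, hiv⟩ := ho.surj v hv
      exact ⟨i, Nat.zero_le i, hi, hiv⟩) (Set.mem_singleton _)
  refine ⟨h.valid, ?_, fun hle => ?_⟩
  · rw [hg.feasible_iff hα, h.count, ho.sum_opensN]
  · have hl : ∀ i, T.lenN (s'.nat 2 i) = T.len ⟨s'.nat 2 i, (h.valid i).1⟩ := fun i =>
      padded_val T.len ⟨s'.nat 2 i, (h.valid i).1⟩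
    -- Cells beyond the number of opened centers hold zeros or leftovers of earlier tests; by
    -- `ValidOut` these are points too, so there are always `p` of them.
    refine ⟨fun i => ⟨⟨s'.nat 2 i, (h.valid i).1⟩, s'.real 3 i, (h.valid i).2.1, ?_⟩,
      fun u => ?_, fun i => ⟨rfl, rfl⟩⟩
    · rw [← hl]
      exact (h.valid i).2.2
    · obtain ⟨z, hz, hd⟩ := hg.exists_cover (fun v => reach_nonneg hα v) u
      obtain ⟨i, hi, hiz⟩ := ho.surj z z.2
      obtain ⟨c, hc, hc2, hc3⟩ := h.center i (Nat.zero_le i) hi (by rw [hiz, opensN_iff]; exact hz)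
      refine ⟨⟨c, hc.trans_le hle⟩, ?_⟩
      rw [dist_mul_le_iff hα]
      convert hd using 2
      refine point_ext (Fin.ext (hc2.trans hiz)) ?_
      simp only [openPoint, hc3, hiz, rootN, Fin.val_inj]

end TreeNetwork

/-! ### Preprocessing -/

/-- Add up the lengths and the weights. -/
def sumProg : Prog :=
  forUp 10 (.get 0 (.lit 0))
    (setR 10 (.add (rv 10) (.add (.get 1 (nv 10)) (.get 1 (nv 10)))) ;;
      setR 11 (.add (rv 11) (.get 0 (nv 10))))

/-- Compute the reaches. -/
def reachProg : Prog :=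
  forUp 10 (.get 0 (.lit 0))
    (.ite (.realLe (.get 0 (nv 10)) (.lit 0))
      (.setReal 4 (nv 10) (.lit 0) ;; .setReal 5 (nv 10) (rv 10))
      (.setReal 4 (nv 10) (.div (.lit 1) (.get 0 (nv 10))) ;; .setReal 5 (nv 10) (.lit 0)) ;;
    .setReal 7 (nv 10) (.get 4 (nv 10)) ;; .setReal 8 (nv 10) (.get 5 (nv 10)))

/-- Append a vertex to the order if its parent has been appended before. -/
def orderBody : Prog :=
  .ite (.natEq (.get 4 (nv 10)) (.lit 0))
    (.ite (.natEq (.get 4 (.get 1 (nv 10))) (.lit 1))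
      (.setNat 3 (nv 11) (nv 10) ;; .setNat 4 (nv 10) (.lit 1) ;;
        setN 12 (.get 5 (.get 1 (nv 10))) ;;
        .setNat 5 (nv 10) (.add (.add (nv 12) (nv 12)) (.add (nv 12) (nv 12))) ;;
        setN 11 (.add (nv 11) (.lit 1)))
      .skip)
    .skip

/-- Start the order with the root. -/
def orderStart : Prog :=
  .setNat 3 (.lit 0) (.get 0 (.lit 2)) ;; .setNat 4 (.get 0 (.lit 2)) (.lit 1) ;;
    .setNat 5 (.get 0 (.lit 2)) (.lit 1) ;; setN 11 (.lit 1)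

/-- Compute the order of the vertices and the weights of the tasks. -/
def orderProg : Prog :=
  orderStart ;;
  .loop (.natLt (nv 11) (.get 0 (.lit 0))) (forUp 10 (.get 0 (.lit 0)) orderBody)

/-! ### Correctness of the preprocessing -/

namespace TreeNetwork

variable {n : ℕ} (T : TreeNetwork n)

theorem sum_range_padded (f : Fin n → ℝ) : ∑ i ∈ Finset.range n, padded f i = ∑ v, f v := by
  rw [Finset.sum_range]
  exact Finset.sum_congr rfl fun v _ => padded_val f v

variable {T} in
theorem HasInput.frame {p : ℕ} {s s' : State} (h : T.HasInput p s) (h0 : s'.nat 0 = s.nat 0)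
    (h1 : s'.nat 1 = s.nat 1) (h2 : s'.real 0 = s.real 0) (h3 : s'.real 1 = s.real 1) :
    T.HasInput p s' := by
  constructor
  · rw [h0, h.n_eq]
  · rw [h0, h.p_eq]
  · rw [h0, h.root_eq]
  · rw [h1, h.par_eq]
  · rw [h2, h.w_eq]
  · rw [h3, h.len_eq]

theorem sumProg_spec {p : ℕ} {s : State} (hin : T.HasInput p s) (h10 : s.real 10 0 = 0)
    (h11 : s.real 11 0 = 0) :
    Ends sumProg s (50 * n + 10) (fun s' => s'.real 10 0 = T.totalLen ∧
      s'.real 11 0 = ∑ v, T.w v) := by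
  refine (ends_forUp (N := n) (c := 30) (fun k s' =>
    s'.real 10 0 = ∑ v ∈ Finset.range k, padded (fun v => T.len v + T.len v) v ∧
    s'.real 11 0 = ∑ v ∈ Finset.range k, T.wN v) rfl (fun s' hf => ?_)
    (fun k hk s' hf hi hinv => ?_) ?_).mono ?_ ?_
  · simp only [NExp.eval]
    rw [hf.1 0 rfl, hin.n_eq]
  · refine ends_of_exec rfl (by decide) ?_
    have e1 : s'.real 1 = T.lenN := by rw [hf.2 1 rfl, hin.len_eq]
    have e0 : s'.real 0 = T.wN := by rw [hf.2 0 rfl, hin.w_eq]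
    simp only [Prog.exec, NExp.eval, RExp.eval, State.putNat_real, State.putReal_real,
      State.putReal_nat, hi, Finset.sum_range_succ, hinv, e1, e0]
    simp [hk, lenN, padded]
  · simp [h10, h11]
  · simp only [NExp.cost]
    omega
  · rintro s' _ ⟨_, h1, h2⟩
    refine ⟨?_, ?_⟩
    · rw [h1, sum_range_padded, totalLen]
    · rw [h2, wN, sum_range_padded]

theorem reachProg_spec {p : ℕ} {s : State} (hin : T.HasInput p s)
    (h10 : s.real 10 0 = T.totalLen) :
    Ends reachProg s (60 * n + 10) (fun s' => T.HasReach s' ∧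
      ∀ v < n, s'.real 7 v = s'.real 4 v ∧ s'.real 8 v = s'.real 5 v) := by
  refine (ends_forUp (N := n) (c := 40) (fun k s' => ∀ v < k,
    s'.real 4 v = padded T.reachSlope v ∧ s'.real 5 v = padded T.reachIcpt v ∧
    s'.real 7 v = s'.real 4 v ∧ s'.real 8 v = s'.real 5 v) rfl (fun s' hf => ?_)
    (fun k hk s' hf hi hinv => ?_) ?_).mono ?_ ?_
  · simp only [NExp.eval]
    rw [hf.1 0 rfl, hin.n_eq]
  · refine ends_of_exec rfl (by decide) ?_
    have e0 : s'.real 0 = T.wN := by rw [hf.2 0 rfl, hin.w_eq]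
    have e10 : s'.real 10 0 = T.totalLen := by rw [hf.2 10 rfl, h10]
    have hw : T.wN k = T.w ⟨k, hk⟩ := padded_val T.w ⟨k, hk⟩
    have hs : padded T.reachSlope k = T.reachSlope ⟨k, hk⟩ := padded_val T.reachSlope ⟨k, hk⟩
    have hc : padded T.reachIcpt k = T.reachIcpt ⟨k, hk⟩ := padded_val T.reachIcpt ⟨k, hk⟩
    intro v hv
    by_cases hvk : v = k
    · subst hvk
      simp only [Prog.exec, NExp.eval, RExp.eval, Test.Holds, e0, hw, hi, hs, hc, reachSlope,
        reachIcpt]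
      by_cases h0 : T.w ⟨v, hk⟩ ≤ 0
      · simp [h0, hi, e10]
      · simp [h0, hi]
    · have := hinv v (by omega)
      simp only [Prog.exec, NExp.eval, RExp.eval, Test.Holds, e0, hw, hi]
      by_cases h0 : T.w ⟨k, hk⟩ ≤ 0
      · simp [h0, hi, hvk, this]
      · simp [h0, hi, hvk, this]
  · intro v hv
    omega
  · simp only [NExp.cost]
    omega
  · rintro s' _ ⟨_, h⟩
    refine ⟨fun v hv α => ?_, fun v hv => ⟨(h v hv).2.2.1, (h v hv).2.2.2⟩⟩
    rw [(h v hv).1, (h v hv).2.1]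
    simp [reachN, padded, hv, reach]

/-- The depth of a vertex given by its number. -/
def depthN : ℕ → ℕ := padded T.depth

theorem depthN_rootN : T.depthN T.rootN = 0 := by
  unfold depthN rootN
  rw [padded_val, depth_eq_zero]

theorem depthN_parN {v : ℕ} (hv : v < n) (hr : v ≠ T.rootN) :
    T.depthN v = T.depthN (T.parN v) + 1 := by
  have h1 : T.parN v = T.parent ⟨v, hv⟩ := padded_val _ (⟨v, hv⟩ : Fin n)
  have h2 : T.depthN v = T.depth ⟨v, hv⟩ := padded_val _ (⟨v, hv⟩ : Fin n)
  rw [h1, h2, depthN, padded_val]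
  exact depth_parent fun h => hr (congrArg Fin.val h)

/-- The invariant of the construction of the order. -/
structure OrderInv (ord mark wt : ℕ → ℕ) (cnt : ℕ) : Prop where
  lt : ∀ i < cnt, ord i < n
  marked : ∀ i < cnt, mark (ord i) = 1
  zero_or_one : ∀ v < n, mark v = 0 ∨ mark v = 1
  exists_of_marked : ∀ v < n, mark v = 1 → ∃ i < cnt, ord i = v
  inj : ∀ i < cnt, ∀ j < cnt, ord i = ord j → i = j
  par : ∀ i < cnt, ord i ≠ T.rootN → ∃ j < i, ord j = T.parN (ord i)
  root_marked : mark T.rootN = 1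
  wt_root : wt T.rootN = 1
  wt_par : ∀ v < n, mark v = 1 → v ≠ T.rootN →
    mark (T.parN v) = 1 ∧ wt v = wt (T.parN v) + wt (T.parN v) + (wt (T.parN v) + wt (T.parN v))

variable {T}

theorem OrderInv.step {ord mark wt : ℕ → ℕ} {cnt : ℕ} (h : T.OrderInv ord mark wt cnt) {v : ℕ}
    (hv : v < n) (h0 : mark v = 0) (h1 : mark (T.parN v) = 1) :
    T.OrderInv (Function.update ord cnt v) (Function.update mark v 1)
      (Function.update wt v (wt (T.parN v) + wt (T.parN v) + (wt (T.parN v) + wt (T.parN v))))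
      (cnt + 1) := by
  have hord : ∀ i < cnt, Function.update ord cnt v i = ord i := fun i hi =>
    Function.update_of_ne (by omega) _ _
  have hne : ∀ i < cnt, ord i ≠ v := by
    rintro i hi rfl
    rw [h.marked i hi] at h0
    exact one_ne_zero h0
  have hmk : ∀ u, mark u = 1 → u ≠ v := by
    rintro u hu rfl
    omega
  have cases' : ∀ i < cnt + 1, i < cnt ∨ i = cnt := fun i hi => by omega
  constructor
  · intro i hi
    rcases cases' i hi with h' | rfl
    · rw [hord i h']
      exact h.lt i h'
    · rwa [Function.update_self]
  · intro i hi
    rcases cases' i hi with h' | rfl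
    · rw [hord i h', Function.update_of_ne (hne i h')]
      exact h.marked i h'
    · rw [Function.update_self, Function.update_self]
  · intro u hu
    rw [Function.update_apply]
    split_ifs
    · exact Or.inr rfl
    · exact h.zero_or_one u hu
  · intro u hu hm
    by_cases huv : u = v
    · exact ⟨cnt, by omega, by rw [Function.update_self, huv]⟩
    · rw [Function.update_of_ne huv] at hm
      obtain ⟨i, hi, hiu⟩ := h.exists_of_marked u hu hm
      exact ⟨i, by omega, by rw [hord i hi, hiu]⟩
  · intro i hi j hj hij
    rcases cases' i hi with h' | rfl <;> rcases cases' j hj with h'' | rfl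
    · rw [hord i h', hord j h''] at hij
      exact h.inj i h' j h'' hij
    · rw [hord i h', Function.update_self] at hij
      exact absurd hij (hne i h')
    · rw [hord j h'', Function.update_self] at hij
      exact absurd hij.symm (hne j h'')
    · rfl
  · intro i hi hr
    rcases cases' i hi with h' | rfl
    · rw [hord i h'] at hr ⊢
      obtain ⟨j, hj, hjp⟩ := h.par i h' hr
      exact ⟨j, hj, by rw [hord j (by omega), hjp]⟩
    · rw [Function.update_self]
      obtain ⟨j, hj, hjp⟩ := h.exists_of_marked _ (T.parN_lt v) h1
      exact ⟨j, hj, by rw [hord j hj, hjp]⟩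
  · rw [Function.update_of_ne (hmk _ h.root_marked), h.root_marked]
  · rw [Function.update_of_ne (hmk _ h.root_marked), h.wt_root]
  · intro u hu hm hr
    by_cases huv : u = v
    · subst huv
      rw [Function.update_self, Function.update_of_ne (hmk _ h1), Function.update_of_ne (hmk _ h1)]
      exact ⟨h1, rfl⟩
    · rw [Function.update_of_ne huv] at hm
      obtain ⟨h2, h3⟩ := h.wt_par u hu hm hr
      rw [Function.update_of_ne (hmk _ h2), Function.update_of_ne huv,
        Function.update_of_ne (hmk _ h2)]
      exact ⟨h2, h3⟩

theorem OrderInv.le {ord mark wt : ℕ → ℕ} {cnt : ℕ} (h : T.OrderInv ord mark wt cnt) :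
    cnt ≤ n := by
  have := Finset.card_le_card_of_injOn (s := Finset.range cnt) (t := Finset.range n) ord
    (fun i hi => by simpa using h.lt i (by simpa using hi))
    (fun i hi j hj hij => h.inj i (by simpa using hi) j (by simpa using hj) hij)
  simpa using this

theorem OrderInv.le_of_marked {ord mark wt : ℕ → ℕ} {cnt : ℕ} (h : T.OrderInv ord mark wt cnt)
    (hm : ∀ v < n, mark v = 1) : n ≤ cnt := by
  have h1 : Finset.range n ⊆ (Finset.range cnt).image ord := by
    intro v hv
    rw [Finset.mem_range] at hv
    obtain ⟨i, hi, hiv⟩ := h.exists_of_marked v hv (hm v hv)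
    exact Finset.mem_image.2 ⟨i, by simpa using hi, hiv⟩
  have h2 := (Finset.card_le_card h1).trans Finset.card_image_le
  simpa using h2

theorem OrderInv.isOrder {ord mark wt : ℕ → ℕ} (h : T.OrderInv ord mark wt n) :
    T.IsOrder ord ∧ ∀ v < n, mark v = 1 := by
  have hsurj : ∀ v < n, ∃ i < n, ord i = v := by
    have h1 : Function.Injective fun i : Fin n => (⟨ord i, h.lt i i.2⟩ : Fin n) := fun i j hij =>
      Fin.ext (h.inj i i.2 j j.2 (congrArg Fin.val hij))
    intro v hv
    obtain ⟨i, hi⟩ := Finite.surjective_of_injective h1 ⟨v, hv⟩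
    exact ⟨i, i.2, congrArg Fin.val hi⟩
  refine ⟨⟨h.lt, h.inj, hsurj, h.par⟩, fun v hv => ?_⟩
  obtain ⟨i, hi, rfl⟩ := hsurj v hv
  exact h.marked i hi

variable (T) in
/-- The weights of the tasks. -/
structure IsWeight (wt : ℕ → ℕ) : Prop where
  root : wt T.rootN = 1
  par : ∀ v < n, v ≠ T.rootN → wt v = 4 * wt (T.parN v)

/-- With height `D`, this bounds the first potential by `4 * n * 4 ^ D`, whose logarithm governs the
number of rounds. -/
theorem IsWeight.eq_pow {wt : ℕ → ℕ} (h : T.IsWeight wt) {v : ℕ} (hv : v < n) :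
    wt v = 4 ^ T.depthN v := by
  induction hd : T.depthN v generalizing v with
  | zero =>
    have : v = T.rootN := by
      by_contra hr
      have := T.depthN_parN hv hr
      omega
    rw [this, h.root, pow_zero]
  | succ d ih =>
    have hr : v ≠ T.rootN := by
      rintro rfl
      rw [T.depthN_rootN] at hd
      omega
    rw [h.par v hv hr, ih (T.parN_lt v) (by have := T.depthN_parN hv hr; omega)]
    ring

theorem orderBody_exec_of {s : State} (h0 : s.nat 4 (s.nat 10 0) = 0)
    (h1 : s.nat 4 (s.nat 1 (s.nat 10 0)) = 1) :
    (orderBody.exec s).nat 3 = Function.update (s.nat 3) (s.nat 11 0) (s.nat 10 0) ∧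
    (orderBody.exec s).nat 4 = Function.update (s.nat 4) (s.nat 10 0) 1 ∧
    (orderBody.exec s).nat 5 = Function.update (s.nat 5) (s.nat 10 0)
      (s.nat 5 (s.nat 1 (s.nat 10 0)) + s.nat 5 (s.nat 1 (s.nat 10 0)) +
        (s.nat 5 (s.nat 1 (s.nat 10 0)) + s.nat 5 (s.nat 1 (s.nat 10 0)))) ∧
    (orderBody.exec s).nat 11 0 = s.nat 11 0 + 1 := by
  simp only [orderBody, Prog.exec, Test.Holds, NExp.eval, h0, h1, if_true]
  refine ⟨?_, ?_, ?_, ?_⟩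
  · funext j
    simp [Function.update_apply]
  · funext j
    simp [Function.update_apply]
  · funext j
    simp [Function.update_apply]
  · simp

theorem orderBody_exec_of_not {s : State}
    (h : ¬ (s.nat 4 (s.nat 10 0) = 0 ∧ s.nat 4 (s.nat 1 (s.nat 10 0)) = 1)) :
    orderBody.exec s = s := by
  simp only [orderBody, Prog.exec, Test.Holds, NExp.eval]
  by_cases h0 : s.nat 4 (s.nat 10 0) = 0
  · have h1 : ¬ s.nat 4 (s.nat 1 (s.nat 10 0)) = 1 := fun h' => h ⟨h0, h'⟩
    simp [h1]
  · simp [h0]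

/-- One pass over the vertices appends all vertices of the next level. -/
theorem orderPass_spec {p : ℕ} {s : State} (hin : T.HasInput p s) {m : ℕ}
    (h : T.OrderInv (s.nat 3) (s.nat 4) (s.nat 5) (s.nat 11 0))
    (hm : ∀ v < n, T.depthN v ≤ m → s.nat 4 v = 1) :
    Ends (forUp 10 (.get 0 (.lit 0)) orderBody) s (80 * n + 10) (fun s' =>
      T.OrderInv (s'.nat 3) (s'.nat 4) (s'.nat 5) (s'.nat 11 0) ∧
      ∀ v < n, T.depthN v ≤ m + 1 → s'.nat 4 v = 1) := by
  refine (ends_forUp (N := n) (c := 60) (fun k s' =>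
    T.OrderInv (s'.nat 3) (s'.nat 4) (s'.nat 5) (s'.nat 11 0) ∧
    ∀ v < n, T.depthN v ≤ m ∨ (v < k ∧ T.depthN v ≤ m + 1) → s'.nat 4 v = 1) rfl
    (fun s' hf => ?_) (fun k hk s' hf hi hinv => ?_) ?_).mono ?_ ?_
  · simp only [NExp.eval]
    rw [hf.1 0 rfl, hin.n_eq]
  · refine ends_of_exec rfl (by decide) ?_
    have e1 : s'.nat 1 = T.parN := by rw [hf.1 1 rfl, hin.par_eq]
    have e : ∀ a j, a ≠ 10 → ((orderBody.exec s').putNat 10 0 (k + 1)).nat a j =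
        (orderBody.exec s').nat a j := fun a j ha => by simp [ha]
    have e' : ∀ a, a ≠ 10 → ((orderBody.exec s').putNat 10 0 (k + 1)).nat a =
        (orderBody.exec s').nat a := fun a ha => funext fun j => e a j ha
    rw [e' 3 (by decide), e' 4 (by decide), e' 5 (by decide), e' 11 (by decide)]
    obtain ⟨hinv, hd⟩ := hinv
    by_cases hc : s'.nat 4 k = 0 ∧ s'.nat 4 (T.parN k) = 1
    · obtain ⟨h3, h4, h5, h11⟩ := orderBody_exec_of (s := s') (by rw [hi]; exact hc.1)
        (by rw [hi, e1]; exact hc.2)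
      rw [h3, h4, h5, h11, hi, e1]
      refine ⟨hinv.step hk hc.1 hc.2, fun v hv hdv => ?_⟩
      rw [Function.update_apply]
      split_ifs with hvk
      · rfl
      · exact hd v hv (hdv.imp id fun h => ⟨by omega, h.2⟩)
    · rw [orderBody_exec_of_not (by rw [hi, e1]; exact hc)]
      refine ⟨hinv, fun v hv hdv => ?_⟩
      by_cases hvk : v = k
      · subst hvk
        rcases hinv.zero_or_one v hv with h0 | h0
        · have hr : v ≠ T.rootN := by
            rintro rfl
            rw [hinv.root_marked] at h0
            exact one_ne_zero h0
          -- The parent is one level higher, hence marked before this pass, so `v` would have been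
          -- appended.
          have h1 := T.depthN_parN hv hr
          exact absurd ⟨h0, hd _ (T.parN_lt v) (Or.inl (by omega))⟩ hc
        · exact h0
      · exact hd v hv (hdv.imp id fun h => ⟨by omega, h.2⟩)
  · have e' : ∀ a, a ≠ 10 → (s.putNat 10 0 0).nat a = s.nat a := fun a ha =>
      State.putNat_nat_of_ne _ _ _ ha
    rw [e' 3 (by decide), e' 4 (by decide), e' 5 (by decide), e' 11 (by decide)]
    exact ⟨h, fun v hv hd => hm v hv (by omega)⟩
  · simp only [NExp.cost]
    omega
  · rintro s' _ ⟨_, h1, h2⟩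
    exact ⟨h1, fun v hv hd => h2 v hv (Or.inr ⟨hv, hd⟩)⟩

/-- Each pass completes at least one further level, so that `D` linear passes suffice; here the
height enters the running time. -/
theorem orderProg_spec {p : ℕ} {s : State} (hin : T.HasInput p s) (h4 : s.nat 4 = 0) {D : ℕ}
    (hD : ∀ v < n, T.depthN v ≤ D) :
    Ends orderProg s (D * (80 * n + 20) + 50) (fun s' => T.IsOrder (s'.nat 3) ∧
      T.IsWeight (s'.nat 5)) := by
  have h1 := exec_frame (P := orderStart) rfl s
  have hin1 : T.HasInput p (orderStart.exec s) :=
    hin.frame (h1.1 0 rfl) (h1.1 1 rfl) (h1.2 0 rfl) (h1.2 1 rfl)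
  have e3 : (orderStart.exec s).nat 3 0 = T.rootN := by
    simp [orderStart, Prog.exec, NExp.eval, hin.root_eq]
  have e4 : ∀ v, (orderStart.exec s).nat 4 v = if v = T.rootN then 1 else 0 := by
    intro v
    simp [orderStart, Prog.exec, NExp.eval, hin.root_eq, h4]
  have e5 : (orderStart.exec s).nat 5 T.rootN = 1 := by
    simp [orderStart, Prog.exec, NExp.eval, hin.root_eq]
  have e11 : (orderStart.exec s).nat 11 0 = 1 := by
    simp [orderStart, Prog.exec, NExp.eval]
  have hinv : T.OrderInv ((orderStart.exec s).nat 3) ((orderStart.exec s).nat 4)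
      ((orderStart.exec s).nat 5) ((orderStart.exec s).nat 11 0) := by
    rw [e11]
    have i0 : ∀ i < 1, i = 0 := fun i hi => by omega
    refine ⟨?_, ?_, ?_, ?_, ?_, ?_, ?_, e5, ?_⟩
    · intro i hi
      rw [i0 i hi, e3]
      exact T.rootN_lt
    · intro i hi
      rw [i0 i hi, e3, e4, if_pos rfl]
    · intro v _
      rw [e4]
      split_ifs <;> simp
    · intro v _ hv
      rw [e4] at hv
      refine ⟨0, one_pos, ?_⟩
      rw [e3]
      by_contra hne
      rw [if_neg (Ne.symm hne)] at hv
      exact zero_ne_one hv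
    · intro i hi j hj _
      rw [i0 i hi, i0 j hj]
    · intro i hi hne
      rw [i0 i hi] at hne
      exact absurd e3 hne
    · rw [e4, if_pos rfl]
    · intro v _ hv hr
      rw [e4, if_neg hr] at hv
      exact absurd hv zero_ne_one
  have hm : ∀ v < n, T.depthN v ≤ 0 → (orderStart.exec s).nat 4 v = 1 := by
    intro v hv hd
    have hr : v = T.rootN := by
      by_contra hr
      have := T.depthN_parN hv hr
      omega
    rw [e4, if_pos hr]
  have key : Ends orderProg s (orderStart.time + (D * (80 * n + 20) + 5)) (fun s' =>
      T.IsOrder (s'.nat 3) ∧ T.IsWeight (s'.nat 5)) := by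
    refine Ends.seq (ends_exec (P := orderStart) rfl s) fun s₁ _ hs₁ => ?_
    rw [← hs₁] at hin1 hinv hm
    refine (Ends.loop (fun b s' => ∃ m ≤ D, b = (D - m) * (80 * n + 20) ∧
      T.OrderInv (s'.nat 3) (s'.nat 4) (s'.nat 5) (s'.nat 11 0) ∧
      ∀ v < n, T.depthN v ≤ m → s'.nat 4 v = 1) ?_ (k := D * (80 * n + 20))
      ⟨0, Nat.zero_le D, by simp, hinv, hm⟩).mono ?_ ?_
    · rintro b s' hf ⟨m, hmD, rfl, hinv, hm⟩ hb
      have hin' : T.HasInput p s' := hin1.frame (hf.1 0 rfl) (hf.1 1 rfl) (hf.2 0 rfl) (hf.2 1 rfl)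
      simp only [Test.Holds, NExp.eval, hin'.n_eq] at hb
      have hmD' : m < D := by
        by_contra hmD'
        have := hinv.le_of_marked fun v hv => hm v hv ((hD v hv).trans (by omega))
        omega
      refine ⟨80 * n + 10, (orderPass_spec hin' hinv hm).mono le_rfl fun s'' _ h => ?_⟩
      refine ⟨_, ⟨m + 1, hmD', rfl, h.1, h.2⟩, ?_⟩
      simp only [Test.cost, NExp.cost]
      obtain ⟨d, rfl⟩ : ∃ d, D = m + 1 + d := ⟨D - (m + 1), by omega⟩
      rw [show m + 1 + d - (m + 1) = d by omega, show m + 1 + d - m = d + 1 by omega]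
      ring_nf
      omega
    · simp only [Test.cost, NExp.cost]
      omega
    · rintro s' hf ⟨⟨b, m, hmD, rfl, hinv, hm⟩, hb⟩
      have hin' : T.HasInput p s' := hin1.frame (hf.1 0 rfl) (hf.1 1 rfl) (hf.2 0 rfl) (hf.2 1 rfl)
      simp only [Test.Holds, NExp.eval, hin'.n_eq] at hb
      have hn : s'.nat 11 0 = n := by
        have := hinv.le
        omega
      rw [hn] at hinv
      obtain ⟨h1, h2⟩ := hinv.isOrder
      refine ⟨h1, hinv.wt_root, fun v hv hr => ?_⟩
      rw [(hinv.wt_par v hv (h2 v hv) hr).2]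
      ring
  have ht : orderStart.time ≤ 40 := by decide
  exact key.mono (by omega) fun _ _ h => h

end TreeNetwork

/-! ### Merge sort -/

/-- The entries from `a` to `b` are sorted by their keys. -/
def SortedOn (C : ℕ → ℝ) (E : ℕ → ℕ) (a b : ℕ) : Prop :=
  ∀ i j, a ≤ i → i ≤ j → j < b → C (E i) ≤ C (E j)

theorem SortedOn.congr {C : ℕ → ℝ} {E E' : ℕ → ℕ} {a b : ℕ} (h : SortedOn C E a b)
    (hE : ∀ i, a ≤ i → i < b → E' i = E i) : SortedOn C E' a b := by
  intro i j hi hij hj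
  rw [hE i hi (by omega), hE j (by omega) hj]
  exact h i j hi hij hj

/-- Append the next entry in the merger of two sorted ranges. -/
def mergeBody : Prog :=
  setN 26 (.lit 0) ;;
  .ite (.natLt (nv 23) (nv 21))
    (.ite (.natLt (nv 24) (nv 22))
      (.ite (.realLe (.get 9 (.get 8 (nv 23))) (.get 9 (.get 8 (nv 24)))) (setN 26 (.lit 1)) .skip)
      (setN 26 (.lit 1)))
    .skip ;;
  .ite (.natEq (nv 26) (.lit 1))
    (.setNat 9 (nv 25) (.get 8 (nv 23)) ;; setN 23 (.add (nv 23) (.lit 1)))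
    (.setNat 9 (nv 25) (.get 8 (nv 24)) ;; setN 24 (.add (nv 24) (.lit 1))) ;;
  setN 25 (.add (nv 25) (.lit 1))

/-- Merge the entries between the registers `20`, `21` and between the registers `21`, `22`. -/
def mergeProg : Prog :=
  (setN 23 (nv 20) ;; setN 24 (nv 21) ;; setN 25 (nv 20)) ;;
  .loop (.natLt (nv 25) (nv 22)) mergeBody

/-- Copy the entries between the registers `28` and `29` back. -/
def copyProg : Prog :=
  forUp 25 (.sub (nv 29) (nv 28))
    (.setNat 8 (.add (nv 28) (nv 25)) (.get 9 (.add (nv 28) (nv 25))))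

/-- Determine the next two blocks. -/
def blockProg : Prog :=
  setN 21 (.add (nv 20) (nv 27)) ;; .ite (.natLt (nv 29) (nv 21)) (setN 21 (nv 29)) .skip ;;
  setN 22 (.add (.add (nv 20) (nv 27)) (nv 27)) ;;
  .ite (.natLt (nv 29) (nv 22)) (setN 22 (nv 29)) .skip

/-- Merge the blocks in pairs. -/
def passProg : Prog :=
  setN 20 (nv 28) ;;
  .loop (.natLt (nv 20) (nv 29)) (blockProg ;; mergeProg ;; setN 20 (nv 22))

/-- Sort the entries between the registers `28` and `29`. -/
def sortProg : Prog :=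
  setN 27 (.lit 1) ;;
  .loop (.natLt (nv 27) (.sub (nv 29) (nv 28)))
    (passProg ;; copyProg ;; setN 27 (.add (nv 27) (nv 27)))

/-- The invariant of the merger. -/
structure MergeInv (C : ℕ → ℝ) (E M₀ : ℕ → ℕ) (lo mid hi i j o : ℕ) (M : ℕ → ℕ) : Prop where
  lo_le : lo ≤ i
  le_mid : i ≤ mid
  mid_le : mid ≤ j
  le_hi : j ≤ hi
  out : o + mid = i + j
  sorted : SortedOn C M lo o
  le_left : ∀ x, lo ≤ x → x < o → ∀ y, i ≤ y → y < mid → C (M x) ≤ C (E y)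
  le_right : ∀ x, lo ≤ x → x < o → ∀ y, j ≤ y → y < hi → C (M x) ≤ C (E y)
  -- Equal sums for all `f` express that the multiset of entries is preserved.
  sum : ∀ f : ℕ → ℕ, ∑ x ∈ Finset.Ico lo o, f (M x) =
    ∑ x ∈ Finset.Ico lo i, f (E x) + ∑ x ∈ Finset.Ico mid j, f (E x)
  outside : ∀ x, x < lo ∨ hi ≤ x → M x = M₀ x

theorem sortedOn_update {C : ℕ → ℝ} {M : ℕ → ℕ} {lo o e : ℕ} (h : SortedOn C M lo o)
    (he : ∀ x, lo ≤ x → x < o → C (M x) ≤ C e) :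
    SortedOn C (Function.update M o e) lo (o + 1) := by
  intro x y hx hxy hy
  rcases Nat.lt_succ_iff_lt_or_eq.1 hy with h' | rfl
  · rw [Function.update_of_ne (by omega), Function.update_of_ne (by omega)]
    exact h x y hx hxy h'
  · rw [Function.update_self]
    rcases Nat.eq_or_lt_of_le hxy with rfl | h'
    · rw [Function.update_self]
    · rw [Function.update_of_ne (by omega)]
      exact he x hx h'

theorem sum_update_top {M : ℕ → ℕ} {lo o e : ℕ} (hlo : lo ≤ o) (f : ℕ → ℕ) :
    ∑ x ∈ Finset.Ico lo (o + 1), f (Function.update M o e x) =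
      ∑ x ∈ Finset.Ico lo o, f (M x) + f e := by
  rw [Finset.sum_Ico_succ_top hlo, Function.update_self]
  congr 1
  refine Finset.sum_congr rfl fun x hx => ?_
  rw [Finset.mem_Ico] at hx
  rw [Function.update_of_ne (by omega)]

theorem MergeInv.left {C : ℕ → ℝ} {E M₀ M : ℕ → ℕ} {lo mid hi i j o : ℕ}
    (h : MergeInv C E M₀ lo mid hi i j o M) (hE : SortedOn C E lo mid) (hi' : i < mid)
    (hle : ∀ y, j ≤ y → y < hi → C (E i) ≤ C (E y)) :
    MergeInv C E M₀ lo mid hi (i + 1) j (o + 1) (Function.update M o (E i)) := by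
  obtain ⟨h1, h2, h3, h4, h5, h6, h7, h8, h9, h10⟩ := h
  have hup : ∀ x, x < o + 1 → x < o ∨ x = o := fun x hx => by omega
  refine ⟨by omega, by omega, h3, h4, by omega, ?_, ?_, ?_, fun f => ?_, ?_⟩
  · exact sortedOn_update h6 fun x hx hxo => h7 x hx hxo i le_rfl hi'
  · intro x hx hxo y hy hy'
    rcases hup x hxo with h' | rfl
    · rw [Function.update_of_ne (by omega)]
      exact h7 x hx h' y (by omega) hy'
    · rw [Function.update_self]
      exact hE i y (by omega) (by omega) hy'
  · intro x hx hxo y hy hy'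
    rcases hup x hxo with h' | rfl
    · rw [Function.update_of_ne (by omega)]
      exact h8 x hx h' y (by omega) hy'
    · rw [Function.update_self]
      exact hle y hy hy'
  · rw [sum_update_top (by omega), h9, Finset.sum_Ico_succ_top h1]
    ring
  · intro x hx
    rw [Function.update_of_ne (by omega)]
    exact h10 x hx

theorem MergeInv.right {C : ℕ → ℝ} {E M₀ M : ℕ → ℕ} {lo mid hi i j o : ℕ}
    (h : MergeInv C E M₀ lo mid hi i j o M) (hE : SortedOn C E mid hi) (hj' : j < hi)
    (hle : ∀ y, i ≤ y → y < mid → C (E j) ≤ C (E y)) :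
    MergeInv C E M₀ lo mid hi i (j + 1) (o + 1) (Function.update M o (E j)) := by
  obtain ⟨h1, h2, h3, h4, h5, h6, h7, h8, h9, h10⟩ := h
  have hup : ∀ x, x < o + 1 → x < o ∨ x = o := fun x hx => by omega
  refine ⟨by omega, by omega, by omega, by omega, by omega, ?_, ?_, ?_, fun f => ?_, ?_⟩
  · exact sortedOn_update h6 fun x hx hxo => h8 x hx hxo j le_rfl hj'
  · intro x hx hxo y hy hy'
    rcases hup x hxo with h' | rfl
    · rw [Function.update_of_ne (by omega)]
      exact h7 x hx h' y (by omega) hy'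
    · rw [Function.update_self]
      exact hle y hy hy'
  · intro x hx hxo y hy hy'
    rcases hup x hxo with h' | rfl
    · rw [Function.update_of_ne (by omega)]
      exact h8 x hx h' y (by omega) hy'
    · rw [Function.update_self]
      exact hE j y (by omega) (by omega) hy'
  · rw [sum_update_top (by omega), h9, Finset.sum_Ico_succ_top h3]
    ring
  · intro x hx
    rw [Function.update_of_ne (by omega)]
    exact h10 x hx

/-- The next entry comes from the left range. -/
def TakesLeft (s : State) : Prop :=
  s.nat 23 0 < s.nat 21 0 ∧ (s.nat 24 0 < s.nat 22 0 →
    s.real 9 (s.nat 8 (s.nat 23 0)) ≤ s.real 9 (s.nat 8 (s.nat 24 0)))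

theorem mergeBody_exec_left {s : State} (h : TakesLeft s) :
    (mergeBody.exec s).nat 9 = Function.update (s.nat 9) (s.nat 25 0) (s.nat 8 (s.nat 23 0)) ∧
    (mergeBody.exec s).nat 23 0 = s.nat 23 0 + 1 ∧ (mergeBody.exec s).nat 24 0 = s.nat 24 0 ∧
    (mergeBody.exec s).nat 25 0 = s.nat 25 0 + 1 := by
  obtain ⟨h1, h2⟩ := h
  simp only [mergeBody, Prog.exec, Test.Holds, NExp.eval, RExp.eval]
  by_cases h3 : s.nat 24 0 < s.nat 22 0
  · have h4 := h2 h3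
    refine ⟨?_, by simp [h1, h3, h4], by simp [h1, h3, h4], by simp [h1, h3, h4]⟩
    funext x
    simp [h1, h3, h4, Function.update_apply]
  · refine ⟨?_, by simp [h1, h3], by simp [h1, h3], by simp [h1, h3]⟩
    funext x
    simp [h1, h3, Function.update_apply]

theorem mergeBody_exec_right {s : State} (h : ¬ TakesLeft s) :
    (mergeBody.exec s).nat 9 = Function.update (s.nat 9) (s.nat 25 0) (s.nat 8 (s.nat 24 0)) ∧
    (mergeBody.exec s).nat 23 0 = s.nat 23 0 ∧ (mergeBody.exec s).nat 24 0 = s.nat 24 0 + 1 ∧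
    (mergeBody.exec s).nat 25 0 = s.nat 25 0 + 1 := by
  simp only [mergeBody, Prog.exec, Test.Holds, NExp.eval, RExp.eval]
  by_cases h1 : s.nat 23 0 < s.nat 21 0
  · have h2 : ¬ (s.nat 24 0 < s.nat 22 0 →
        s.real 9 (s.nat 8 (s.nat 23 0)) ≤ s.real 9 (s.nat 8 (s.nat 24 0))) := fun h' => h ⟨h1, h'⟩
    rw [Classical.not_imp] at h2
    obtain ⟨h3, h4⟩ := h2
    refine ⟨?_, by simp [h1, h3, h4], by simp [h1, h3, h4], by simp [h1, h3, h4]⟩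
    funext x
    simp [h1, h3, h4, Function.update_apply]
  · refine ⟨?_, by simp [h1], by simp [h1], by simp [h1]⟩
    funext x
    simp [h1, Function.update_apply]

theorem mergeProg_spec {s : State} {lo mid hi : ℕ} (h20 : s.nat 20 0 = lo) (h21 : s.nat 21 0 = mid)
    (h22 : s.nat 22 0 = hi) (hlm : lo ≤ mid) (hmh : mid ≤ hi)
    (hl : SortedOn (s.real 9) (s.nat 8) lo mid) (hr : SortedOn (s.real 9) (s.nat 8) mid hi) :
    Ends mergeProg s (60 * (hi - lo) + 30) (fun s' =>
      SortedOn (s.real 9) (s'.nat 9) lo hi ∧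
      (∀ f : ℕ → ℕ, ∑ x ∈ Finset.Ico lo hi, f (s'.nat 9 x) =
        ∑ x ∈ Finset.Ico lo hi, f (s.nat 8 x)) ∧
      ∀ x, x < lo ∨ hi ≤ x → s'.nat 9 x = s.nat 9 x) := by
  have key : Ends mergeProg s (16 + ((hi - lo) * 60 + 5)) (fun s' =>
      MergeInv (s.real 9) (s.nat 8) (s.nat 9) lo mid hi mid hi hi (s'.nat 9)) := by
    refine Ends.seq (ends_of_exec (Q := fun s' => s' = (setN 23 (nv 20) ;; setN 24 (nv 21) ;;
      setN 25 (nv 20)).exec s) rfl (by decide) rfl) fun s₁ hf₁ hs₁ => ?_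
    have e23 : s₁.nat 23 0 = lo := by rw [hs₁]; simp [Prog.exec, NExp.eval, h20]
    have e24 : s₁.nat 24 0 = mid := by rw [hs₁]; simp [Prog.exec, NExp.eval, h21]
    have e25 : s₁.nat 25 0 = lo := by rw [hs₁]; simp [Prog.exec, NExp.eval, h20]
    refine (Ends.loop (fun b s' => b = (hi - s'.nat 25 0) * 60 ∧
      MergeInv (s.real 9) (s.nat 8) (s.nat 9) lo mid hi (s'.nat 23 0) (s'.nat 24 0) (s'.nat 25 0)
        (s'.nat 9)) ?_ (k := (hi - lo) * 60) ⟨by rw [e25], ?_⟩).mono ?_ ?_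
    · rintro b s' hf ⟨rfl, hinv⟩ hb
      have e8 : s'.nat 8 = s.nat 8 := by rw [hf.1 8 rfl, hf₁.1 8 rfl]
      have er : s'.real 9 = s.real 9 := by rw [hf.2 9 rfl, hf₁.2 9 rfl]
      have e21 : s'.nat 21 0 = mid := by rw [hf.1 21 rfl, hf₁.1 21 rfl, h21]
      have e22 : s'.nat 22 0 = hi := by rw [hf.1 22 rfl, hf₁.1 22 rfl, h22]
      simp only [Test.Holds, NExp.eval, e22] at hb
      have hio := hinv.out
      have h3 := hinv.le_mid
      have h4 := hinv.le_hi
      refine ⟨55, ends_of_exec rfl (by decide) ?_⟩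
      by_cases ht : TakesLeft s'
      · obtain ⟨x9, x23, x24, x25⟩ := mergeBody_exec_left ht
        refine ⟨(hi - (s'.nat 25 0 + 1)) * 60, ⟨by rw [x25], ?_⟩, ?_⟩
        · rw [x9, x23, x24, x25, e8]
          unfold TakesLeft at ht
          rw [e21, e22, e8, er] at ht
          refine hinv.left hl ht.1 fun y hy hy' => ?_
          exact (ht.2 (by omega)).trans (hr _ _ hinv.mid_le hy hy')
        · simp only [Test.cost, NExp.cost]
          omega
      · obtain ⟨x9, x23, x24, x25⟩ := mergeBody_exec_right ht
        refine ⟨(hi - (s'.nat 25 0 + 1)) * 60, ⟨by rw [x25], ?_⟩, ?_⟩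
        · rw [x9, x23, x24, x25, e8]
          unfold TakesLeft at ht
          rw [e21, e22, e8, er] at ht
          -- If the right range were exhausted, the left one would not be, and the entry would come
          -- from there.
          have hj : s'.nat 24 0 < hi := by
            by_contra hj
            refine ht ⟨by omega, fun h' => absurd h' hj⟩
          refine hinv.right hr hj fun y hy hy' => ?_
          have h5 : s.real 9 (s.nat 8 (s'.nat 24 0)) ≤ s.real 9 (s.nat 8 (s'.nat 23 0)) := by
            by_contra h5
            exact ht ⟨by omega, fun _ => (not_le.1 h5).le⟩
          exact h5.trans (hl _ _ hinv.lo_le hy hy')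
        · simp only [Test.cost, NExp.cost]
          omega
    · rw [e23, e24, e25, hf₁.1 9 rfl]
      exact ⟨le_rfl, hlm, le_rfl, hmh, by omega, fun x y _ _ _ => by omega, fun x _ _ => by omega,
        fun x _ _ => by omega, fun f => by simp, fun x _ => rfl⟩
    · simp only [Test.cost, NExp.cost]
      omega
    · rintro s' hf ⟨⟨b, rfl, hinv⟩, hb⟩
      have e22 : s'.nat 22 0 = hi := by rw [hf.1 22 rfl, hf₁.1 22 rfl, h22]
      simp only [Test.Holds, NExp.eval, e22] at hb
      have h1 := hinv.out
      have h2 := hinv.le_mid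
      have h3 := hinv.le_hi
      rw [show s'.nat 23 0 = mid by omega, show s'.nat 24 0 = hi by omega,
        show s'.nat 25 0 = hi by omega] at hinv
      exact hinv
  refine key.mono (by omega) fun s' _ h => ⟨h.sorted, fun f => ?_, h.outside⟩
  rw [h.sum f, Finset.sum_Ico_consecutive _ hlm hmh]

theorem copyProg_spec {s : State} {a b : ℕ} (h28 : s.nat 28 0 = a) (h29 : s.nat 29 0 = b) :
    Ends copyProg s (40 * (b - a) + 20) (fun s' =>
      ∀ x, s'.nat 8 x = if a ≤ x ∧ x < b then s.nat 9 x else s.nat 8 x) := by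
  refine (ends_forUp (N := b - a) (c := 20) (fun k s' => ∀ x, s'.nat 8 x =
    if a ≤ x ∧ x < a + k then s.nat 9 x else s.nat 8 x) rfl (fun s' hf => ?_)
    (fun k hk s' hf hi hinv => ?_) ?_).mono ?_ ?_
  · simp only [NExp.eval]
    rw [hf.1 28 rfl, hf.1 29 rfl, h28, h29]
  · refine ends_of_exec rfl (by decide) ?_
    intro x
    have e28 : s'.nat 28 0 = a := by rw [hf.1 28 rfl, h28]
    have e9 : s'.nat 9 = s.nat 9 := hf.1 9 rfl
    simp only [Prog.exec, NExp.eval, e28, e9, hi]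
    simp only [State.putNat_nat, hinv]
    by_cases hx : x = a + k
    · simp [hx]
    · have : (x < a + (k + 1)) ↔ x < a + k := by omega
      simp [hx, this]
  · intro x
    have : ¬ (a ≤ x ∧ x < a) := by omega
    simp [this]
  · simp only [NExp.cost]
    omega
  · rintro s' _ ⟨_, h⟩ x
    rw [h x]
    by_cases hx : a ≤ x ∧ x < b
    · rw [if_pos hx, if_pos (by omega)]
    · rw [if_neg hx, if_neg (by omega)]

theorem blockProg_exec (s : State) :
    (blockProg.exec s).nat 21 0 = min (s.nat 20 0 + s.nat 27 0) (s.nat 29 0) ∧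
    (blockProg.exec s).nat 22 0 = min (s.nat 20 0 + s.nat 27 0 + s.nat 27 0) (s.nat 29 0) := by
  simp only [blockProg, Prog.exec, Test.Holds, NExp.eval]
  by_cases h1 : s.nat 29 0 < s.nat 20 0 + s.nat 27 0 <;>
    by_cases h2 : s.nat 29 0 < s.nat 20 0 + s.nat 27 0 + s.nat 27 0 <;>
      simp [h1, h2] <;> omega

/-- The blocks of length `w` are sorted. -/
def BlockSorted (C : ℕ → ℝ) (E : ℕ → ℕ) (a b w : ℕ) : Prop :=
  ∀ q, SortedOn C E (a + q * w) (min (a + (q + 1) * w) b)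

theorem passProg_spec {s : State} {a b w : ℕ} (h28 : s.nat 28 0 = a) (h29 : s.nat 29 0 = b)
    (h27 : s.nat 27 0 = w) (hab : a ≤ b) (hw : 0 < w)
    (hs : BlockSorted (s.real 9) (s.nat 8) a b w) :
    Ends passProg s (160 * (b - a) + 10) (fun s' =>
      BlockSorted (s.real 9) (s'.nat 9) a b (w + w) ∧
      ∀ f : ℕ → ℕ, ∑ x ∈ Finset.Ico a b, f (s'.nat 9 x) =
        ∑ x ∈ Finset.Ico a b, f (s.nat 8 x)) := by
  have key : Ends passProg s (4 + ((b - a) * 160 + 5)) (fun s' =>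
      BlockSorted (s.real 9) (s'.nat 9) a b (w + w) ∧
      ∀ f : ℕ → ℕ, ∑ x ∈ Finset.Ico a b, f (s'.nat 9 x) =
        ∑ x ∈ Finset.Ico a b, f (s.nat 8 x)) := by
    refine Ends.seq (ends_exec (P := setN 20 (nv 28)) rfl s) fun s₁ hf₁ hs₁ => ?_
    have e20 : s₁.nat 20 0 = a := by rw [hs₁]; simp [Prog.exec, NExp.eval, h28]
    refine (Ends.loop (fun m s' => m = (b - s'.nat 20 0) * 160 ∧ a ≤ s'.nat 20 0 ∧
      s'.nat 20 0 ≤ b ∧ (∃ q, s'.nat 20 0 = min (a + q * (w + w)) b ∧ ∀ q' < q,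
        SortedOn (s.real 9) (s'.nat 9) (a + q' * (w + w)) (min (a + (q' + 1) * (w + w)) b)) ∧
      ∀ f : ℕ → ℕ, ∑ x ∈ Finset.Ico a (s'.nat 20 0), f (s'.nat 9 x) =
        ∑ x ∈ Finset.Ico a (s'.nat 20 0), f (s.nat 8 x)) ?_ (k := (b - a) * 160)
      ⟨by rw [e20], e20.ge, e20.trans_le hab, ⟨0, by rw [e20]; omega, by simp⟩,
        by simp [e20]⟩).mono ?_ ?_
    · rintro m s' hf ⟨rfl, ha, hb', ⟨q, hq, hsort⟩, hsum⟩ hb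
      have e8 : s'.nat 8 = s.nat 8 := by rw [hf.1 8 rfl, hf₁.1 8 rfl]
      have er : s'.real 9 = s.real 9 := by rw [hf.2 9 rfl, hf₁.2 9 rfl]
      have e27 : s'.nat 27 0 = w := by rw [hf.1 27 rfl, hf₁.1 27 rfl, h27]
      have e29 : s'.nat 29 0 = b := by rw [hf.1 29 rfl, hf₁.1 29 rfl, h29]
      simp only [Test.Holds, NExp.eval, e29] at hb
      set lo := s'.nat 20 0 with hlo
      have hlo' : lo = a + q * (w + w) := by omega
      have hbl := blockProg_exec s'
      rw [← hlo, e27, e29] at hbl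
      -- A merger handles at least one entry, so the constants fit into `160` steps per entry.
      refine ⟨50 + ((60 * (min (lo + w + w) b - lo) + 30) + 4), ?_⟩
      refine Ends.seq (ends_of_exec (Q := fun t => t = blockProg.exec s') rfl (by decide) rfl)
        fun s₂ hf₂ hs₂ => ?_
      rw [← hs₂] at hbl
      have e8' : s₂.nat 8 = s.nat 8 := by rw [hf₂.1 8 rfl, e8]
      have er' : s₂.real 9 = s.real 9 := by rw [hf₂.2 9 rfl, er]
      -- The block `q` of the doubled width consists of the old blocks `2 * q` and `2 * q + 1`.
      have hm : (2 * q + 1) * w = q * (w + w) + w := by ring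
      have hm' : (2 * q + 1 + 1) * w = q * (w + w) + w + w := by ring
      have hm'' : 2 * q * w = q * (w + w) := by ring
      have hm3 : (q + 1) * (w + w) = q * (w + w) + w + w := by ring
      refine Ends.seq (mergeProg_spec (lo := lo) (hf₂.1 20 rfl ▸ hlo.symm) hbl.1 hbl.2 (by omega)
        (by omega) ?_ ?_) fun s₃ hf₃ ⟨hs₃, hsum₃, hout₃⟩ => ?_
      · rw [e8', er']
        have := hs (2 * q)
        rw [hm, hm''] at this
        rwa [hlo', add_assoc]
      · rw [e8', er']
        have := hs (2 * q + 1)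
        rw [hm, hm'] at this
        intro x y hx hxy hy
        exact this x y (by omega) hxy (by omega)
      · refine ends_of_exec rfl (by decide) ?_
        have x20 : ((setN 20 (nv 22)).exec s₃).nat 20 0 = min (lo + w + w) b := by
          simp only [Prog.exec, NExp.eval, State.putNat_nat, if_true, hf₃.1 22 rfl]
          exact hbl.2
        have x9 : ((setN 20 (nv 22)).exec s₃).nat 9 = s₃.nat 9 := by
          funext x
          simp [Prog.exec]
        have h9 : s₂.nat 9 = s'.nat 9 := hf₂.1 9 rfl
        refine ⟨(b - min (lo + w + w) b) * 160, ⟨by rw [x20], by omega, by omega, ?_, ?_⟩, ?_⟩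
        · refine ⟨q + 1, by rw [x20]; omega, fun q' hq' => ?_⟩
          rw [x9]
          rcases Nat.lt_succ_iff_lt_or_eq.1 hq' with h | rfl
          · refine (hsort q' h).congr fun x hx hx' => ?_
            have : (q' + 1) * (w + w) ≤ q * (w + w) := Nat.mul_le_mul_right _ h
            rw [hout₃ x (Or.inl (by omega)), h9]
          · rw [er'] at hs₃
            rwa [hm3, ← hlo', ← add_assoc, ← add_assoc, ← hlo']
        · intro f
          rw [x20, x9, ← Finset.sum_Ico_consecutive _ ha (show lo ≤ min (lo + w + w) b by omega),
            ← Finset.sum_Ico_consecutive _ ha (show lo ≤ min (lo + w + w) b by omega),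
            hsum₃ f, e8', ← hsum f]
          congr 1
          refine Finset.sum_congr rfl fun x hx => ?_
          rw [Finset.mem_Ico] at hx
          rw [hout₃ x (Or.inl hx.2), h9]
        · simp only [Test.cost, NExp.cost]
          omega
    · simp only [Test.cost, NExp.cost]
      omega
    · rintro s' hf ⟨⟨m, rfl, ha, hb', ⟨q, hq, hsort⟩, hsum⟩, hb⟩
      have e29 : s'.nat 29 0 = b := by rw [hf.1 29 rfl, hf₁.1 29 rfl, h29]
      simp only [Test.Holds, NExp.eval, e29] at hb
      have hlo : s'.nat 20 0 = b := by omega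
      rw [hlo] at hsum hq
      refine ⟨fun q' => ?_, hsum⟩
      by_cases hq' : q' < q
      · exact hsort q' hq'
      · intro x y hx hxy hy
        have : q * (w + w) ≤ q' * (w + w) := Nat.mul_le_mul_right _ (by omega)
        omega
  exact key.mono (by omega) fun _ _ h => h

/-- The width of the sorted blocks doubles with each linear pass, so `L` passes suffice. -/
theorem sortProg_spec {s : State} {a b L : ℕ} (h28 : s.nat 28 0 = a) (h29 : s.nat 29 0 = b)
    (hab : a ≤ b) (hL : b - a ≤ 2 ^ L) :
    Ends sortProg s (L * (200 * (b - a) + 50) + 20) (fun s' =>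
      SortedOn (s.real 9) (s'.nat 8) a b ∧
      (∀ f : ℕ → ℕ, ∑ x ∈ Finset.Ico a b, f (s'.nat 8 x) =
        ∑ x ∈ Finset.Ico a b, f (s.nat 8 x)) ∧
      ∀ x, x < a → s'.nat 8 x = s.nat 8 x) := by
  have key : Ends sortProg s (3 + (L * (200 * (b - a) + 50) + 8)) (fun s' =>
      SortedOn (s.real 9) (s'.nat 8) a b ∧
      (∀ f : ℕ → ℕ, ∑ x ∈ Finset.Ico a b, f (s'.nat 8 x) =
        ∑ x ∈ Finset.Ico a b, f (s.nat 8 x)) ∧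
      ∀ x, x < a → s'.nat 8 x = s.nat 8 x) := by
    refine Ends.seq (ends_exec (P := setN 27 (.lit 1)) rfl s) fun s₁ hf₁ hs₁ => ?_
    have e27 : s₁.nat 27 0 = 1 := by rw [hs₁]; simp [Prog.exec, NExp.eval]
    refine (Ends.loop (fun m s' => ∃ k ≤ L, m = (L - k) * (200 * (b - a) + 50) ∧
      s'.nat 27 0 = 2 ^ k ∧ BlockSorted (s.real 9) (s'.nat 8) a b (2 ^ k) ∧
      (∀ f : ℕ → ℕ, ∑ x ∈ Finset.Ico a b, f (s'.nat 8 x) =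
        ∑ x ∈ Finset.Ico a b, f (s.nat 8 x)) ∧
      ∀ x, x < a → s'.nat 8 x = s.nat 8 x) ?_ (k := L * (200 * (b - a) + 50))
      ⟨0, Nat.zero_le L, by simp, by rw [e27, pow_zero], ?_, ?_, ?_⟩).mono ?_ ?_
    · rintro m s' hf ⟨k, hk, rfl, hw, hbs, hsum, hout⟩ hb
      have er : s'.real 9 = s.real 9 := by rw [hf.2 9 rfl, hf₁.2 9 rfl]
      have e28 : s'.nat 28 0 = a := by rw [hf.1 28 rfl, hf₁.1 28 rfl, h28]
      have e29 : s'.nat 29 0 = b := by rw [hf.1 29 rfl, hf₁.1 29 rfl, h29]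
      simp only [Test.Holds, NExp.eval, e28, e29, hw] at hb
      have hkL : k < L := (Nat.pow_lt_pow_iff_right (by norm_num : 1 < 2)).1 (hb.trans_le hL)
      refine ⟨(160 * (b - a) + 10) + ((40 * (b - a) + 20) + 7), ?_⟩
      rw [← er] at hbs
      refine Ends.seq (passProg_spec e28 e29 hw hab (by positivity) hbs) fun s₂ hf₂ ⟨hb₂, hsum₂⟩ => ?_
      refine Ends.seq (copyProg_spec ((congrFun (hf₂.1 28 rfl) 0).trans e28)
        ((congrFun (hf₂.1 29 rfl) 0).trans e29)) fun s₃ hf₃ h₃ => ?_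
      refine ends_of_exec rfl (by decide) ?_
      have x27 : ((setN 27 (.add (nv 27) (nv 27))).exec s₃).nat 27 0 = 2 ^ (k + 1) := by
        simp only [Prog.exec, NExp.eval, State.putNat_nat, if_true, hf₃.1 27 rfl, hf₂.1 27 rfl, hw]
        ring
      have x8 : ((setN 27 (.add (nv 27) (nv 27))).exec s₃).nat 8 = s₃.nat 8 := by
        funext x
        simp [Prog.exec]
      refine ⟨_, ⟨k + 1, hkL, rfl, x27, ?_, ?_, ?_⟩, ?_⟩
      · rw [x8, ← er, show (2 : ℕ) ^ (k + 1) = 2 ^ k + 2 ^ k by ring]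
        intro q
        refine (hb₂ q).congr fun x hx hx' => ?_
        rw [h₃ x, if_pos (by omega)]
      · intro f
        rw [x8, ← hsum f, ← hsum₂ f]
        refine Finset.sum_congr rfl fun x hx => ?_
        rw [Finset.mem_Ico] at hx
        rw [h₃ x, if_pos hx]
      · intro x hx
        rw [x8, h₃ x, if_neg (by omega), hf₂.1 8 rfl, hout x hx]
      · simp only [Test.cost, NExp.cost]
        obtain ⟨d, rfl⟩ : ∃ d, L = k + 1 + d := ⟨L - (k + 1), by omega⟩
        rw [show k + 1 + d - (k + 1) = d by omega, show k + 1 + d - k = d + 1 by omega, add_mul, one_mul]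
        omega
    · intro q x y hx hxy hy
      obtain rfl : x = y := by omega
      exact le_rfl
    · intro f
      rw [hf₁.1 8 rfl]
    · intro x _
      rw [hf₁.1 8 rfl]
    · simp only [Test.cost, NExp.cost]
      omega
    · rintro s' hf ⟨⟨m, k, hk, rfl, hw, hbs, hsum, hout⟩, hb⟩
      have e28 : s'.nat 28 0 = a := by rw [hf.1 28 rfl, hf₁.1 28 rfl, h28]
      have e29 : s'.nat 29 0 = b := by rw [hf.1 29 rfl, hf₁.1 29 rfl, h29]
      simp only [Test.Holds, NExp.eval, e28, e29, hw] at hb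
      refine ⟨?_, hsum, hout⟩
      intro x y hx hxy hy
      exact hbs 0 x y (by omega) hxy (by omega)
  exact key.mono (by omega) fun _ _ h => h

/-- Sort the new entries, between the registers `16` and `17`, and merge them with the old ones. -/
def insertProg : Prog :=
  (setN 28 (nv 16) ;; setN 29 (nv 17)) ;; sortProg ;;
  (setN 20 (.lit 0) ;; setN 21 (nv 16) ;; setN 22 (nv 17)) ;; mergeProg ;;
  (setN 28 (.lit 0)) ;; copyProg ;; setN 16 (nv 17)

/-- Only the new entries pay the factor `L`; the old ones take part in a linear merger. Over the
whole search each entry is thus sorted once, which avoids a second logarithm. -/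
theorem insertProg_spec {s : State} {k t L : ℕ} (h16 : s.nat 16 0 = k) (h17 : s.nat 17 0 = t)
    (hkt : k ≤ t) (hL : t ≤ 2 ^ L) (hs : SortedOn (s.real 9) (s.nat 8) 0 k) :
    Ends insertProg s (L * (200 * (t - k) + 50) + 100 * t + 150) (fun s' =>
      s'.nat 16 0 = t ∧ SortedOn (s.real 9) (s'.nat 8) 0 t ∧
      ∀ f : ℕ → ℕ, ∑ x ∈ Finset.range t, f (s'.nat 8 x) =
        ∑ x ∈ Finset.range t, f (s.nat 8 x)) := by
  have key : Ends insertProg s (10 + ((L * (200 * (t - k) + 50) + 20) + (20 + ((60 * (t - 0) + 30) +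
      (3 + ((40 * (t - 0) + 20) + 4)))))) (fun s' =>
      s'.nat 16 0 = t ∧ SortedOn (s.real 9) (s'.nat 8) 0 t ∧
      ∀ f : ℕ → ℕ, ∑ x ∈ Finset.range t, f (s'.nat 8 x) =
        ∑ x ∈ Finset.range t, f (s.nat 8 x)) := by
    refine Ends.seq (ends_of_exec (Q := fun s' => s'.nat 28 0 = k ∧ s'.nat 29 0 = t) rfl (by decide)
      (by simp [Prog.exec, NExp.eval, h16, h17])) fun s₁ hf₁ ⟨h28, h29⟩ => ?_
    refine Ends.seq (sortProg_spec h28 h29 hkt (by omega)) fun s₂ hf₂ ⟨hs₂, hsum₂, hout₂⟩ => ?_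
    have e16 : s₂.nat 16 0 = k := by rw [hf₂.1 16 rfl, hf₁.1 16 rfl, h16]
    have e17 : s₂.nat 17 0 = t := by rw [hf₂.1 17 rfl, hf₁.1 17 rfl, h17]
    refine Ends.seq (ends_of_exec (Q := fun s' => s'.nat 20 0 = 0 ∧ s'.nat 21 0 = k ∧
      s'.nat 22 0 = t) rfl (by decide) (by simp [Prog.exec, NExp.eval, e16, e17]))
      fun s₃ hf₃ ⟨h20, h21, h22⟩ => ?_
    have e8 : s₃.nat 8 = s₂.nat 8 := hf₃.1 8 rfl
    have er : s₁.real 9 = s.real 9 := hf₁.2 9 rfl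
    have er' : s₃.real 9 = s.real 9 := by rw [hf₃.2 9 rfl, hf₂.2 9 rfl, hf₁.2 9 rfl]
    have e8' : s₁.nat 8 = s.nat 8 := hf₁.1 8 rfl
    refine Ends.seq (mergeProg_spec h20 h21 h22 (Nat.zero_le k) hkt ?_ ?_)
      fun s₄ hf₄ ⟨hs₄, hsum₄, _⟩ => ?_
    · rw [e8, er']
      refine hs.congr fun x _ hx => ?_
      rw [hout₂ x hx, e8']
    · rw [e8, er', ← er]
      exact hs₂
    refine Ends.seq (ends_of_exec (Q := fun s' => s'.nat 28 0 = 0) rfl (by decide)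
      (by simp [Prog.exec, NExp.eval])) fun s₅ hf₅ h₅ => ?_
    have e29 : s₅.nat 29 0 = t := by
      rw [hf₅.1 29 rfl, hf₄.1 29 rfl, hf₃.1 29 rfl, hf₂.1 29 rfl, h29]
    have e9 : s₅.nat 9 = s₄.nat 9 := hf₅.1 9 rfl
    refine Ends.seq (copyProg_spec h₅ e29) fun s₆ hf₆ h₆ => ?_
    refine ends_of_exec rfl (by decide) ?_
    have x17 : s₆.nat 17 0 = t := by
      rw [hf₆.1 17 rfl, hf₅.1 17 rfl, hf₄.1 17 rfl, hf₃.1 17 rfl, e17]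
    have x8 : ∀ x, ((setN 16 (nv 17)).exec s₆).nat 8 x = s₆.nat 8 x := by
      intro x
      simp [Prog.exec]
    refine ⟨by simp [Prog.exec, NExp.eval, x17], ?_, fun f => ?_⟩
    · rw [er'] at hs₄
      refine hs₄.congr fun x hx hx' => ?_
      rw [x8, h₆ x, if_pos ⟨hx, hx'⟩, e9]
    · have h1 : ∑ x ∈ Finset.range t, f (((setN 16 (nv 17)).exec s₆).nat 8 x) =
          ∑ x ∈ Finset.Ico 0 t, f (s₄.nat 9 x) := by
        rw [Finset.range_eq_Ico]
        refine Finset.sum_congr rfl fun x hx => ?_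
        rw [Finset.mem_Ico] at hx
        rw [x8, h₆ x, if_pos hx, e9]
      rw [h1, hsum₄ f, e8, Finset.range_eq_Ico,
        ← Finset.sum_Ico_consecutive _ (Nat.zero_le k) hkt,
        ← Finset.sum_Ico_consecutive _ (Nat.zero_le k) hkt, hsum₂ f, e8']
      congr 1
      refine Finset.sum_congr rfl fun x hx => ?_
      rw [Finset.mem_Ico] at hx
      rw [hout₂ x hx.2, e8']
  exact key.mono (by omega) fun _ _ h => h

/-! ### The symbolic greedy algorithm -/

/-- The zero of a linear function; it is `0` if the slope is `0`. -/
noncomputable def lineRoot (a b : ℝ) : ℝ := (0 - b) / a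

/-- The value lies in the open interval. -/
def InRange (lo hi c : ℝ) : Prop := lo < c ∧ c < hi

theorem InRange.mono {lo hi lo' hi' c : ℝ} (h : InRange lo' hi' c) (h1 : lo ≤ lo') (h2 : hi' ≤ hi) :
    InRange lo hi c :=
  ⟨h1.trans_lt h.1, h.2.trans_le h2⟩

/-- An affine function has constant sign on an interval without its zero. For slope `0` it is
constant, whatever `lineRoot` returns. -/
theorem sign_of_not_inRange {a b lo hi : ℝ} (h : ¬ InRange lo hi (lineRoot a b))
    {x y : ℝ} (hx : x ∈ Set.Ioo lo hi) (hy : y ∈ Set.Ioo lo hi) :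
    (0 ≤ a * x + b → 0 ≤ a * y + b) ∧ (a * x + b < 0 → a * y + b < 0) ∧
      (a * x + b ≤ 0 → a * y + b ≤ 0) := by
  rcases eq_or_ne a 0 with rfl | ha
  · simp
  have hroot : a * lineRoot a b + b = 0 := by
    unfold lineRoot
    field_simp
    ring
  set c := lineRoot a b
  have e1 : a * x + b = a * (x - c) := by linarith
  have e2 : a * y + b = a * (y - c) := by linarith
  have hc : (0 < x - c ∧ 0 < y - c) ∨ (x - c < 0 ∧ y - c < 0) := by
    unfold InRange at h
    by_cases h1 : lo < c
    · have h2 : hi ≤ c := not_lt.1 fun h2 => h ⟨h1, h2⟩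
      exact Or.inr ⟨by linarith [hx.2], by linarith [hy.2]⟩
    · exact Or.inl ⟨by linarith [hx.1, not_lt.1 h1], by linarith [hy.1, not_lt.1 h1]⟩
  rw [e1, e2]
  rcases hc with ⟨h1, h2⟩ | ⟨h1, h2⟩ <;> rcases lt_or_gt_of_ne ha with h3 | h3
  · have := mul_neg_of_neg_of_pos h3 h1
    have := mul_neg_of_neg_of_pos h3 h2
    refine ⟨?_, ?_, ?_⟩ <;> intros <;> linarith
  · have := mul_pos h3 h1
    have := mul_pos h3 h2
    refine ⟨?_, ?_, ?_⟩ <;> intros <;> linarith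
  · have := mul_pos_of_neg_of_neg h3 h1
    have := mul_pos_of_neg_of_neg h3 h2
    refine ⟨?_, ?_, ?_⟩ <;> intros <;> linarith
  · have := mul_neg_of_pos_of_neg h3 h1
    have := mul_neg_of_pos_of_neg h3 h2
    refine ⟨?_, ?_, ?_⟩ <;> intros <;> linarith

/-- The order of two linear functions is constant between critical values. -/
theorem prec_of_not_inRange {a b a' b' lo hi : ℝ}
    (h : ¬ InRange lo hi (lineRoot (a + a') (b + b')))
    (h' : ¬ InRange lo hi (lineRoot (a - a') (b - b'))) {x y : ℝ} (hx : x ∈ Set.Ioo lo hi)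
    (hy : y ∈ Set.Ioo lo hi) (hp : Prec (a * x + b) (a' * x + b')) :
    Prec (a * y + b) (a' * y + b') := by
  -- `Prec` depends only on the signs of the sum and of the difference.
  obtain ⟨s1, s2, _⟩ := sign_of_not_inRange h hx hy
  obtain ⟨d1, _, d3⟩ := sign_of_not_inRange h' hx hy
  rcases hp with ⟨h1, h2⟩ | ⟨h1, h2⟩
  · exact Or.inl ⟨by linarith [s1 (by linarith)], by linarith [d3 (by linarith)]⟩
  · exact Or.inr ⟨by linarith [s2 (by linarith)], by linarith [d1 (by linarith)]⟩

/-! ### Symbolic states on a range of values -/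

namespace TreeNetwork

variable {n : ℕ} (T : TreeNetwork n)

/-- The critical values of the edge above a vertex: those of the comparisons of the two states at
the upper end, and of the signs of the states at both ends of the edge. -/
noncomputable def critVal (A B : ℕ → ℝ) (v j : ℕ) : ℝ :=
  if j = 0 then lineRoot (A (T.parN v) + A v) (B (T.parN v) + (B v - T.lenN v))
  else if j = 1 then lineRoot (A (T.parN v) - A v) (B (T.parN v) - (B v - T.lenN v))
  else if j = 2 then lineRoot (A v) (B v)
  else lineRoot (A v) (B v - T.lenN v)

/-- The invariant of the symbolic greedy algorithm, for the values between `lo` and `hi`. The edge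
above a vertex of status `1` has critical values, the one above a vertex of status `2` has been
taken into account. -/
structure SymInv (ord st : ℕ → ℕ) (A B crit : ℕ → ℝ) (lo hi : ℝ) : Prop where
  part : T.Partial (Set.Ioo lo hi) (fun v α => A v * α + B v) fun u => st u = 2
  st_le : ∀ v < n, st v ≤ 2
  -- A vertex leaves status `0` only when its children are resolved, so that its own line is final.
  child : ∀ v < n, st v ≠ 0 → ∀ u < n, u ≠ T.rootN → T.parN u = v → st u = 2
  -- Siblings take turns, the last in the order first; hence the line of the parent stays fixed
  -- while an active vertex has critical values that depend on it.
  sibling : ∀ i j, i < j → j < n → st (ord i) ≠ 0 → ord i ≠ T.rootN → ord j ≠ T.rootN →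
    T.parN (ord j) = T.parN (ord i) → st (ord j) = 2
  crit_eq : ∀ v < n, st v = 1 → ∀ j < 4, crit (4 * v + j) = T.critVal A B v j
  sign : ∀ v < n, st v = 2 → ∀ x ∈ Set.Ioo lo hi, ∀ y ∈ Set.Ioo lo hi,
    (0 ≤ A v * x + B v → 0 ≤ A v * y + B v) ∧
      (A v * x + B v - T.lenN v < 0 → A v * y + B v - T.lenN v < 0)
  out : ∀ v < n, st v = 2 → ∀ j < 4, ¬ InRange lo hi (crit (4 * v + j))

/-- Record the critical values of a vertex. -/
noncomputable def addCrit (A B crit : ℕ → ℝ) (v e : ℕ) : ℝ :=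
  if e / 4 = v then T.critVal A B v (e % 4) else crit e

variable {T}

theorem Partial.mono {X Y : Set ℝ} {acc : ℕ → ℝ → ℝ} {R : ℕ → Prop} (h : T.Partial X acc R)
    (hXY : Y ⊆ X) : T.Partial Y acc R := by
  refine ⟨fun v hv α hα => h.prec_reach v hv α (hXY hα),
    fun u hu hR hr α hα => h.prec_child u hu hR hr α (hXY hα), fun v hv => ?_⟩
  rcases h.eq_or v hv with h1 | ⟨u, hu, hR, hr, hp, h1⟩
  · exact Or.inl fun α hα => h1 α (hXY hα)
  · exact Or.inr ⟨u, hu, hR, hr, hp, fun α hα => h1 α (hXY hα)⟩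

theorem SymInv.shrink {ord st : ℕ → ℕ} {A B crit : ℕ → ℝ} {lo hi lo' hi' : ℝ}
    (h : T.SymInv ord st A B crit lo hi) (h1 : lo ≤ lo') (h2 : hi' ≤ hi) :
    T.SymInv ord st A B crit lo' hi' := by
  have hsub : Set.Ioo lo' hi' ⊆ Set.Ioo lo hi := Set.Ioo_subset_Ioo h1 h2
  exact ⟨h.part.mono hsub, h.st_le, h.child, h.sibling, h.crit_eq,
    fun v hv hst x hx y hy => h.sign v hv hst x (hsub hx) y (hsub hy),
    fun v hv hst j hj hr => h.out v hv hst j hj (hr.mono h1 h2)⟩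

theorem addCrit_of_ne {A B crit : ℕ → ℝ} {u v j : ℕ} (huv : u ≠ v) (hj : j < 4) :
    T.addCrit A B crit v (4 * u + j) = crit (4 * u + j) := by
  unfold addCrit
  rw [if_neg (by omega)]

theorem addCrit_self {A B crit : ℕ → ℝ} {v j : ℕ} (hj : j < 4) :
    T.addCrit A B crit v (4 * v + j) = T.critVal A B v j := by
  unfold addCrit
  rw [if_pos (by omega), show (4 * v + j) % 4 = j by omega]

theorem SymInv.activate {ord st : ℕ → ℕ} {A B crit : ℕ → ℝ} {lo hi : ℝ}
    (h : T.SymInv ord st A B crit lo hi) {k : ℕ} (ho : T.IsOrder ord) (hk : k < n)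
    (h0 : st (ord k) = 0)
    (hc : ∀ u < n, u ≠ T.rootN → T.parN u = ord k → st u = 2)
    (hs : ∀ j, k < j → j < n → ord k ≠ T.rootN → ord j ≠ T.rootN →
      T.parN (ord j) = T.parN (ord k) → st (ord j) = 2) :
    T.SymInv ord (Function.update st (ord k) 1) A B (T.addCrit A B crit (ord k)) lo hi := by
  have h2 : ∀ u, Function.update st (ord k) 1 u = 2 ↔ st u = 2 := by
    intro u
    rw [Function.update_apply]
    split_ifs with hu
    · rw [hu, h0]
      decide
    · rfl
  have hne2 : ∀ u, st u = 2 → u ≠ ord k := by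
    rintro u hu rfl
    omega
  refine ⟨?_, fun v hv => ?_, fun v hv hst u hu hur hup => ?_, fun i j hij hj hst hir hjr hp => ?_,
    fun v hv hst j hj => ?_, fun v hv hst => ?_, fun v hv hst j hj => ?_⟩
  · simp only [h2]
    exact h.part
  · rw [Function.update_apply]
    split_ifs
    · omega
    · exact h.st_le v hv
  · rw [h2]
    by_cases hvk : v = ord k
    · exact hc u hu hur (hup.trans hvk)
    · rw [Function.update_of_ne hvk] at hst
      exact h.child v hv hst u hu hur hup
  · rw [h2]
    by_cases hik : i = k
    · subst hik
      exact hs j hij hj hir hjr hp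
    · rw [Function.update_of_ne fun h' => hik (ho.inj i (by omega) k hk h')] at hst
      exact h.sibling i j hij hj hst hir hjr hp
  · by_cases hvk : v = ord k
    · subst hvk
      exact addCrit_self hj
    · rw [Function.update_of_ne hvk] at hst
      rw [addCrit_of_ne hvk hj]
      exact h.crit_eq v hv hst j hj
  · exact h.sign v hv ((h2 v).1 hst)
  · rw [h2] at hst
    rw [addCrit_of_ne (hne2 v hst) hj]
    exact h.out v hv hst j hj

/-- The new line at the upper end of an edge. -/
theorem SymInv.resolve {ord st : ℕ → ℕ} {A B crit : ℕ → ℝ} {lo hi : ℝ}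
    (h : T.SymInv ord st A B crit lo hi) {k : ℕ} (ho : T.IsOrder ord) (hk : k < n)
    {m : ℝ} (hm : m ∈ Set.Ioo lo hi) (h1 : st (ord k) = 1)
    (hout : ∀ j < 4, ¬ InRange lo hi (crit (4 * ord k + j))) {A' B' : ℕ → ℝ}
    (hA : Prec (A (T.parN (ord k)) * m + B (T.parN (ord k)))
      (A (ord k) * m + B (ord k) - T.lenN (ord k)) → A' = A ∧ B' = B)
    (hA' : ¬ Prec (A (T.parN (ord k)) * m + B (T.parN (ord k)))
      (A (ord k) * m + B (ord k) - T.lenN (ord k)) →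
      A' = Function.update A (T.parN (ord k)) (A (ord k)) ∧
      B' = Function.update B (T.parN (ord k)) (B (ord k) - T.lenN (ord k))) :
    T.SymInv ord (Function.update st (ord k) 2) A' B' crit lo hi := by
  set v := ord k with hvdef
  have hv : v < n := ho.lt k hk
  set q := T.parN v with hq
  have hc := fun j hj => h.crit_eq v hv h1 j hj
  have hout' : ∀ j < 4, ¬ InRange lo hi (T.critVal A B v j) := fun j hj => hc j hj ▸ hout j hj
  have o0 := hout' 0 (by norm_num)
  have o1 := hout' 1 (by norm_num)
  have o2 := hout' 2 (by norm_num)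
  have o3 := hout' 3 (by norm_num)
  simp only [critVal, if_true, one_ne_zero, if_false, OfNat.ofNat_ne_zero,
    show (2 : ℕ) ≠ 1 by norm_num, show (3 : ℕ) ≠ 1 by norm_num, show (3 : ℕ) ≠ 2 by norm_num,
    ← hq] at o0 o1 o2 o3
  -- The parent still has an unresolved child. So its line, the only one that changes, belongs to an
  -- inactive vertex.
  have hpar : v ≠ T.rootN → st q = 0 := by
    intro hr
    by_contra hq0
    have := h.child q (T.parN_lt v) hq0 v hv hr rfl
    omega
  -- The loop at the root again changes nothing.
  have hroot : v = T.rootN → A' = A ∧ B' = B := by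
    intro hr
    by_cases hp : Prec (A q * m + B q) (A v * m + B v - T.lenN v)
    · exact hA hp
    · obtain ⟨e1, e2⟩ := hA' hp
      have hqv : q = v := by rw [hq, hr, parN_rootN]
      rw [hqv, hr] at e1 e2
      rw [lenN_rootN, sub_zero] at e2
      exact ⟨by rw [e1, Function.update_eq_self], by rw [e2, Function.update_eq_self]⟩
  have hsame : ∀ u, u ≠ q → A' u = A u ∧ B' u = B u := by
    intro u hu
    by_cases hp : Prec (A q * m + B q) (A v * m + B v - T.lenN v)
    · rw [(hA hp).1, (hA hp).2]
      exact ⟨rfl, rfl⟩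
    · rw [(hA' hp).1, (hA' hp).2, Function.update_of_ne hu, Function.update_of_ne hu]
      exact ⟨rfl, rfl⟩
  have hst0 : ∀ u, st u ≠ 0 → A' u = A u ∧ B' u = B u := by
    intro u hu
    by_cases hr : v = T.rootN
    · rw [(hroot hr).1, (hroot hr).2]
      exact ⟨rfl, rfl⟩
    · refine hsame u ?_
      rintro rfl
      exact hu (hpar hr)
  have hst2 : ∀ u, Function.update st v 2 u = 2 ↔ (st u = 2 ∨ u = v) := by
    intro u
    rw [Function.update_apply]
    split_ifs with hu
    · simp [hu]
    · simp [hu]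
  have hst2' : ∀ u, Function.update st v 2 u = 2 → st u ≠ 0 := by
    intro u hu
    rcases (hst2 u).1 hu with h' | rfl <;> omega
  refine ⟨?_, fun u hu => ?_, fun x hx hst u hu hur hup => ?_,
    fun i j hij hj hst hir hjr hp => ?_, fun u hu hst j hj => ?_, fun u hu hst x hx y hy => ?_,
    fun u hu hst j hj => ?_⟩
  · have hstep := h.part.step (v := v) hv (fun hr => by rw [hpar hr]; decide)
      (f := fun α => A' q * α + B' q)
    -- The comparison at the sample point `m` is valid on the whole range, as both zeros lie
    -- outside.
    have hcases : (A' q = A q ∧ B' q = B q ∧ ∀ α ∈ Set.Ioo lo hi,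
          Prec (A q * α + B q) (A v * α + B v - T.lenN v)) ∨
        (A' q = A v ∧ B' q = B v - T.lenN v ∧ ∀ α ∈ Set.Ioo lo hi,
          Prec (A v * α + B v - T.lenN v) (A q * α + B q)) := by
      by_cases hp : Prec (A q * m + B q) (A v * m + B v - T.lenN v)
      · refine Or.inl ⟨by rw [(hA hp).1], by rw [(hA hp).2], fun α hα => ?_⟩
        rw [add_sub_assoc] at hp ⊢
        exact prec_of_not_inRange o0 o1 hm hα hp
      · refine Or.inr ⟨by rw [(hA' hp).1, Function.update_self],
          by rw [(hA' hp).2, Function.update_self], fun α hα => ?_⟩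
        by_contra hp'
        have hp'' := Prec.of_not hp'
        rw [add_sub_assoc] at hp hp''
        exact hp (prec_of_not_inRange o0 o1 hα hm hp'')
    have hres := hstep (fun α hα => by
        show Prec (A' q * α + B' q) (A q * α + B q)
        rcases hcases with ⟨e1, e2, _⟩ | ⟨e1, e2, e3⟩
        · rw [e1, e2]
          exact Prec.refl _
        · rw [e1, e2, ← add_sub_assoc]
          exact e3 α hα)
      (fun α hα => by
        show Prec (A' q * α + B' q) (A v * α + B v - T.lenN v)
        rcases hcases with ⟨e1, e2, e3⟩ | ⟨e1, e2, _⟩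
        · rw [e1, e2]
          exact e3 α hα
        · rw [e1, e2, ← add_sub_assoc]
          exact Prec.refl _)
      (by
        rcases hcases with ⟨e1, e2, _⟩ | ⟨e1, e2, _⟩
        · refine Or.inl fun α _ => ?_
          show A' q * α + B' q = A q * α + B q
          rw [e1, e2]
        · refine Or.inr fun α _ => ?_
          show A' q * α + B' q = A v * α + B v - T.lenN v
          rw [e1, e2, add_sub_assoc])
    convert hres using 1
    · funext u α
      rw [Function.update_apply]
      split_ifs with hu
      · rw [hu]
      · rw [(hsame u hu).1, (hsame u hu).2]
    · funext u
      exact propext (hst2 u)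
  · rw [Function.update_apply]
    split_ifs
    · exact le_rfl
    · exact h.st_le u hu
  · rw [hst2]
    by_cases hxv : x = v
    · exact Or.inl (h.child v hv (by omega) u hu hur (hup.trans hxv))
    · rw [Function.update_of_ne hxv] at hst
      exact Or.inl (h.child x hx hst u hu hur hup)
  · rw [hst2]
    by_cases hik : ord i = v
    · refine Or.inl (h.sibling i j hij hj ?_ hir hjr hp)
      rw [hik]
      omega
    · rw [Function.update_of_ne hik] at hst
      exact Or.inl (h.sibling i j hij hj hst hir hjr hp)
  · have huv : u ≠ v := by
      rintro rfl
      rw [Function.update_self] at hst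
      omega
    rw [Function.update_of_ne huv] at hst
    rw [h.crit_eq u hu hst j hj]
    have e1 := hst0 u (by omega)
    -- Otherwise `u` and `v` would be siblings, both of status `1`, against the rule that siblings
    -- take turns.
    have e2 : A' (T.parN u) = A (T.parN u) ∧ B' (T.parN u) = B (T.parN u) := by
      by_cases hr : v = T.rootN
      · rw [(hroot hr).1, (hroot hr).2]
        exact ⟨rfl, rfl⟩
      refine hsame _ fun hpu => ?_
      by_cases hur : u = T.rootN
      · rw [hur, parN_rootN] at hpu
        have := hpar hr
        rw [← hpu, ← hur] at this
        omega
      · obtain ⟨i, hi, rfl⟩ := ho.surj u hu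
        rcases lt_trichotomy i k with h' | h' | h'
        · have := h.sibling i k h' hk (by omega) hur hr hpu.symm
          rw [← hvdef] at this
          omega
        · exact huv (by rw [h'])
        · have := h.sibling k i h' hi (by rw [← hvdef]; omega) hr hur hpu
          omega
    unfold critVal
    rw [e1.1, e1.2, e2.1, e2.2]
  · have e1 := hst0 u (hst2' u hst)
    rw [e1.1, e1.2]
    rcases (hst2 u).1 hst with h' | rfl
    · exact h.sign u hu h' x hx y hy
    · refine ⟨(sign_of_not_inRange o2 hx hy).1, ?_⟩
      rw [add_sub_assoc, add_sub_assoc]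
      exact (sign_of_not_inRange o3 hx hy).2.1
  · rcases (hst2 u).1 hst with h' | rfl
    · exact h.out u hu h' j hj
    · exact hout j hj

/-! ### Entries and potential -/

/-- The first `t` entries are the critical values of the vertices of positive status. -/
def EntInv (n : ℕ) (st ent : ℕ → ℕ) (t : ℕ) : Prop :=
  ∀ f : ℕ → ℕ, ∑ i ∈ Finset.range t, f (ent i) =
    ∑ v ∈ Finset.range n, if st v = 0 then 0 else ∑ j ∈ Finset.range 4, f (4 * v + j)

/-- Apply the equality of sums to the indicator function of the unwanted entries. -/
theorem EntInv.exists_eq {st ent : ℕ → ℕ} {t : ℕ} (h : EntInv n st ent t) {i : ℕ} (hi : i < t) :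
    st (ent i / 4) ≠ 0 ∧ ent i / 4 < n := by
  classical
  have h1 := h fun e => if st (e / 4) ≠ 0 ∧ e / 4 < n then 0 else 1
  have h2 : (∑ v ∈ Finset.range n, if st v = 0 then 0 else ∑ j ∈ Finset.range 4,
      if st ((4 * v + j) / 4) ≠ 0 ∧ (4 * v + j) / 4 < n then 0 else 1) = 0 := by
    refine Finset.sum_eq_zero fun v hv => ?_
    rw [Finset.mem_range] at hv
    split_ifs with h0
    · rfl
    · refine Finset.sum_eq_zero fun j hj => ?_
      rw [Finset.mem_range] at hj
      rw [show (4 * v + j) / 4 = v by omega, if_pos ⟨h0, hv⟩]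
  rw [h2] at h1
  have h3 := Finset.sum_eq_zero_iff.1 h1 i (Finset.mem_range.2 hi)
  by_contra hc
  rw [if_neg hc] at h3
  exact one_ne_zero h3

theorem EntInv.le {st ent : ℕ → ℕ} {t : ℕ} (h : EntInv n st ent t) : t ≤ 4 * n := by
  have h1 := h fun _ => 1
  simp only [Finset.sum_const, Finset.card_range, smul_eq_mul, mul_one] at h1
  rw [h1]
  calc _ ≤ ∑ v ∈ Finset.range n, 4 := Finset.sum_le_sum fun v _ => by split_ifs <;> omega
    _ = 4 * n := by simp [mul_comm]

theorem EntInv.congr_st {st st' ent : ℕ → ℕ} {t : ℕ} (h : EntInv n st ent t)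
    (hst : ∀ v < n, st' v = 0 ↔ st v = 0) : EntInv n st' ent t := by
  intro f
  rw [h f]
  refine Finset.sum_congr rfl fun v hv => ?_
  rw [if_congr (hst v (Finset.mem_range.1 hv)) rfl rfl]

theorem EntInv.activate {st ent ent' : ℕ → ℕ} {t v : ℕ} (h : EntInv n st ent t) (hv : v < n)
    (h0 : st v = 0) (he : ∀ i < t, ent' i = ent i) (he' : ∀ j < 4, ent' (t + j) = 4 * v + j) :
    EntInv n (Function.update st v 1) ent' (t + 4) := by
  intro f
  have h1 : ∑ i ∈ Finset.range (t + 4), f (ent' i) =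
      ∑ i ∈ Finset.range t, f (ent i) + ∑ j ∈ Finset.range 4, f (4 * v + j) := by
    rw [Finset.sum_range_add]
    congr 1
    · exact Finset.sum_congr rfl fun i hi => by rw [he i (Finset.mem_range.1 hi)]
    · exact Finset.sum_congr rfl fun j hj => by rw [he' j (Finset.mem_range.1 hj)]
  have hv' : v ∈ Finset.range n := Finset.mem_range.2 hv
  rw [h1, h f, ← Finset.add_sum_erase _ _ hv', ← Finset.add_sum_erase (Finset.range n) (fun u =>
    if Function.update st v 1 u = 0 then 0 else ∑ j ∈ Finset.range 4, f (4 * u + j)) hv']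
  simp only [h0, if_true, Function.update_self, one_ne_zero, if_false, zero_add]
  rw [add_comm]
  congr 1
  refine Finset.sum_congr rfl fun u hu => ?_
  rw [Function.update_of_ne (Finset.ne_of_mem_erase hu)]

open Classical in
/-- The weight of an entry in the range. -/
noncomputable def entWeight (wt : ℕ → ℕ) (crit : ℕ → ℝ) (lo hi : ℝ) (e : ℕ) : ℕ :=
  if InRange lo hi (crit e) then wt (e / 4) else 0

/-- The potential of the symbolic greedy algorithm. -/
noncomputable def potential (n : ℕ) (wt st : ℕ → ℕ) (crit : ℕ → ℝ) (lo hi : ℝ) : ℕ :=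
  ∑ v ∈ Finset.range n, if st v = 0 then 4 * wt v else
    ∑ j ∈ Finset.range 4, entWeight wt crit lo hi (4 * v + j)

theorem entWeight_le (wt : ℕ → ℕ) (crit : ℕ → ℝ) (lo hi : ℝ) {v j : ℕ} (hj : j < 4) :
    entWeight wt crit lo hi (4 * v + j) ≤ wt v := by
  unfold entWeight
  rw [show (4 * v + j) / 4 = v by omega]
  split_ifs
  · exact le_rfl
  · exact Nat.zero_le _

/-- An inactive vertex has prepaid four times its weight, the most that its critical values can
weigh once they are recorded. -/
theorem potential_activate {wt st : ℕ → ℕ} {A B crit : ℕ → ℝ} {lo hi : ℝ} {v : ℕ} (h0 : st v = 0) :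
    potential n wt (Function.update st v 1) (T.addCrit A B crit v) lo hi ≤
      potential n wt st crit lo hi := by
  refine Finset.sum_le_sum fun u _ => ?_
  by_cases huv : u = v
  · subst huv
    rw [Function.update_self, if_neg one_ne_zero, if_pos h0]
    calc _ ≤ ∑ j ∈ Finset.range 4, wt u :=
          Finset.sum_le_sum fun j hj => entWeight_le _ _ _ _ (Finset.mem_range.1 hj)
      _ = 4 * wt u := by simp
  · rw [Function.update_of_ne huv]
    split_ifs
    · exact le_rfl
    · refine Finset.sum_le_sum fun j hj => ?_
      unfold entWeight
      rw [addCrit_of_ne huv (Finset.mem_range.1 hj)]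

theorem potential_congr_st {wt st st' : ℕ → ℕ} {crit : ℕ → ℝ} {lo hi : ℝ}
    (hst : ∀ v < n, st' v = 0 ↔ st v = 0) :
    potential n wt st' crit lo hi = potential n wt st crit lo hi := by
  refine Finset.sum_congr rfl fun v hv => ?_
  rw [if_congr (hst v (Finset.mem_range.1 hv)) rfl rfl]

theorem EntInv.potential_eq {wt st ent : ℕ → ℕ} {crit : ℕ → ℝ} {lo hi : ℝ} {t : ℕ}
    (h : EntInv n st ent t) :
    potential n wt st crit lo hi = 4 * (∑ v ∈ (Finset.range n).filter (st · = 0), wt v) +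
      ∑ i ∈ Finset.range t, entWeight wt crit lo hi (ent i) := by
  rw [h (entWeight wt crit lo hi), Finset.sum_filter, Finset.mul_sum, ← Finset.sum_add_distrib]
  refine Finset.sum_congr rfl fun v _ => ?_
  split_ifs <;> simp

variable (T) in
/-- The vertex of index `i` is resolved or has to wait for another one or for a critical value. -/
def Saturated (ord st : ℕ → ℕ) (crit : ℕ → ℝ) (lo hi : ℝ) (i : ℕ) : Prop :=
  st (ord i) = 2 ∨ (∃ u < n, u ≠ T.rootN ∧ T.parN u = ord i ∧ st u ≠ 2) ∨
    (ord i ≠ T.rootN ∧ ∃ j, i < j ∧ j < n ∧ ord j ≠ T.rootN ∧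
      T.parN (ord j) = T.parN (ord i) ∧ st (ord j) ≠ 2) ∨
    st (ord i) = 1 ∧ ∃ j < 4, InRange lo hi (crit (4 * ord i + j))

theorem IsBinary.false_of_three (hb : T.IsBinary) {a b c : ℕ} (ha : a < n) (hb' : b < n) (hc : c < n)
    (har : a ≠ T.rootN) (hbr : b ≠ T.rootN) (hcr : c ≠ T.rootN) (hab : a ≠ b) (hac : a ≠ c)
    (hbc : b ≠ c) (h1 : T.parN b = T.parN a) (h2 : T.parN c = T.parN a) : False := by
  have hp : ∀ v (hv : v < n), T.parN v = T.parent ⟨v, hv⟩ := fun v hv =>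
    padded_val _ (⟨v, hv⟩ : Fin n)
  have hr : ∀ v (hv : v < n), v ≠ T.rootN → (⟨v, hv⟩ : Fin n) ≠ T.root := fun v hv h h' =>
    h (congrArg Fin.val h')
  have h3 := hb (T.parent ⟨a, ha⟩)
  have hsub : ({⟨a, ha⟩, ⟨b, hb'⟩, ⟨c, hc⟩} : Finset (Fin n)) ⊆
      Finset.univ.filter fun u => u ≠ T.root ∧ T.parent u = T.parent ⟨a, ha⟩ := by
    intro x hx
    simp only [Finset.mem_insert, Finset.mem_singleton] at hx
    simp only [Finset.mem_filter, Finset.mem_univ, true_and]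
    rcases hx with rfl | rfl | rfl
    · exact ⟨hr _ _ har, rfl⟩
    · exact ⟨hr _ _ hbr, Fin.ext (by rw [← hp, ← hp, h1])⟩
    · exact ⟨hr _ _ hcr, Fin.ext (by rw [← hp, ← hp, h2])⟩
  have h4 := Finset.card_le_card hsub
  have h5 : ({⟨a, ha⟩, ⟨b, hb'⟩, ⟨c, hc⟩} : Finset (Fin n)).card = 3 :=
    Finset.card_eq_three.2 ⟨⟨a, ha⟩, ⟨b, hb'⟩, ⟨c, hc⟩, by simpa using hab, by simpa using hac,
      by simpa using hbc, rfl⟩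
  omega

theorem sum_le_sum_of_inj {S S' : Finset ℕ} {f f' : ℕ → ℕ} (g : ℕ → ℕ) (hg : ∀ v ∈ S, g v ∈ S')
    (hinj : ∀ v ∈ S, ∀ v' ∈ S, g v = g v' → v = v') (hf : ∀ v ∈ S, f v = f' (g v)) :
    ∑ v ∈ S, f v ≤ ∑ v ∈ S', f' v := by
  rw [Finset.sum_congr rfl hf, ← Finset.sum_image (f := f') (g := g) hinj]
  refine Finset.sum_le_sum_of_subset fun x hx => ?_
  obtain ⟨v, hv, rfl⟩ := Finset.mem_image.1 hx
  exact hg v hv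

/-- The vertices of status `0` carry at most three times the weight of those of status `1`. -/
theorem sum_inactive_le (hb : T.IsBinary) {ord wt st : ℕ → ℕ} {crit : ℕ → ℝ} {lo hi : ℝ}
    (ho : T.IsOrder ord) (hw : T.IsWeight wt) (hst : ∀ v < n, st v ≤ 2)
    (hsat : ∀ i < n, T.Saturated ord st crit lo hi i) :
    ∑ v ∈ (Finset.range n).filter (st · = 0), wt v ≤
      3 * ∑ v ∈ (Finset.range n).filter (st · = 1), wt v := by
  classical
  let IsA : ℕ → Prop := fun v => ∃ u < n, u ≠ T.rootN ∧ T.parN u = v ∧ st u ≠ 2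
  let U := (Finset.range n).filter (st · = 0)
  let Ua := U.filter IsA
  let Ub := U.filter fun v => ¬ IsA v
  let Y := (Finset.range n).filter (st · = 1)
  have hU : ∑ v ∈ Ua, wt v + ∑ v ∈ Ub, wt v = ∑ v ∈ U, wt v := Finset.sum_filter_add_sum_filter_not _ _ _
  have memU : ∀ v, v ∈ U ↔ v < n ∧ st v = 0 := fun v => by simp [U]
  have memY : ∀ v, v ∈ Y ↔ v < n ∧ st v = 1 := fun v => by simp [Y]
  have memA : ∀ v, v ∈ Ua ↔ (v < n ∧ st v = 0) ∧ IsA v := fun v => by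
    rw [Finset.mem_filter, memU]
  have memB : ∀ v, v ∈ Ub ↔ (v < n ∧ st v = 0) ∧ ¬ IsA v := fun v => by
    rw [Finset.mem_filter, memU]
  have hUY : Disjoint U Y := by
    rw [Finset.disjoint_left]
    intro v h1 h2
    rw [memU] at h1
    rw [memY] at h2
    omega
  have hAY : Disjoint Ua Y := Finset.disjoint_of_subset_left (Finset.filter_subset _ _) hUY
  have hunres : ∀ v < n, st v ≠ 2 → v ∈ U ∪ Y := by
    intro v hv h2
    rw [Finset.mem_union, memU, memY]
    have := hst v hv
    omega
  have ha : ∀ v ∈ Ua, ∃ u < n, u ≠ T.rootN ∧ T.parN u = v ∧ st u ≠ 2 := fun v hv =>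
    ((memA v).1 hv).2
  choose! g hg using ha
  -- Charge each vertex of `Ua` to an unresolved child, which is four times as heavy and has only
  -- this parent.
  have h1 : 4 * ∑ v ∈ Ua, wt v ≤ ∑ v ∈ U, wt v + ∑ v ∈ Y, wt v := by
    rw [Finset.mul_sum, ← Finset.sum_union hUY]
    refine sum_le_sum_of_inj g (fun v hv => hunres _ (hg v hv).1 (hg v hv).2.2.2)
      (fun v hv v' hv' h => ?_) fun v hv => ?_
    · rw [← (hg v hv).2.2.1, h, (hg v' hv').2.2.1]
    · rw [hw.par _ (hg v hv).1 (hg v hv).2.1, (hg v hv).2.2.1]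
  have hb' : ∀ v ∈ Ub, ∃ i j, i < n ∧ ord i = v ∧ v ≠ T.rootN ∧ i < j ∧ j < n ∧ ord j ≠ T.rootN ∧
      T.parN (ord j) = T.parN v ∧ st (ord j) ≠ 2 := by
    intro v hv
    obtain ⟨⟨hvn, h0⟩, hA⟩ := (memB v).1 hv
    obtain ⟨i, hi, rfl⟩ := ho.surj v hvn
    rcases hsat i hi with h | h | ⟨hr, j, hij, hj, h⟩ | h
    · omega
    · exact absurd h hA
    · exact ⟨i, j, hi, rfl, hr, hij, hj, h⟩
    · omega
  choose! p q hp hpv hvr hpq hq hqr hqp hq2 using hb'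
  have hne : ∀ v ∈ Ub, v ≠ ord (q v) := by
    intro v hv h
    have := ho.inj _ (hp v hv) _ (hq v hv) ((hpv v hv).trans h)
    have := hpq v hv
    omega
  -- Charge each vertex of `Ub` to the sibling it waits for, which has the same weight.
  have h2 : ∑ v ∈ Ub, wt v ≤ ∑ v ∈ Ua, wt v + ∑ v ∈ Y, wt v := by
    rw [← Finset.sum_union hAY]
    refine sum_le_sum_of_inj (fun v => ord (q v)) (fun v hv => ?_) (fun v hv v' hv' h => ?_)
      fun v hv => ?_
    · have hlt := ho.lt _ (hq v hv)
      have h3 := hunres _ hlt (hq2 v hv)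
      rw [Finset.mem_union] at h3 ⊢
      rcases h3 with h3 | h3
      · by_contra h4
        push Not at h4
        have hB : ord (q v) ∈ Ub := by
          rw [memB]
          rw [memA] at h4
          rw [memU] at h3
          exact ⟨h3, fun h5 => h4.1 ⟨h3, h5⟩⟩
        have e1 := ho.inj _ (hp _ hB) _ (hq v hv) (hpv _ hB)
        have e2 := hpq _ hB
        have e3 := hpq v hv
        refine hb.false_of_three ((memB v).1 hv).1.1 hlt (ho.lt _ (hq _ hB)) (hvr v hv) (hqr v hv)
          (hqr _ hB) (hne v hv) ?_ (hne _ hB) (hqp v hv) ((hqp _ hB).trans (hqp v hv))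
        intro h5
        have := ho.inj _ (hp v hv) _ (hq _ hB) ((hpv v hv).trans h5)
        omega
      · exact Or.inr h3
    · by_contra hvv
      have h' : ord (q v) = ord (q v') := h
      refine hb.false_of_three ((memB v).1 hv).1.1 ((memB v').1 hv').1.1 (ho.lt _ (hq v hv))
        (hvr v hv) (hvr v' hv') (hqr v hv) hvv (hne v hv) ?_ ?_ (hqp v hv)
      · rw [h']
        exact hne v' hv'
      · rw [← hqp v' hv', ← h', hqp v hv]
    · show wt v = wt (ord (q v))
      rw [hw.par _ (ho.lt _ (hq v hv)) (hqr v hv), hqp v hv, ← hw.par v ((memB v).1 hv).1.1 (hvr v hv)]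
  -- In sums of weights, `U ≤ 2 * Ua + Y` and `4 * Ua ≤ U + Y`, so `2 * U ≤ U + 3 * Y`.
  show ∑ v ∈ U, wt v ≤ 3 * ∑ v ∈ Y, wt v
  omega

/-- The active vertices have a critical value in the range. -/
theorem SymInv.sum_active_le {ord wt st ent : ℕ → ℕ} {A B crit : ℕ → ℝ} {lo hi : ℝ} {t : ℕ}
    (h : T.SymInv ord st A B crit lo hi) (ho : T.IsOrder ord) (he : EntInv n st ent t)
    (hsat : ∀ i < n, T.Saturated ord st crit lo hi i) :
    ∑ v ∈ (Finset.range n).filter (st · = 1), wt v ≤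
      ∑ i ∈ Finset.range t, entWeight wt crit lo hi (ent i) := by
  rw [he, Finset.sum_filter]
  refine Finset.sum_le_sum fun v hv => ?_
  rw [Finset.mem_range] at hv
  by_cases h1 : st v = 1
  · rw [if_pos h1, if_neg (by omega)]
    obtain ⟨i, hi', rfl⟩ := ho.surj v hv
    rcases hsat i hi' with h2 | ⟨u, hu, hur, hup, h2⟩ | ⟨hr, j, hij, hj, hjr, hjp, h2⟩ | ⟨_, j, hj, h2⟩
    · omega
    · exact absurd (h.child _ hv (by omega) u hu hur hup) h2
    · exact absurd (h.sibling i j hij hj (by omega) hr hjr hjp) h2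
    · refine le_trans ?_ (Finset.single_le_sum (fun _ _ => Nat.zero_le _) (Finset.mem_range.2 hj))
      unfold entWeight
      rw [if_pos h2, show (4 * ord i + j) / 4 = ord i by omega]
  · rw [if_neg h1]
    exact Nat.zero_le _

end TreeNetwork

/-! ### The scan -/

namespace TreeNetwork

variable {n : ℕ} (T : TreeNetwork n)

/-- The invariant of the search: the symbolic state, the entries, the first `K` of which are sorted,
and the bound for the potential. -/
structure SearchInv (ord wt : ℕ → ℕ) (Φ : ℕ) (s : State) : Prop where
  lt : s.real 13 0 < s.real 14 0
  sym : T.SymInv ord (s.nat 6) (s.real 7) (s.real 8) (s.real 9) (s.real 13 0) (s.real 14 0)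
  ent : EntInv n (s.nat 6) (s.nat 8) (s.nat 17 0)
  le : s.nat 16 0 ≤ s.nat 17 0
  sorted : SortedOn (s.real 9) (s.nat 8) 0 (s.nat 16 0)
  pot : potential n wt (s.nat 6) (s.real 9) (s.real 13 0) (s.real 14 0) ≤ Φ

variable {T}

theorem SearchInv.congr {ord wt : ℕ → ℕ} {Φ : ℕ} {s s' : State} (h : T.SearchInv ord wt Φ s)
    (h6 : s'.nat 6 = s.nat 6) (h8 : s'.nat 8 = s.nat 8) (h16 : s'.nat 16 = s.nat 16)
    (h17 : s'.nat 17 = s.nat 17) (r7 : s'.real 7 = s.real 7) (r8 : s'.real 8 = s.real 8)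
    (r9 : s'.real 9 = s.real 9) (r13 : s'.real 13 = s.real 13) (r14 : s'.real 14 = s.real 14) :
    T.SearchInv ord wt Φ s' := by
  obtain ⟨h1, h2, h3, h4, h5, h7⟩ := h
  constructor <;> simpa only [h6, h8, h16, h17, r7, r8, r9, r13, r14]

theorem SearchInv.activate {ord wt : ℕ → ℕ} {Φ : ℕ} {s s' : State} (h : T.SearchInv ord wt Φ s)
    (ho : T.IsOrder ord) {k : ℕ} (hk : k < n) (h0 : s.nat 6 (ord k) = 0)
    (hc : ∀ u < n, u ≠ T.rootN → T.parN u = ord k → s.nat 6 u = 2)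
    (hs : ∀ j, k < j → j < n → ord k ≠ T.rootN → ord j ≠ T.rootN →
      T.parN (ord j) = T.parN (ord k) → s.nat 6 (ord j) = 2)
    (h6 : s'.nat 6 = Function.update (s.nat 6) (ord k) 1)
    (r9 : s'.real 9 = T.addCrit (s.real 7) (s.real 8) (s.real 9) (ord k))
    (h8 : ∀ i < s.nat 17 0, s'.nat 8 i = s.nat 8 i)
    (h8' : ∀ j < 4, s'.nat 8 (s.nat 17 0 + j) = 4 * ord k + j)
    (h17 : s'.nat 17 0 = s.nat 17 0 + 4) (h16 : s'.nat 16 = s.nat 16)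
    (r7 : s'.real 7 = s.real 7) (r8 : s'.real 8 = s.real 8)
    (r13 : s'.real 13 = s.real 13) (r14 : s'.real 14 = s.real 14) :
    T.SearchInv ord wt Φ s' := by
  refine ⟨by rw [r13, r14]; exact h.lt, ?_, ?_, ?_, ?_, ?_⟩
  · rw [h6, r7, r8, r9, r13, r14]
    exact h.sym.activate ho hk h0 hc hs
  · rw [h6, h17]
    exact h.ent.activate (ho.lt k hk) h0 h8 h8'
  · rw [h16, h17]
    exact h.le.trans (by omega)
  · rw [h16, r9]
    have hle := h.le
    -- The sorted entries belong to vertices of positive status, so the new critical values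
    -- overwrite none of their keys.
    have hent : ∀ i < s.nat 16 0, T.addCrit (s.real 7) (s.real 8) (s.real 9) (ord k) (s'.nat 8 i) =
        s.real 9 (s.nat 8 i) := by
      intro i hi
      have := (h.ent.exists_eq (i := i) (by omega)).1
      rw [h8 i (by omega), addCrit, if_neg]
      intro he
      rw [he] at this
      exact this h0
    intro i j hi hij hj
    rw [hent i (by omega), hent j hj]
    exact h.sorted i j hi hij hj
  · rw [h6, r9, r13, r14]
    exact (potential_activate h0).trans h.pot

theorem SearchInv.resolve {ord wt : ℕ → ℕ} {Φ : ℕ} {s s' : State} (h : T.SearchInv ord wt Φ s)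
    (ho : T.IsOrder ord) {k : ℕ} (hk : k < n) (h1 : s.nat 6 (ord k) = 1)
    (hout : ∀ j < 4, ¬ InRange (s.real 13 0) (s.real 14 0) (s.real 9 (4 * ord k + j)))
    {m : ℝ} (hm : m = (s.real 13 0 + s.real 14 0) / 2)
    (hA : Prec (s.real 7 (T.parN (ord k)) * m + s.real 8 (T.parN (ord k)))
      (s.real 7 (ord k) * m + s.real 8 (ord k) - T.lenN (ord k)) →
      s'.real 7 = s.real 7 ∧ s'.real 8 = s.real 8)
    (hA' : ¬ Prec (s.real 7 (T.parN (ord k)) * m + s.real 8 (T.parN (ord k)))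
      (s.real 7 (ord k) * m + s.real 8 (ord k) - T.lenN (ord k)) →
      s'.real 7 = Function.update (s.real 7) (T.parN (ord k)) (s.real 7 (ord k)) ∧
      s'.real 8 = Function.update (s.real 8) (T.parN (ord k)) (s.real 8 (ord k) - T.lenN (ord k)))
    (h6 : s'.nat 6 = Function.update (s.nat 6) (ord k) 2)
    (h8 : s'.nat 8 = s.nat 8) (h16 : s'.nat 16 = s.nat 16)
    (h17 : s'.nat 17 = s.nat 17) (r9 : s'.real 9 = s.real 9)
    (r13 : s'.real 13 = s.real 13) (r14 : s'.real 14 = s.real 14) :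
    T.SearchInv ord wt Φ s' := by
  have hst : ∀ v < n, Function.update (s.nat 6) (ord k) 2 v = 0 ↔ s.nat 6 v = 0 := by
    intro v _
    rw [Function.update_apply]
    split_ifs with hv
    · rw [hv, h1]
      decide
    · rfl
  refine ⟨by rw [r13, r14]; exact h.lt, ?_, ?_, ?_, ?_, ?_⟩
  · rw [h6, r9, r13, r14]
    have := h.lt
    exact h.sym.resolve ho hk (m := m) ⟨by linarith, by linarith⟩ h1 hout hA hA'
  · rw [h6, h8, h17]
    exact h.ent.congr_st hst
  · rw [h16, h17]
    exact h.le
  · rw [h16, r9, h8]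
    exact h.sorted
  · rw [h6, r9, r13, r14, potential_congr_st hst]
    exact h.pot

/-- Saturation of index `i` depends only on indices from `i` on, as children come later in the
order. Hence one backward scan suffices: the visits that follow cannot undo it. -/
theorem Saturated.congr {ord st st' : ℕ → ℕ} {crit crit' : ℕ → ℝ} {lo hi : ℝ} {i : ℕ}
    (h : T.Saturated ord st crit lo hi i) (ho : T.IsOrder ord) (hi' : i < n)
    (hst : ∀ j, i ≤ j → j < n → st' (ord j) = st (ord j))
    (hc : ∀ j < 4, crit' (4 * ord i + j) = crit (4 * ord i + j)) :
    T.Saturated ord st' crit' lo hi i := by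
  unfold Saturated
  rw [hst i le_rfl hi']
  rcases h with h | ⟨u, hu, hur, hup, h⟩ | ⟨hr, j, hij, hj, hjr, hjp, h⟩ | ⟨h, j, hj, h'⟩
  · exact Or.inl h
  · refine Or.inr (Or.inl ⟨u, hu, hur, hup, ?_⟩)
    obtain ⟨j, hj, rfl⟩ := ho.surj u hu
    obtain ⟨j', hj', hjp⟩ := ho.par j hj hur
    have := ho.inj j' (by omega) i hi' (hjp.trans hup)
    rwa [hst j (by omega) hj]
  · exact Or.inr (Or.inr (Or.inl ⟨hr, j, hij, hj, hjr, hjp, by rwa [hst j hij.le hj]⟩))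
  · exact Or.inr (Or.inr (Or.inr ⟨h, j, hj, by rwa [hc j hj]⟩))

variable (T) in
/-- The marks of the scan: a vertex to come is blocked if it has a child that has been passed but
not resolved. -/
def Blocked (ord st blk : ℕ → ℕ) (k : ℕ) : Prop :=
  ∀ i < n, blk (ord i) ≠ 0 ↔ i < k ∧ ∃ j, k ≤ j ∧ j < n ∧ ord j ≠ T.rootN ∧
    T.parN (ord j) = ord i ∧ st (ord j) ≠ 2

theorem Blocked.children {ord st blk : ℕ → ℕ} {k : ℕ} (h : T.Blocked ord st blk (k + 1))
    (ho : T.IsOrder ord) (hk : k < n) :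
    blk (ord k) = 0 ↔ ∀ u < n, u ≠ T.rootN → T.parN u = ord k → st u = 2 := by
  have h1 := h k hk
  constructor
  · intro h0 u hu hur hup
    by_contra h2
    obtain ⟨j, hj, rfl⟩ := ho.surj u hu
    obtain ⟨j', hj', hjp⟩ := ho.par j hj hur
    have := ho.inj j' (by omega) k hk (hjp.trans hup)
    exact h1.2 ⟨by omega, j, by omega, hj, hur, hup, h2⟩ h0
  · intro h2
    by_contra h0
    obtain ⟨_, j, _, hj, hjr, hjp, h3⟩ := h1.1 h0
    exact h3 (h2 _ (ho.lt j hj) hjr hjp)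

/-- Before `ord k` is handled, the mark of its parent records precisely the siblings of larger
index. -/
theorem Blocked.siblings {ord st blk : ℕ → ℕ} {k : ℕ} (h : T.Blocked ord st blk (k + 1))
    (ho : T.IsOrder ord) (hk : k < n) (hr : ord k ≠ T.rootN) :
    blk (T.parN (ord k)) = 0 ↔ ∀ j, k < j → j < n → ord j ≠ T.rootN →
      T.parN (ord j) = T.parN (ord k) → st (ord j) = 2 := by
  obtain ⟨i, hi, hip⟩ := ho.par k hk hr
  rw [← hip]
  have h1 := h i (by omega)
  constructor
  · intro h0 j hkj hj hjr hjp
    by_contra h2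
    exact h1.2 ⟨by omega, j, by omega, hj, hjr, hjp, h2⟩ h0
  · intro h2
    by_contra h0
    obtain ⟨_, j, hkj, hj, hjr, hjp, h3⟩ := h1.1 h0
    exact h3 (h2 j (by omega) hj hjr hjp)

theorem Blocked.step {ord st st' blk blk' : ℕ → ℕ} {k : ℕ} (h : T.Blocked ord st blk (k + 1))
    (ho : T.IsOrder ord) (hk : k < n) (hst : ∀ v, v ≠ ord k → st' v = st v)
    (h2 : st' (ord k) ≤ 2)
    (hblk : blk' = Function.update (if st' (ord k) < 2 then
      Function.update blk (T.parN (ord k)) 1 else blk) (ord k) 0) :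
    T.Blocked ord st' blk' k := by
  intro i hi
  have hj : ∀ j, k < j → j < n → st' (ord j) = st (ord j) := fun j hkj hj =>
    hst _ fun h' => by
      have := ho.inj j hj k hk h'
      omega
  rw [hblk]
  by_cases hik : i = k
  · subst hik
    simp
  have hne : ord i ≠ ord k := fun h' => hik (ho.inj i hi k hk h')
  rw [Function.update_of_ne hne]
  have hold := h i hi
  by_cases hpar : ord i = T.parN (ord k)
  · have hr : ord k ≠ T.rootN := by
      intro hr
      rw [hr, parN_rootN] at hpar
      exact hne (hpar.trans hr.symm)
    obtain ⟨i', hi', hip⟩ := ho.par k hk hr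
    have hii : i = i' := ho.inj i hi i' (by omega) (hpar.trans hip.symm)
    split_ifs with hlt
    · rw [hpar, Function.update_self]
      exact ⟨fun _ => ⟨by omega, k, le_rfl, hk, hr, rfl, by omega⟩, fun _ => one_ne_zero⟩
    · rw [hold]
      refine ⟨fun ⟨_, j, hkj, hjn, hjr, hjp, h3⟩ =>
        ⟨by omega, j, by omega, hjn, hjr, hjp, by rwa [hj j (by omega) hjn]⟩,
        fun ⟨_, j, hkj, hjn, hjr, hjp, h3⟩ => ⟨by omega, j, ?_, hjn, hjr, hjp, ?_⟩⟩
      · rcases Nat.eq_or_lt_of_le hkj with h' | h'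
        · subst h'
          omega
        · exact h'
      · rcases Nat.eq_or_lt_of_le hkj with h' | h'
        · subst h'
          omega
        · rwa [← hj j h' hjn]
  · have : (if st' (ord k) < 2 then Function.update blk (T.parN (ord k)) 1 else blk) (ord i) =
        blk (ord i) := by
      split_ifs
      · rw [Function.update_of_ne hpar]
      · rfl
    rw [this, hold]
    have hjk : ∀ j, k ≤ j → T.parN (ord j) = ord i → k < j := by
      intro j hkj hjp
      rcases Nat.eq_or_lt_of_le hkj with h' | h'
      · subst h'
        exact absurd hjp.symm hpar
      · exact h'
    refine ⟨fun ⟨_, j, hkj, hjn, hjr, hjp, h3⟩ =>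
      ⟨by omega, j, by omega, hjn, hjr, hjp, by rwa [hj j (by omega) hjn]⟩,
      fun ⟨_, j, hkj, hjn, hjr, hjp, h3⟩ =>
      ⟨by omega, j, hjk j hkj hjp, hjn, hjr, hjp, by rwa [← hj j (hjk j hkj hjp) hjn]⟩⟩

end TreeNetwork

/-- Load the current vertex and its parent. -/
def scanLoad : Prog :=
  setN 13 (.get 3 (nv 12)) ;; setN 14 (.get 1 (nv 13)) ;;
    setN 19 (.add (.add (nv 13) (nv 13)) (.add (nv 13) (nv 13)))

/-- Record a critical value of the current vertex. -/
def critProg (j : ℕ) (a b : RExp) : Prog :=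
  .setReal 9 (.add (nv 19) (.lit j)) (.div (.sub (.lit 0) b) a) ;;
    .setNat 8 (.add (nv 17) (.lit j)) (.add (nv 19) (.lit j))

/-- Activate the current vertex. -/
def activateProg : Prog :=
  critProg 0 (.add (.get 7 (nv 14)) (.get 7 (nv 13)))
    (.add (.get 8 (nv 14)) (.sub (.get 8 (nv 13)) (.get 1 (nv 13)))) ;;
  critProg 1 (.sub (.get 7 (nv 14)) (.get 7 (nv 13)))
    (.sub (.get 8 (nv 14)) (.sub (.get 8 (nv 13)) (.get 1 (nv 13)))) ;;
  critProg 2 (.get 7 (nv 13)) (.get 8 (nv 13)) ;;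
  critProg 3 (.get 7 (nv 13)) (.sub (.get 8 (nv 13)) (.get 1 (nv 13))) ;;
  .setNat 6 (nv 13) (.lit 1) ;; setN 17 (.add (nv 17) (.lit 4))

/-- Activate the current vertex if it is not blocked. -/
def tryActivate : Prog :=
  .ite (.natEq (.add (.get 6 (nv 13)) (.add (.get 7 (nv 13)) (.get 7 (nv 14)))) (.lit 0))
    activateProg .skip

/-- Raise the flag if a critical value lies in the range. -/
def flagOne (j : ℕ) : Prog :=
  .ite (.realLt (rv 13) (.get 9 (.add (nv 19) (.lit j))))
    (.ite (.realLt (.get 9 (.add (nv 19) (.lit j))) (rv 14)) (setN 18 (.lit 2)) .skip) .skip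

/-- Find out whether a critical value of the current vertex lies in the range. -/
def flagProg : Prog :=
  setN 18 (.lit 0) ;; flagOne 0 ;; flagOne 1 ;; flagOne 2 ;; flagOne 3

/-- Replace the line of the parent. -/
def replaceProg : Prog :=
  .setReal 7 (nv 14) (.get 7 (nv 13)) ;; .setReal 8 (nv 14) (.sub (.get 8 (nv 13)) (.get 1 (nv 13)))

/-- Compute the line of the parent. -/
def combineProg : Prog :=
  setR 15 (.div (.add (rv 13) (rv 14)) (.lit 2)) ;;
  setR 16 (.add (.mul (.get 7 (nv 14)) (rv 15)) (.get 8 (nv 14))) ;;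
  setR 17 (.sub (.add (.mul (.get 7 (nv 13)) (rv 15)) (.get 8 (nv 13))) (.get 1 (nv 13))) ;;
  .ite (.realLe (.lit 0) (.add (rv 16) (rv 17)))
    (.ite (.realLe (rv 16) (rv 17)) .skip replaceProg)
    (.ite (.realLe (rv 17) (rv 16)) .skip replaceProg)

/-- Resolve the edge above the current vertex. -/
def resolveProg : Prog := combineProg ;; .setNat 6 (nv 13) (.lit 2)

/-- Resolve the edge above the current vertex if no critical value is left. -/
def tryResolve : Prog :=
  -- The flag is `0` or `2`, so the sum is `1` only for status `1` and a lowered flag.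
  .ite (.natEq (.add (.get 6 (nv 13)) (nv 18)) (.lit 1)) resolveProg .skip

/-- Update the marks. -/
def markProg : Prog :=
  .ite (.natLt (.get 6 (nv 13)) (.lit 2)) (.setNat 7 (nv 14) (.lit 1)) .skip ;;
    -- The own mark is cleared last because the root is its own parent.
    .setNat 7 (nv 13) (.lit 0)

/-- Visit all vertices, children first, to activate and to resolve what can be. -/
def scanProg : Prog :=
  forDown 12 (.get 0 (.lit 0)) (scanLoad ;; tryActivate ;; flagProg ;; tryResolve ;; markProg)

theorem markProg_exec (s : State) :
    (markProg.exec s).nat 7 = Function.update (if s.nat 6 (s.nat 13 0) < 2 then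
      Function.update (s.nat 7) (s.nat 14 0) 1 else s.nat 7) (s.nat 13 0) 0 := by
  funext j
  simp only [markProg, Prog.exec, Test.Holds, NExp.eval]
  by_cases h : s.nat 6 (s.nat 13 0) < 2 <;> simp [h, Function.update_apply]

theorem flagProg_exec (s : State) :
    (flagProg.exec s).nat 18 0 = 0 ∧
      (∀ j < 4, ¬ InRange (s.real 13 0) (s.real 14 0) (s.real 9 (s.nat 19 0 + j))) ∨
    (flagProg.exec s).nat 18 0 = 2 ∧
      ∃ j < 4, InRange (s.real 13 0) (s.real 14 0) (s.real 9 (s.nat 19 0 + j)) := by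
  classical
  have h1 : ∀ (s : State) (j : ℕ), (flagOne j).exec s = s.putNat 18 0
      (if InRange (s.real 13 0) (s.real 14 0) (s.real 9 (s.nat 19 0 + j)) then 2
        else s.nat 18 0) := by
    intro s j
    have h0 : s.putNat 18 0 (s.nat 18 0) = s := by
      refine State.ext ?_ rfl
      funext a i
      rw [State.putNat_nat]
      split_ifs with h1 h2
      · rw [h1, h2]
      · rfl
      · rfl
    simp only [flagOne, Prog.exec, Test.Holds, NExp.eval, RExp.eval, InRange]
    by_cases h1 : s.real 13 0 < s.real 9 (s.nat 19 0 + j) <;>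
      by_cases h2 : s.real 9 (s.nat 19 0 + j) < s.real 14 0 <;> simp [h1, h2, h0]
  by_cases c : ∃ j < 4, InRange (s.real 13 0) (s.real 14 0) (s.real 9 (s.nat 19 0 + j))
  · refine Or.inr ⟨?_, c⟩
    obtain ⟨j, hj, c⟩ := c
    interval_cases j <;> simp_all [flagProg, Prog.exec, NExp.eval]
  · push Not at c
    refine Or.inl ⟨?_, c⟩
    have c0 : ¬ InRange _ _ (s.real 9 (s.nat 19 0)) := c 0 (by norm_num)
    have c1 := c 1 (by norm_num)
    have c2 := c 2 (by norm_num)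
    have c3 := c 3 (by norm_num)
    simp [flagProg, Prog.exec, h1, NExp.eval, c0, c1, c2, c3]

theorem combineProg_exec_of {s : State} {m : ℝ} (hm : m = (s.real 13 0 + s.real 14 0) / 2)
    (h : Prec (s.real 7 (s.nat 14 0) * m + s.real 8 (s.nat 14 0))
      (s.real 7 (s.nat 13 0) * m + s.real 8 (s.nat 13 0) - s.real 1 (s.nat 13 0))) :
    (combineProg.exec s).real 7 = s.real 7 ∧ (combineProg.exec s).real 8 = s.real 8 := by
  subst hm
  rcases h with ⟨h1, h2⟩ | ⟨h1, h2⟩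
  · constructor <;> funext i <;>
      simp [combineProg, Prog.exec, Test.Holds, NExp.eval, RExp.eval, h1, h2]
  · constructor <;> funext i <;>
      simp [combineProg, Prog.exec, Test.Holds, NExp.eval, RExp.eval, not_le.2 h1, h2]

theorem combineProg_exec_of_not {s : State} {m : ℝ} (hm : m = (s.real 13 0 + s.real 14 0) / 2)
    (h : ¬ Prec (s.real 7 (s.nat 14 0) * m + s.real 8 (s.nat 14 0))
      (s.real 7 (s.nat 13 0) * m + s.real 8 (s.nat 13 0) - s.real 1 (s.nat 13 0))) :
    (combineProg.exec s).real 7 =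
      Function.update (s.real 7) (s.nat 14 0) (s.real 7 (s.nat 13 0)) ∧
    (combineProg.exec s).real 8 = Function.update (s.real 8) (s.nat 14 0)
      (s.real 8 (s.nat 13 0) - s.real 1 (s.nat 13 0)) := by
  subst hm
  unfold Prec at h
  rw [not_or, not_and, not_and] at h
  by_cases h1 : 0 ≤ s.real 7 (s.nat 14 0) * ((s.real 13 0 + s.real 14 0) / 2) +
      s.real 8 (s.nat 14 0) + (s.real 7 (s.nat 13 0) * ((s.real 13 0 + s.real 14 0) / 2) +
      s.real 8 (s.nat 13 0) - s.real 1 (s.nat 13 0))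
  · have h2 := h.1 h1
    constructor <;> funext i <;>
      simp [combineProg, replaceProg, Prog.exec, Test.Holds, NExp.eval, RExp.eval, h1, h2,
        Function.update_apply]
  · have h2 := h.2 (not_le.1 h1)
    constructor <;> funext i <;>
      simp [combineProg, replaceProg, Prog.exec, Test.Holds, NExp.eval, RExp.eval, h1, h2,
        Function.update_apply]

theorem resolveProg_exec_nat (s : State) :
    (resolveProg.exec s).nat 6 = Function.update (s.nat 6) (s.nat 13 0) 2 := by
  have hf := exec_frame (P := combineProg) rfl s
  simp only [resolveProg, Prog.exec, NExp.eval]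
  rw [putNat_nat_self, hf.1 6 rfl, hf.1 13 rfl]

theorem activateProg_exec (s : State) :
    (activateProg.exec s).nat 6 = Function.update (s.nat 6) (s.nat 13 0) 1 ∧
    (activateProg.exec s).nat 17 0 = s.nat 17 0 + 4 ∧
    (∀ i < s.nat 17 0, (activateProg.exec s).nat 8 i = s.nat 8 i) ∧
    ∀ j < 4, (activateProg.exec s).nat 8 (s.nat 17 0 + j) = s.nat 19 0 + j := by
  refine ⟨?_, ?_, fun i hi => ?_, fun j hj => ?_⟩
  · funext i
    simp [activateProg, critProg, Prog.exec, NExp.eval, Function.update_apply]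
  · simp [activateProg, critProg, Prog.exec, NExp.eval]
  · simp [activateProg, critProg, Prog.exec, NExp.eval, hi.ne, show i ≠ s.nat 17 0 + 1 by omega,
      show i ≠ s.nat 17 0 + 2 by omega, show i ≠ s.nat 17 0 + 3 by omega]
  · interval_cases j <;> simp [activateProg, critProg, Prog.exec, NExp.eval]

namespace TreeNetwork

variable {n : ℕ} {T : TreeNetwork n}

theorem activateProg_exec_crit {s : State} (h14 : s.nat 14 0 = T.parN (s.nat 13 0))
    (h19 : s.nat 19 0 = 4 * s.nat 13 0) (hl : s.real 1 = T.lenN) :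
    (activateProg.exec s).real 9 = T.addCrit (s.real 7) (s.real 8) (s.real 9) (s.nat 13 0) := by
  have e : (activateProg.exec s).real 9 = Function.update (Function.update (Function.update
      (Function.update (s.real 9) (4 * s.nat 13 0) (T.critVal (s.real 7) (s.real 8) (s.nat 13 0) 0))
      (4 * s.nat 13 0 + 1) (T.critVal (s.real 7) (s.real 8) (s.nat 13 0) 1))
      (4 * s.nat 13 0 + 2) (T.critVal (s.real 7) (s.real 8) (s.nat 13 0) 2))
      (4 * s.nat 13 0 + 3) (T.critVal (s.real 7) (s.real 8) (s.nat 13 0) 3) := by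
    funext i
    simp [activateProg, critProg, Prog.exec, NExp.eval, RExp.eval, Function.update_apply, h19, h14,
      hl, critVal, lineRoot]
  rw [e]
  funext i
  unfold addCrit
  split_ifs with hi
  · have : i = 4 * s.nat 13 0 + i % 4 := by omega
    have h4 : i % 4 < 4 := Nat.mod_lt _ (by norm_num)
    generalize i % 4 = j at *
    subst this
    interval_cases j <;> simp
  · rw [Function.update_of_ne (by omega), Function.update_of_ne (by omega),
      Function.update_of_ne (by omega), Function.update_of_ne (by omega)]

end TreeNetwork

/-! ### Correctness of the scan -/

namespace TreeNetwork

variable {n : ℕ} {T : TreeNetwork n}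

theorem tryActivate_spec {ord wt : ℕ → ℕ} (ho : T.IsOrder ord) {Φ k : ℕ} (hk : k < n) {s : State}
    (h13 : s.nat 13 0 = ord k) (h14 : s.nat 14 0 = T.parN (ord k)) (h19 : s.nat 19 0 = 4 * ord k)
    (hl : s.real 1 = T.lenN) (h : T.SearchInv ord wt Φ s)
    (hb : T.Blocked ord (s.nat 6) (s.nat 7) (k + 1)) :
    T.SearchInv ord wt Φ (tryActivate.exec s) ∧
      (∀ v, v ≠ ord k → (tryActivate.exec s).nat 6 v = s.nat 6 v) ∧
      (∀ v, v ≠ ord k → ∀ j < 4,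
        (tryActivate.exec s).real 9 (4 * v + j) = s.real 9 (4 * v + j)) ∧
      ((tryActivate.exec s).nat 6 (ord k) = 0 →
        s.nat 7 (ord k) ≠ 0 ∨ s.nat 7 (T.parN (ord k)) ≠ 0) := by
  have hex : tryActivate.exec s = if s.nat 6 (ord k) + (s.nat 7 (ord k) +
      s.nat 7 (T.parN (ord k))) = 0 then activateProg.exec s else s := by
    simp only [tryActivate, Prog.exec, Test.Holds, NExp.eval, h13, h14]
  by_cases hc : s.nat 6 (ord k) + (s.nat 7 (ord k) + s.nat 7 (T.parN (ord k))) = 0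
  · rw [if_pos hc] at hex
    rw [hex]
    have hf := exec_frame (P := activateProg) rfl s
    obtain ⟨e6, e17, e8, e8'⟩ := activateProg_exec s
    have e9 := activateProg_exec_crit (T := T) (s := s) (by rw [h14, h13]) (by rw [h19, h13]) hl
    rw [h13] at e6 e9
    rw [h19] at e8'
    refine ⟨h.activate ho hk (by omega) ((hb.children ho hk).1 (by omega)) ?_ e6 e9 e8 e8' e17
      (hf.1 16 rfl) (hf.2 7 rfl) (hf.2 8 rfl) (hf.2 13 rfl) (hf.2 14 rfl), fun v hv => ?_,
      fun v hv j hj => ?_, fun h0 => ?_⟩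
    · intro j hkj hj hr hjr hjp
      exact (hb.siblings ho hk hr).1 (by omega) j hkj hj hjr hjp
    · rw [e6, Function.update_of_ne hv]
    · rw [e9, addCrit_of_ne hv hj]
    · rw [e6, Function.update_self] at h0
      omega
  · rw [if_neg hc] at hex
    rw [hex]
    exact ⟨h, fun _ _ => rfl, fun _ _ _ _ => rfl, fun h0 => by omega⟩

theorem tryResolve_spec {ord wt : ℕ → ℕ} (ho : T.IsOrder ord) {Φ k : ℕ} (hk : k < n) {s : State}
    (h13 : s.nat 13 0 = ord k) (h14 : s.nat 14 0 = T.parN (ord k))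
    (hl : s.real 1 = T.lenN) (h : T.SearchInv ord wt Φ s)
    (hflag : s.nat 18 0 = 0 ∧
        (∀ j < 4, ¬ InRange (s.real 13 0) (s.real 14 0) (s.real 9 (4 * ord k + j))) ∨
      s.nat 18 0 = 2 ∧ ∃ j < 4, InRange (s.real 13 0) (s.real 14 0) (s.real 9 (4 * ord k + j))) :
    T.SearchInv ord wt Φ (tryResolve.exec s) ∧
      (∀ v, v ≠ ord k → (tryResolve.exec s).nat 6 v = s.nat 6 v) ∧
      ((tryResolve.exec s).nat 6 (ord k) = 0 → s.nat 6 (ord k) = 0) ∧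
      ((tryResolve.exec s).nat 6 (ord k) = 1 →
        ∃ j < 4, InRange (s.real 13 0) (s.real 14 0) (s.real 9 (4 * ord k + j))) := by
  have hex : tryResolve.exec s = if s.nat 6 (ord k) + s.nat 18 0 = 1 then resolveProg.exec s
      else s := by
    simp only [tryResolve, Prog.exec, Test.Holds, NExp.eval, h13]
  by_cases hc : s.nat 6 (ord k) + s.nat 18 0 = 1
  · rw [if_pos hc] at hex
    rw [hex]
    have hf := exec_frame (P := resolveProg) rfl s
    have e6 := resolveProg_exec_nat s
    rw [h13] at e6
    have hout := hflag.resolve_right fun h' => by omega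
    have e7 : (resolveProg.exec s).real = (combineProg.exec s).real := rfl
    refine ⟨h.resolve ho hk (by omega) hout.2 rfl (fun hp => ?_) (fun hp => ?_) e6 (hf.1 8 rfl)
      (hf.1 16 rfl) (hf.1 17 rfl) (hf.2 9 rfl) (hf.2 13 rfl) (hf.2 14 rfl), fun v hv => ?_,
      fun h0 => ?_, fun h0 => ?_⟩
    · rw [e7]
      refine combineProg_exec_of rfl ?_
      rw [h13, h14, hl]
      exact hp
    · rw [e7]
      have := combineProg_exec_of_not (s := s) rfl (by
        rw [h13, h14, hl]
        exact hp)
      rwa [h13, h14, hl] at this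
    · rw [e6, Function.update_of_ne hv]
    · rw [e6, Function.update_self] at h0
      omega
    · rw [e6, Function.update_self] at h0
      omega
  · rw [if_neg hc] at hex
    rw [hex]
    refine ⟨h, fun _ _ => rfl, id, fun h1 => ?_⟩
    rcases hflag with ⟨h2, _⟩ | ⟨_, h2⟩
    · omega
    · exact h2

variable (T) in
/-- The invariant of the scan. -/
structure ScanInv (ord wt : ℕ → ℕ) (Φ k : ℕ) (s : State) : Prop where
  search : T.SearchInv ord wt Φ s
  blocked : T.Blocked ord (s.nat 6) (s.nat 7) k
  sat : ∀ i, k ≤ i → i < n → T.Saturated ord (s.nat 6) (s.real 9) (s.real 13 0) (s.real 14 0) i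

theorem ScanInv.step {ord wt : ℕ → ℕ} (ho : T.IsOrder ord) {Φ k : ℕ} (hk : k < n) {s : State}
    (h12 : s.nat 12 0 = k) (h3 : s.nat 3 = ord) (h1 : s.nat 1 = T.parN) (hl : s.real 1 = T.lenN)
    (h : T.ScanInv ord wt Φ (k + 1) s) :
    Ends (scanLoad ;; tryActivate ;; flagProg ;; tryResolve ;; markProg) s 500
      (T.ScanInv ord wt Φ k) := by
  refine ends_of_exec rfl (by decide) ?_
  simp only [Prog.exec]
  have eL : (scanLoad.exec s).nat 13 0 = ord k ∧ (scanLoad.exec s).nat 14 0 = T.parN (ord k) ∧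
      (scanLoad.exec s).nat 19 0 = 4 * ord k := by
    refine ⟨?_, ?_, ?_⟩ <;> simp [scanLoad, Prog.exec, NExp.eval, h12, h3, h1]
    omega
  have f1 := exec_frame (P := scanLoad) rfl s
  set s1 := scanLoad.exec s
  obtain ⟨e13, e14, e19⟩ := eL
  have i1 : T.SearchInv ord wt Φ s1 := h.search.congr (f1.1 6 rfl) (f1.1 8 rfl) (f1.1 16 rfl)
    (f1.1 17 rfl) (f1.2 7 rfl) (f1.2 8 rfl) (f1.2 9 rfl) (f1.2 13 rfl) (f1.2 14 rfl)
  have b1 : T.Blocked ord (s1.nat 6) (s1.nat 7) (k + 1) := by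
    rw [f1.1 6 rfl, f1.1 7 rfl]
    exact h.blocked
  have l1 : s1.real 1 = T.lenN := (f1.2 1 rfl).trans hl
  obtain ⟨i2, st2, cr2, z2⟩ := tryActivate_spec ho hk e13 e14 e19 l1 i1 b1
  have f2 := exec_frame (P := tryActivate) rfl s1
  set s2 := tryActivate.exec s1
  have g3 := flagProg_exec s2
  have f3 := exec_frame (P := flagProg) rfl s2
  set s3 := flagProg.exec s2
  have i3 : T.SearchInv ord wt Φ s3 := i2.congr (f3.1 6 rfl) (f3.1 8 rfl) (f3.1 16 rfl)
    (f3.1 17 rfl) (f3.2 7 rfl) (f3.2 8 rfl) (f3.2 9 rfl) (f3.2 13 rfl) (f3.2 14 rfl)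
  rw [← f3.2 13 rfl, ← f3.2 14 rfl, ← f3.2 9 rfl, show s2.nat 19 0 = 4 * ord k by
    rw [f2.1 19 rfl, e19]] at g3
  obtain ⟨i4, st4, z4, o4⟩ := tryResolve_spec ho hk (s := s3)
    (by rw [f3.1 13 rfl, f2.1 13 rfl, e13]) (by rw [f3.1 14 rfl, f2.1 14 rfl, e14])
    (by rw [f3.2 1 rfl, f2.2 1 rfl, l1]) i3 g3
  have f4 := exec_frame (P := tryResolve) rfl s3
  set s4 := tryResolve.exec s3
  have m5 := markProg_exec s4
  have f5 := exec_frame (P := markProg) rfl s4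
  set s5 := markProg.exec s4
  have hst : ∀ v, v ≠ ord k → s5.nat 6 v = s.nat 6 v := by
    intro v hv
    rw [f5.1 6 rfl, st4 v hv, f3.1 6 rfl, st2 v hv, f1.1 6 rfl]
  have hcr : ∀ v, v ≠ ord k → ∀ j < 4, s5.real 9 (4 * v + j) = s.real 9 (4 * v + j) := by
    intro v hv j hj
    rw [f5.2 9 rfl, f4.2 9 rfl, f3.2 9 rfl, cr2 v hv j hj, f1.2 9 rfl]
  have r13 : s5.real 13 = s.real 13 := by
    rw [f5.2 13 rfl, f4.2 13 rfl, f3.2 13 rfl, f2.2 13 rfl, f1.2 13 rfl]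
  have r14 : s5.real 14 = s.real 14 := by
    rw [f5.2 14 rfl, f4.2 14 rfl, f3.2 14 rfl, f2.2 14 rfl, f1.2 14 rfl]
  have i5 : T.SearchInv ord wt Φ s5 := i4.congr (f5.1 6 rfl) (f5.1 8 rfl) (f5.1 16 rfl)
    (f5.1 17 rfl) (f5.2 7 rfl) (f5.2 8 rfl) (f5.2 9 rfl) (f5.2 13 rfl) (f5.2 14 rfl)
  have hle := i5.sym.st_le _ (ho.lt k hk)
  have hjk : ∀ j, k < j → j < n → ord j ≠ ord k := fun j hkj hj h' => by
    have := ho.inj j hj k hk h'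
    omega
  refine ⟨i5, h.blocked.step ho hk hst hle ?_, fun i hki hi => ?_⟩
  · rw [m5, f5.1 6 rfl, show s4.nat 13 0 = ord k by rw [f4.1 13 rfl, f3.1 13 rfl, f2.1 13 rfl, e13],
      show s4.nat 14 0 = T.parN (ord k) by rw [f4.1 14 rfl, f3.1 14 rfl, f2.1 14 rfl, e14],
      f4.1 7 rfl, f3.1 7 rfl, f2.1 7 rfl, f1.1 7 rfl]
  · rcases Nat.eq_or_lt_of_le hki with h' | h'
    · subst h'
      unfold Saturated
      have hcases : s5.nat 6 (ord k) = 2 ∨ s5.nat 6 (ord k) = 1 ∨ s5.nat 6 (ord k) = 0 := by omega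
      rcases hcases with h2 | h2 | h2
      · exact Or.inl h2
      · refine Or.inr (Or.inr (Or.inr ⟨h2, ?_⟩))
        rw [f5.1 6 rfl] at h2
        rw [f5.2 9 rfl, f4.2 9 rfl, f5.2 13 rfl, f4.2 13 rfl, f5.2 14 rfl, f4.2 14 rfl]
        exact o4 h2
      -- Activation was refused because of a mark: the own mark reveals an unresolved child, the
      -- mark of the parent an unresolved later sibling.
      · rw [f5.1 6 rfl] at h2
        have h3 := z4 h2
        rw [f3.1 6 rfl] at h3
        have h4 := z2 h3
        rw [f1.1 7 rfl] at h4
        by_cases hc : s.nat 7 (ord k) = 0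
        · have h5 := h4.resolve_left fun h' => h' hc
          -- At the root both marks are the same cell.
          have hr : ord k ≠ T.rootN := by
            intro hr
            rw [hr, parN_rootN, ← hr] at h5
            exact h5 hc
          have h6 := mt (h.blocked.siblings ho hk hr).2 h5
          push Not at h6
          obtain ⟨j, hkj, hj, hjr, hjp, h7⟩ := h6
          exact Or.inr (Or.inr (Or.inl ⟨hr, j, hkj, hj, hjr, hjp,
            by rwa [hst _ (hjk j hkj hj)]⟩))
        · have h6 := mt (h.blocked.children ho hk).2 hc
          push Not at h6
          obtain ⟨u, hu, hur, hup, h7⟩ := h6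
          refine Or.inr (Or.inl ⟨u, hu, hur, hup, ?_⟩)
          rwa [hst u]
          rintro rfl
          exact T.parN_ne hu hur hup
    · rw [r13, r14]
      exact (h.sat i h' hi).congr ho hi (fun j hj hjn => hst _ (hjk j (by omega) hjn))
        (fun j hj => hcr _ (hjk i h' hi) j hj)

/-- The scan makes all vertices saturated. -/
theorem scanProg_spec {ord wt : ℕ → ℕ} (ho : T.IsOrder ord) {p Φ : ℕ} {s : State}
    (hin : T.HasInput p s) (h3 : s.nat 3 = ord) (h : T.SearchInv ord wt Φ s)
    (hb : ∀ v < n, s.nat 7 v = 0) :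
    Ends scanProg s (510 * n + 10) (fun s' => T.SearchInv ord wt Φ s' ∧ (∀ v < n, s'.nat 7 v = 0) ∧
      ∀ i < n, T.Saturated ord (s'.nat 6) (s'.real 9) (s'.real 13 0) (s'.real 14 0) i) := by
  refine (ends_forDown (N := n) (c := 500) (T.ScanInv ord wt Φ) rfl ?_ ?_ ?_).mono ?_ ?_
  · simp only [NExp.eval]
    exact hin.n_eq
  · intro k hk s' hf hks hinv
    have hne : ∀ a, a ≠ 12 → (s'.putNat 12 0 k).nat a = s'.nat a := fun a ha =>
      s'.putNat_nat_of_ne _ _ ha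
    refine ScanInv.step ho hk (by simp) ?_ ?_ ?_ ?_
    · rw [hne 3 (by decide), hf.1 3 rfl, h3]
    · rw [hne 1 (by decide), hf.1 1 rfl, hin.par_eq]
    · rw [State.putNat_real, hf.2 1 rfl, hin.len_eq]
    · refine ⟨hinv.search.congr (hne 6 (by decide)) (hne 8 (by decide)) (hne 16 (by decide))
        (hne 17 (by decide)) rfl rfl rfl rfl rfl, ?_, ?_⟩
      · rw [hne 6 (by decide), hne 7 (by decide)]
        exact hinv.blocked
      · rw [hne 6 (by decide)]
        exact hinv.sat
  · have hne : ∀ a, a ≠ 12 → (s.putNat 12 0 n).nat a = s.nat a := fun a ha =>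
      s.putNat_nat_of_ne _ _ ha
    refine ⟨h.congr (hne 6 (by decide)) (hne 8 (by decide)) (hne 16 (by decide))
        (hne 17 (by decide)) rfl rfl rfl rfl rfl, fun i hi => ?_, fun i hi hi' => by omega⟩
    rw [hne 7 (by decide)]
    exact ⟨fun h' => absurd (hb _ (ho.lt i hi)) h', fun ⟨_, j, hj, hj', _⟩ => by omega⟩
  · simp only [NExp.cost]
    omega
  · intro s' _ hs'
    refine ⟨hs'.search, fun v hv => ?_, fun i hi => hs'.sat i (Nat.zero_le i) hi⟩
    obtain ⟨i, hi, rfl⟩ := ho.surj v hv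
    by_contra h0
    have := ((hs'.blocked i hi).1 h0).1
    omega

end TreeNetwork

/-! ### The weighted median and the search -/

/-- Execute the program if the current entry lies in the range. -/
def ifInRange (P : Prog) : Prog :=
  .ite (.realLt (rv 13) (.get 9 (.get 8 (nv 31))))
    (.ite (.realLt (.get 9 (.get 8 (nv 31))) (rv 14)) P .skip) .skip

/-- Add the weight of the current entry to a register. -/
def addWeight (a : ℕ) : Prog := setN a (.add (nv a) (.get 5 (.half (.half (.get 8 (nv 31))))))

/-- Compute the total weight of the entries in the range. -/
def totalProg : Prog :=
  setN 30 (.lit 0) ;; forUp 31 (nv 17) (ifInRange (addWeight 30))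

/-- Find the weighted median of the entries in the range. -/
def medianProg : Prog :=
  totalProg ;; setN 32 (.lit 0) ;;
  forUp 31 (nv 17)
    (ifInRange (.ite (.natLt (.add (nv 32) (nv 32)) (nv 30)) (setR 12 (.get 9 (.get 8 (nv 31)))) .skip
      ;; addWeight 32))

/-- One round of the search: sort the new entries, test the median, shrink the range and scan. -/
def roundProg : Prog :=
  insertProg ;; medianProg ;; testProg ;;
  .ite (.natLt (.get 0 (.lit 1)) (nv 15)) (setR 13 (rv 12)) (setR 14 (rv 12)) ;; scanProg

/-- The rounds of the search. -/
def searchProg : Prog := .loop (.natLt (.get 6 (.get 0 (.lit 2))) (.lit 2)) roundProg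

theorem ifInRange_exec (P : Prog) (s : State) :
    (ifInRange P).exec s = open Classical in
      if InRange (s.real 13 0) (s.real 14 0) (s.real 9 (s.nat 8 (s.nat 31 0))) then P.exec s
      else s := by
  simp only [ifInRange, Prog.exec, Test.Holds, NExp.eval, RExp.eval, InRange]
  by_cases h1 : s.real 13 0 < s.real 9 (s.nat 8 (s.nat 31 0)) <;>
    by_cases h2 : s.real 9 (s.nat 8 (s.nat 31 0)) < s.real 14 0 <;> simp [h1, h2]

/-! ### Correctness and cost of the search -/

namespace TreeNetwork

variable {n : ℕ} {T : TreeNetwork n}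

theorem totalProg_spec {s : State} {t : ℕ} (h17 : s.nat 17 0 = t) :
    Ends totalProg s (50 * t + 15) (fun s' => s'.nat 30 0 = ∑ i ∈ Finset.range t,
      entWeight (s.nat 5) (s.real 9) (s.real 13 0) (s.real 14 0) (s.nat 8 i)) := by
  classical
  have key : Ends totalProg s (3 + (t * (30 + 2 + 9) + 2 + 6)) (fun s' => s'.nat 30 0 =
      ∑ i ∈ Finset.range t,
        entWeight (s.nat 5) (s.real 9) (s.real 13 0) (s.real 14 0) (s.nat 8 i)) := by
    refine Ends.seq (ends_exec (P := setN 30 (.lit 0)) rfl s) fun s₁ hf₁ h₁ => ?_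
    refine (ends_forUp (c := 30) (N := t) (fun k s' => s'.nat 30 0 = ∑ i ∈ Finset.range k,
      entWeight (s.nat 5) (s.real 9) (s.real 13 0) (s.real 14 0) (s.nat 8 i)) rfl
      (fun s' hf => ?_) (fun k hk s' hf hi hinv => ?_) ?_).mono le_rfl fun s' _ h => h.2
    · simp only [NExp.eval]
      rw [hf.1 17 rfl, hf₁.1 17 rfl, h17]
    · refine ends_of_exec rfl (by decide) ?_
      have e8 : s'.nat 8 = s.nat 8 := (hf.1 8 rfl).trans (hf₁.1 8 rfl)
      have e5 : s'.nat 5 = s.nat 5 := (hf.1 5 rfl).trans (hf₁.1 5 rfl)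
      have e9 : s'.real 9 = s.real 9 := (hf.2 9 rfl).trans (hf₁.2 9 rfl)
      have e13 : s'.real 13 = s.real 13 := (hf.2 13 rfl).trans (hf₁.2 13 rfl)
      have e14 : s'.real 14 = s.real 14 := (hf.2 14 rfl).trans (hf₁.2 14 rfl)
      rw [ifInRange_exec, e8, e9, e13, e14, hi, Finset.sum_range_succ]
      unfold entWeight at hinv ⊢
      split_ifs with hr
      · simp [addWeight, Prog.exec, NExp.eval, hinv, e8, e5, hi, Nat.div_div_eq_div_mul]
      · simpa using hinv
    · rw [h₁]
      simp [Prog.exec, NExp.eval]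
  exact key.mono (by omega) fun _ _ h => h

theorem medianProg_spec {s : State} {t : ℕ} (h17 : s.nat 17 0 = t) {W : ℕ → ℕ}
    (hW : W = fun k => ∑ i ∈ Finset.range k,
      entWeight (s.nat 5) (s.real 9) (s.real 13 0) (s.real 14 0) (s.nat 8 i)) (hpos : 0 < W t) :
    Ends medianProg s (150 * t + 50) (fun s' => ∃ i < t,
      InRange (s.real 13 0) (s.real 14 0) (s.real 9 (s.nat 8 i)) ∧
      s'.real 12 0 = s.real 9 (s.nat 8 i) ∧ 2 * W i < W t ∧ W t ≤ 2 * W (i + 1)) := by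
  classical
  have key : Ends medianProg s ((50 * t + 15) + (3 + (t * (60 + 2 + 9) + 2 + 6))) (fun s' => ∃ i < t,
      InRange (s.real 13 0) (s.real 14 0) (s.real 9 (s.nat 8 i)) ∧
      s'.real 12 0 = s.real 9 (s.nat 8 i) ∧ 2 * W i < W t ∧ W t ≤ 2 * W (i + 1)) := by
    refine Ends.seq (totalProg_spec h17) fun s₁ hf₁ h₁ => ?_
    refine Ends.seq (ends_exec (P := setN 32 (.lit 0)) rfl s₁) fun s₂ hf₂ h₂ => ?_
    have hW' : W t = s₂.nat 30 0 := by rw [hf₂.1 30 rfl, h₁, hW]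
    have hWs : ∀ k, W (k + 1) = W k +
        if InRange (s.real 13 0) (s.real 14 0) (s.real 9 (s.nat 8 k)) then s.nat 5 (s.nat 8 k / 4)
        else 0 := by
      intro k
      rw [hW]
      exact Finset.sum_range_succ _ _
    -- The candidate `i` is the last entry in the range at which the weight before it was less than
    -- half. Either its own weight reaches half, or no weight has been added since; at the end, the
    -- second case implies the first.
    refine (ends_forUp (c := 60) (N := t) (fun k s' => s'.nat 32 0 = W k ∧ (W k = 0 ∨ ∃ i < k,
      InRange (s.real 13 0) (s.real 14 0) (s.real 9 (s.nat 8 i)) ∧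
      s'.real 12 0 = s.real 9 (s.nat 8 i) ∧ 2 * W i < W t ∧
      (W t ≤ 2 * W (i + 1) ∨ W (i + 1) = W k))) rfl
      (fun s' hf => ?_) (fun k hk s' hf hi hinv => ?_) ?_).mono le_rfl fun s' _ h => ?_
    · simp only [NExp.eval]
      rw [hf.1 17 rfl, hf₂.1 17 rfl, hf₁.1 17 rfl, h17]
    · refine ends_of_exec rfl (by decide) ?_
      have e8 : s'.nat 8 = s.nat 8 := (hf.1 8 rfl).trans ((hf₂.1 8 rfl).trans (hf₁.1 8 rfl))
      have e5 : s'.nat 5 = s.nat 5 := (hf.1 5 rfl).trans ((hf₂.1 5 rfl).trans (hf₁.1 5 rfl))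
      have e9 : s'.real 9 = s.real 9 := (hf.2 9 rfl).trans ((hf₂.2 9 rfl).trans (hf₁.2 9 rfl))
      have e13 : s'.real 13 = s.real 13 := (hf.2 13 rfl).trans ((hf₂.2 13 rfl).trans (hf₁.2 13 rfl))
      have e14 : s'.real 14 = s.real 14 := (hf.2 14 rfl).trans ((hf₂.2 14 rfl).trans (hf₁.2 14 rfl))
      have e30 : s'.nat 30 0 = W t := by rw [hf.1 30 rfl, hW']
      have hs := hWs k
      obtain ⟨h32, hrest⟩ := hinv
      rw [ifInRange_exec, e8, e9, e13, e14, hi]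
      split_ifs with hr
      · rw [if_pos hr] at hs
        by_cases hlt : W k + W k < W t
        · refine ⟨?_, Or.inr ⟨k, by omega, hr, ?_, by omega, Or.inr rfl⟩⟩
          · simp [addWeight, Prog.exec, Test.Holds, NExp.eval, h32, e30, hlt, e8, e5, hi, hs,
              Nat.div_div_eq_div_mul]
          · simp [addWeight, Prog.exec, Test.Holds, NExp.eval, RExp.eval, h32, e30, hlt, e8, e9, hi]
        · refine ⟨?_, Or.inr ?_⟩
          · simp [addWeight, Prog.exec, Test.Holds, NExp.eval, h32, e30, hlt, e8, e5, hi, hs,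
              Nat.div_div_eq_div_mul]
          · obtain ⟨i, hik, hir, h12, hi1, hi2⟩ := hrest.resolve_left fun h' => by omega
            refine ⟨i, by omega, hir, ?_, hi1, Or.inl (by omega)⟩
            simpa [addWeight, Prog.exec, Test.Holds, NExp.eval, h32, e30, hlt] using h12
      · rw [if_neg hr, add_zero] at hs
        refine ⟨by simpa [hs] using h32, ?_⟩
        rw [hs]
        refine hrest.imp id ?_
        rintro ⟨i, hik, hrest⟩
        exact ⟨i, by omega, by simpa using hrest⟩
    · have h0 : W 0 = 0 := by
        rw [hW]
        rfl
      rw [h0]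
      refine ⟨?_, Or.inl rfl⟩
      rw [h₂]
      simp [Prog.exec, NExp.eval]
    · obtain ⟨i, hit, hir, h12, hi1, hi2⟩ := h.2.2.resolve_left hpos.ne'
      exact ⟨i, hit, hir, h12, hi1, by omega⟩
  exact key.mono (by omega) fun _ _ h => h

/-- The entries below the median have at most half of the weight. -/
theorem sum_entWeight_below {wt ent : ℕ → ℕ} {crit : ℕ → ℝ} {lo hi : ℝ} {t i : ℕ}
    (hs : SortedOn crit ent 0 t) (hit : i < t) (h : crit (ent i) ≤ hi)
    (h1 : 2 * ∑ x ∈ Finset.range i, entWeight wt crit lo hi (ent x) <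
      ∑ x ∈ Finset.range t, entWeight wt crit lo hi (ent x)) :
    2 * ∑ x ∈ Finset.range t, entWeight wt crit lo (crit (ent i)) (ent x) ≤
      ∑ x ∈ Finset.range t, entWeight wt crit lo hi (ent x) := by
  have h2 : ∑ x ∈ Finset.range t, entWeight wt crit lo (crit (ent i)) (ent x) ≤
      ∑ x ∈ Finset.range i, entWeight wt crit lo hi (ent x) := by
    rw [← Finset.sum_range_add_sum_Ico _ hit.le, Finset.sum_eq_zero (s := Finset.Ico i t), add_zero]
    · refine Finset.sum_le_sum fun x _ => ?_
      unfold entWeight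
      by_cases hx : InRange lo (crit (ent i)) (crit (ent x))
      · rw [if_pos hx, if_pos (hx.mono le_rfl h)]
      · rw [if_neg hx]
        exact Nat.zero_le _
    · intro x hx
      rw [Finset.mem_Ico] at hx
      exact if_neg fun hr => absurd hr.2 (not_lt.2 (hs i x (Nat.zero_le _) hx.1 hx.2))
  omega

/-- The entries above the median have at most half of the weight. -/
theorem sum_entWeight_above {wt ent : ℕ → ℕ} {crit : ℕ → ℝ} {lo hi : ℝ} {t i : ℕ}
    (hs : SortedOn crit ent 0 t) (hit : i < t) (h : lo ≤ crit (ent i))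
    (h1 : ∑ x ∈ Finset.range t, entWeight wt crit lo hi (ent x) ≤
      2 * ∑ x ∈ Finset.range (i + 1), entWeight wt crit lo hi (ent x)) :
    2 * ∑ x ∈ Finset.range t, entWeight wt crit (crit (ent i)) hi (ent x) ≤
      ∑ x ∈ Finset.range t, entWeight wt crit lo hi (ent x) := by
  have h2 : ∑ x ∈ Finset.range t, entWeight wt crit (crit (ent i)) hi (ent x) ≤
      ∑ x ∈ Finset.Ico (i + 1) t, entWeight wt crit lo hi (ent x) := by
    rw [← Finset.sum_range_add_sum_Ico _ (show i + 1 ≤ t from hit),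
      Finset.sum_eq_zero (s := Finset.range (i + 1)), zero_add]
    · refine Finset.sum_le_sum fun x _ => ?_
      unfold entWeight
      by_cases hx : InRange (crit (ent i)) hi (crit (ent x))
      · rw [if_pos hx, if_pos (hx.mono h le_rfl)]
      · rw [if_neg hx]
        exact Nat.zero_le _
    · intro x hx
      rw [Finset.mem_range] at hx
      exact if_neg fun hr => absurd hr.1 (not_lt.2 (hs x i (Nat.zero_le _) (by omega) hit))
  have h3 := Finset.sum_range_add_sum_Ico (fun x => entWeight wt crit lo hi (ent x))
    (show i + 1 ≤ t from hit)
  omega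

variable (T) in
/-- The state between the rounds of the search. -/
structure SearchState (ord wt : ℕ → ℕ) (p Φ : ℕ) (s : State) : Prop where
  input : T.HasInput p s
  reach : T.HasReach s
  valid : T.ValidOut s
  ord_eq : s.nat 3 = ord
  wt_eq : s.nat 5 = wt
  search : T.SearchInv ord wt Φ s
  blk : ∀ v < n, s.nat 7 v = 0
  sat : ∀ i < n, T.Saturated ord (s.nat 6) (s.real 9) (s.real 13 0) (s.real 14 0) i
  nonneg : 0 ≤ s.real 13 0
  infeasible : ¬ T.Feasible p (s.real 13 0)
  feasible : T.Feasible p (s.real 14 0)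

theorem SearchInv.insert {ord wt : ℕ → ℕ} {Φ : ℕ} {s s' : State} (h : T.SearchInv ord wt Φ s)
    (h16 : s'.nat 16 0 = s.nat 17 0) (hs : SortedOn (s.real 9) (s'.nat 8) 0 (s.nat 17 0))
    (hsum : ∀ f : ℕ → ℕ, ∑ x ∈ Finset.range (s.nat 17 0), f (s'.nat 8 x) =
      ∑ x ∈ Finset.range (s.nat 17 0), f (s.nat 8 x))
    (h6 : s'.nat 6 = s.nat 6) (h17 : s'.nat 17 = s.nat 17) (r7 : s'.real 7 = s.real 7)
    (r8 : s'.real 8 = s.real 8) (r9 : s'.real 9 = s.real 9) (r13 : s'.real 13 = s.real 13)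
    (r14 : s'.real 14 = s.real 14) : T.SearchInv ord wt Φ s' := by
  refine ⟨by rw [r13, r14]; exact h.lt, by rw [h6, r7, r8, r9, r13, r14]; exact h.sym,
    fun f => ?_, by rw [h16, h17], by rw [r9, h16]; exact hs,
    by rw [h6, r9, r13, r14]; exact h.pot⟩
  rw [h17, hsum f, h.ent f, h6]

theorem SearchInv.shrink {ord wt : ℕ → ℕ} {Φ Φ' : ℕ} {s s' : State} (h : T.SearchInv ord wt Φ s)
    (h6 : s'.nat 6 = s.nat 6) (h8 : s'.nat 8 = s.nat 8) (h16 : s'.nat 16 = s.nat 16)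
    (h17 : s'.nat 17 = s.nat 17) (r7 : s'.real 7 = s.real 7) (r8 : s'.real 8 = s.real 8)
    (r9 : s'.real 9 = s.real 9) (r13 : s.real 13 0 ≤ s'.real 13 0)
    (r14 : s'.real 14 0 ≤ s.real 14 0) (hlt : s'.real 13 0 < s'.real 14 0)
    (hpot : potential n wt (s.nat 6) (s.real 9) (s'.real 13 0) (s'.real 14 0) ≤ Φ') :
    T.SearchInv ord wt Φ' s' := by
  refine ⟨hlt, by rw [h6, r7, r8, r9]; exact h.sym.shrink r13 r14, by rw [h6, h8, h17]; exact h.ent,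
    by rw [h16, h17]; exact h.le, by rw [r9, h8, h16]; exact h.sorted, by rw [h6, r9]; exact hpot⟩

theorem SearchState.inactive_le {ord wt : ℕ → ℕ} {p Φ : ℕ} {s : State}
    (h : T.SearchState ord wt p Φ s) (hb : T.IsBinary) (ho : T.IsOrder ord) (hw : T.IsWeight wt) :
    ∑ v ∈ (Finset.range n).filter (s.nat 6 · = 0), wt v ≤ 3 * ∑ i ∈ Finset.range (s.nat 17 0),
      entWeight wt (s.real 9) (s.real 13 0) (s.real 14 0) (s.nat 8 i) :=
  (sum_inactive_le hb ho hw h.search.sym.st_le h.sat).trans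
    (Nat.mul_le_mul_left 3 (h.search.sym.sum_active_le ho h.search.ent h.sat))

/-- An unresolved root has weight `1` and counts as inactive or active, so some critical value is
left in the range and there is a median to test. -/
theorem SearchState.total_pos {ord wt : ℕ → ℕ} {p Φ : ℕ} {s : State}
    (h : T.SearchState ord wt p Φ s) (hb : T.IsBinary) (ho : T.IsOrder ord) (hw : T.IsWeight wt)
    (hr : s.nat 6 T.rootN < 2) : 0 < ∑ i ∈ Finset.range (s.nat 17 0),
      entWeight wt (s.real 9) (s.real 13 0) (s.real 14 0) (s.nat 8 i) := by
  have h1 := h.inactive_le hb ho hw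
  have h2 := h.search.sym.sum_active_le (wt := wt) ho h.search.ent h.sat
  have h3 : 0 < wt T.rootN := by
    rw [hw.root]
    exact one_pos
  have hmem : ∀ i, s.nat 6 T.rootN = i → wt T.rootN ≤
      ∑ v ∈ (Finset.range n).filter (s.nat 6 · = i), wt v := fun i hi =>
    Finset.single_le_sum (f := wt) (fun _ _ => Nat.zero_le _)
      (Finset.mem_filter.2 ⟨Finset.mem_range.2 T.rootN_lt, hi⟩)
  have hcases : s.nat 6 T.rootN = 0 ∨ s.nat 6 T.rootN = 1 := by omega
  rcases hcases with h0 | h0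
  · have := hmem 0 h0
    omega
  · have := hmem 1 h0
    omega

theorem roundProg_spec (hb : T.IsBinary) {ord wt : ℕ → ℕ} (ho : T.IsOrder ord) (hw : T.IsWeight wt)
    {p Φ L : ℕ} {s : State} (h : T.SearchState ord wt p Φ s) (hr : s.nat 6 T.rootN < 2)
    (hL : 4 * n ≤ 2 ^ L) :
    Ends roundProg s (L * (200 * (s.nat 17 0 - s.nat 16 0) + 50) + 2000 * n + 300) (fun s' =>
      s'.nat 16 0 = s.nat 17 0 ∧ ∃ Φ', 26 * Φ' ≤ 25 * Φ ∧ T.SearchState ord wt p Φ' s') := by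
  have ht := h.search.ent.le
  have htot := h.total_pos hb ho hw hr
  have hX := h.inactive_le hb ho hw
  have hpot := h.search.pot
  rw [h.search.ent.potential_eq] at hpot
  set t := s.nat 17 0 with htdef
  set lo := s.real 13 0 with hlo
  set hi := s.real 14 0 with hhi
  set tot := ∑ i ∈ Finset.range t, entWeight wt (s.real 9) lo hi (s.nat 8 i) with htotdef
  set X := ∑ v ∈ (Finset.range n).filter (s.nat 6 · = 0), wt v
  have key : Ends roundProg s ((L * (200 * (t - s.nat 16 0) + 50) + 100 * t + 150) +
      ((150 * t + 50) + ((200 * n + 50) + (20 + (510 * n + 10))))) (fun s' =>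
      s'.nat 16 0 = t ∧ ∃ Φ', 26 * Φ' ≤ 25 * Φ ∧ T.SearchState ord wt p Φ' s') := by
    refine Ends.seq (insertProg_spec rfl rfl h.search.le (ht.trans hL) h.search.sorted)
      fun s₁ f₁ ⟨h16, hsort, hsum⟩ => ?_
    have i₁ := h.search.insert h16 hsort hsum (f₁.1 6 rfl) (f₁.1 17 rfl) (f₁.2 7 rfl) (f₁.2 8 rfl)
      (f₁.2 9 rfl) (f₁.2 13 rfl) (f₁.2 14 rfl)
    have t₁ : s₁.nat 17 0 = t := by rw [f₁.1 17 rfl]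
    have hsum' := hsum (entWeight wt (s.real 9) lo hi)
    have hpos₁ : 0 < (fun k => ∑ i ∈ Finset.range k, entWeight (s₁.nat 5) (s₁.real 9)
        (s₁.real 13 0) (s₁.real 14 0) (s₁.nat 8 i)) t := by
      simp only
      rw [f₁.1 5 rfl, f₁.2 9 rfl, f₁.2 13 rfl, f₁.2 14 rfl, h.wt_eq, hsum']
      exact htot
    refine Ends.seq (medianProg_spec t₁ rfl hpos₁) fun s₂ f₂ hs₂ => ?_
    rw [f₁.1 5 rfl, f₁.2 9 rfl, f₁.2 13 rfl, f₁.2 14 rfl, h.wt_eq] at hs₂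
    obtain ⟨i, hit, hir, h12, hi1, hi2⟩ := hs₂
    have q1 := sum_entWeight_below (wt := wt) (lo := lo) hsort hit hir.2.le hi1
    have q2 := sum_entWeight_above (wt := wt) (hi := hi) hsort hit hir.1.le hi2
    have in₂ : T.HasInput p s₂ := by
      refine h.input.frame ?_ ?_ ?_ ?_
      · rw [f₂.1 0 rfl, f₁.1 0 rfl]
      · rw [f₂.1 1 rfl, f₁.1 1 rfl]
      · rw [f₂.2 0 rfl, f₁.2 0 rfl]
      · rw [f₂.2 1 rfl, f₁.2 1 rfl]
    have re₂ : T.HasReach s₂ := by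
      unfold HasReach
      rw [f₂.2 4 rfl, f₁.2 4 rfl, f₂.2 5 rfl, f₁.2 5 rfl]
      exact h.reach
    have va₂ : T.ValidOut s₂ := by
      unfold ValidOut
      rw [f₂.1 2 rfl, f₁.1 2 rfl, f₂.2 3 rfl, f₁.2 3 rfl]
      exact h.valid
    set α := s.real 9 (s₁.nat 8 i) with hα
    refine Ends.seq (testProg_spec ho in₂ re₂ va₂ (by rw [f₂.1 3 rfl, f₁.1 3 rfl, h.ord_eq])
      (by rw [h12]; exact h.nonneg.trans hir.1.le)) fun s₃ f₃ ⟨va₃, hiff, _⟩ => ?_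
    rw [h12] at hiff
    have r12 : s₃.real 12 0 = α := by rw [f₃.2 12 rfl, h12]
    have r13 : s₃.real 13 0 = lo := by rw [f₃.2 13 rfl, f₂.2 13 rfl, f₁.2 13 rfl]
    have r14 : s₃.real 14 0 = hi := by rw [f₃.2 14 rfl, f₂.2 14 rfl, f₁.2 14 rfl]
    have hp : s₃.nat 0 1 = p := by rw [f₃.1 0 rfl, in₂.p_eq]
    refine Ends.seq (Q := fun s₄ => s.real 13 0 ≤ s₄.real 13 0 ∧ s₄.real 14 0 ≤ s.real 14 0 ∧
      s₄.real 13 0 < s₄.real 14 0 ∧ ¬ T.Feasible p (s₄.real 13 0) ∧ T.Feasible p (s₄.real 14 0) ∧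
      2 * ∑ x ∈ Finset.range t, entWeight wt (s.real 9) (s₄.real 13 0) (s₄.real 14 0) (s₁.nat 8 x) ≤
        tot) (ends_of_exec rfl (by decide) ?_) fun s₄ f₄ ⟨p1, p2, p3, p4, p5, p6⟩ => ?_
    · simp only [Prog.exec, Test.Holds, NExp.eval, RExp.eval, hp, r12]
      split_ifs with hc
      · simp only [State.putReal_real, if_true, show (14 : ℕ) ≠ 13 by decide, if_false, r14]
        refine ⟨hir.1.le, le_rfl, hir.2, fun hf => ?_, h.feasible, q2.trans_eq hsum'⟩
        have := hiff.2 hf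
        omega
      · simp only [State.putReal_real, if_true, show (13 : ℕ) ≠ 14 by decide, if_false, r13]
        exact ⟨le_rfl, hir.2.le, hir.1, h.infeasible, hiff.1 (not_lt.1 hc), q1.trans_eq hsum'⟩
    have n₄ : ∀ a, insertProg.writesNat a = false → medianProg.writesNat a = false →
        testProg.writesNat a = false → s₄.nat a = s.nat a := by
      intro a a1 a2 a3
      rw [f₄.1 a rfl, f₃.1 a a3, f₂.1 a a2, f₁.1 a a1]
    have m₄ : ∀ a, medianProg.writesNat a = false → testProg.writesNat a = false →
        s₄.nat a = s₁.nat a := by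
      intro a a2 a3
      rw [f₄.1 a rfl, f₃.1 a a3, f₂.1 a a2]
    have in₄ : T.HasInput p s₄ := in₂.frame (by rw [f₄.1 0 rfl, f₃.1 0 rfl])
      (by rw [f₄.1 1 rfl, f₃.1 1 rfl]) (by rw [f₄.2 0 rfl, f₃.2 0 rfl])
      (by rw [f₄.2 1 rfl, f₃.2 1 rfl])
    set Φ' := potential n wt (s₁.nat 6) (s₁.real 9) (s₄.real 13 0) (s₄.real 14 0) with hΦ'
    have i₄ : T.SearchInv ord wt Φ' s₄ := i₁.shrink (m₄ 6 rfl rfl) (m₄ 8 rfl rfl) (m₄ 16 rfl rfl)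
      (m₄ 17 rfl rfl) (by rw [f₄.2 7 rfl, f₃.2 7 rfl, f₂.2 7 rfl])
      (by rw [f₄.2 8 rfl, f₃.2 8 rfl, f₂.2 8 rfl]) (by rw [f₄.2 9 rfl, f₃.2 9 rfl, f₂.2 9 rfl])
      (by rw [f₁.2 13 rfl]; exact p1) (by rw [f₁.2 14 rfl]; exact p2) p3 le_rfl
    rw [i₁.ent.potential_eq, t₁, f₁.1 6 rfl, f₁.2 9 rfl] at hΦ'
    refine (scanProg_spec ho in₄ (by rw [n₄ 3 rfl rfl rfl, h.ord_eq]) i₄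
      (by rw [n₄ 7 rfl rfl rfl]; exact h.blk)).mono le_rfl fun s₅ f₅ ⟨i₅, b₅, sat₅⟩ => ?_
    refine ⟨by rw [f₅.1 16 rfl, m₄ 16 rfl rfl, h16], Φ', ?_, ?_, ?_, ?_, ?_, ?_, i₅, b₅, sat₅, ?_, ?_, ?_⟩
    -- Let `tot'` be the new weight in the range. Then `4 * X + tot ≤ Φ`, `Φ' = 4 * X + tot'`, `2 *
    -- tot' ≤ tot` and `X ≤ 3 * tot`. So `26 * Φ' ≤ 104 * X + 13 * tot ≤ 100 * X + 25 * tot ≤ 25 *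
    -- Φ`. The scan adds nothing to the potential.
    · omega
    · exact in₄.frame (f₅.1 0 rfl) (f₅.1 1 rfl) (f₅.2 0 rfl) (f₅.2 1 rfl)
    · unfold HasReach
      rw [f₅.2 4 rfl, f₄.2 4 rfl, f₃.2 4 rfl, f₅.2 5 rfl, f₄.2 5 rfl, f₃.2 5 rfl]
      exact re₂
    · unfold ValidOut
      rw [f₅.1 2 rfl, f₄.1 2 rfl, f₅.2 3 rfl, f₄.2 3 rfl]
      exact va₃
    · rw [f₅.1 3 rfl, n₄ 3 rfl rfl rfl, h.ord_eq]
    · rw [f₅.1 5 rfl, n₄ 5 rfl rfl rfl, h.wt_eq]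
    · rw [f₅.2 13 rfl]
      exact h.nonneg.trans p1
    · rw [f₅.2 13 rfl]
      exact p4
    · rw [f₅.2 14 rfl]
      exact p5
  refine key.mono ?_ fun _ _ h => h
  generalize L * (200 * (t - s.nat 16 0) + 50) = y
  omega

/-- The budget consists of a linear cost for each of the `r` rounds that the potential allows, and
of `200 * L` for each of the at most `4 * n` entries not yet sorted. -/
theorem searchProg_spec (hb : T.IsBinary) {ord wt : ℕ → ℕ} (ho : T.IsOrder ord) (hw : T.IsWeight wt)
    {p Φ L r : ℕ} {s : State} (h : T.SearchState ord wt p Φ s) (hL : 4 * n ≤ 2 ^ L)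
    (hr : Φ * 25 ^ r < 26 ^ r) :
    Ends searchProg s (r * (50 * L + 2000 * n + 310) + 800 * n * L + 10) (fun s' =>
      (∃ Φ, T.SearchState ord wt p Φ s') ∧ 2 ≤ s'.nat 6 T.rootN) := by
  refine (Ends.loop (k := r * (50 * L + 2000 * n + 310) + (4 * n - s.nat 16 0) * (200 * L))
    (fun k s' => ∃ Φ r, k = r * (50 * L + 2000 * n + 310) + (4 * n - s'.nat 16 0) * (200 * L) ∧
      Φ * 25 ^ r < 26 ^ r ∧ T.SearchState ord wt p Φ s') ?_ ⟨Φ, r, rfl, hr, h⟩).mono ?_ ?_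
  · rintro k s₁ - ⟨Φ₁, r₁, rfl, hr₁, h₁⟩ hb₁
    simp only [Test.Holds, NExp.eval, h₁.input.root_eq] at hb₁
    refine ⟨_, (roundProg_spec hb ho hw h₁ hb₁ hL).mono le_rfl ?_⟩
    rintro s₂ - ⟨h16, Φ₂, hΦ, h₂⟩
    have hpos : 0 < Φ₁ := by
      have h3 := h₁.total_pos hb ho hw hb₁
      have h4 := h₁.search.pot
      rw [h₁.search.ent.potential_eq] at h4
      omega
    -- A positive potential leaves at least one round in the budget.
    obtain ⟨r₂, rfl⟩ : ∃ r₂, r₁ = r₂ + 1 := by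
      refine ⟨r₁ - 1, ?_⟩
      rcases Nat.eq_zero_or_pos r₁ with h0 | h0
      · subst h0
        simp at hr₁
        omega
      · omega
    refine ⟨_, ⟨Φ₂, r₂, rfl, ?_, h₂⟩, ?_⟩
    · rw [pow_succ, pow_succ] at hr₁
      have h5 : 26 * (Φ₂ * 25 ^ r₂) ≤ Φ₁ * (25 ^ r₂ * 25) := by
        calc 26 * (Φ₂ * 25 ^ r₂) = 26 * Φ₂ * 25 ^ r₂ := by ring
          _ ≤ 25 * Φ₁ * 25 ^ r₂ := Nat.mul_le_mul_right _ hΦ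
          _ = _ := by ring
      omega
    · rw [h16]
      have hle := h₁.search.le
      have ht := h₁.search.ent.le
      simp only [Test.cost, NExp.cost]
      obtain ⟨d, hd⟩ : ∃ d, s₁.nat 17 0 = s₁.nat 16 0 + d := ⟨_, (Nat.add_sub_cancel' hle).symm⟩
      obtain ⟨e, he⟩ : ∃ e, 4 * n = s₁.nat 17 0 + e := ⟨_, (Nat.add_sub_cancel' ht).symm⟩
      rw [show 4 * n - s₁.nat 17 0 = e by omega, show s₁.nat 17 0 - s₁.nat 16 0 = d by omega,
        show 4 * n - s₁.nat 16 0 = d + e by omega]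
      ring_nf
      omega
  · simp only [Test.cost, NExp.cost]
    have : (4 * n - s.nat 16 0) * (200 * L) ≤ 800 * n * L := by
      calc _ ≤ 4 * n * (200 * L) := Nat.mul_le_mul_right _ (Nat.sub_le _ _)
        _ = _ := by ring
    omega
  · rintro s' - ⟨⟨_, Φ', _, _, _, h'⟩, hb'⟩
    simp only [Test.Holds, NExp.eval, h'.input.root_eq] at hb'
    exact ⟨⟨Φ', h'⟩, not_lt.1 hb'⟩

end TreeNetwork

/-! ### The algorithm -/

/-- Search for the smallest feasible value if it is positive. -/
def positiveProg : Prog :=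
  (setR 13 (.lit 0) ;; setR 14 (.mul (rv 10) (rv 11))) ;; scanProg ;; searchProg

/-- Compute the order of the vertices and all other data that the search needs. -/
def prepareProg : Prog := sumProg ;; reachProg ;; orderProg ;; setR 12 (.lit 0)

/-- The algorithm for the weighted discrete `p`-center problem. -/
def centerProg : Prog :=
  prepareProg ;; testProg ;;
  .ite (.natLt (.get 0 (.lit 1)) (nv 15)) positiveProg (setR 14 (.lit 0)) ;;
  setR 12 (rv 14) ;; testProg ;; setR 2 (rv 14)

/-! ### Correctness and running time of the whole algorithm -/

namespace TreeNetwork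

variable {n : ℕ} {T : TreeNetwork n}

/-- A resolved vertex has resolved children, so the status of the root spreads to all vertices. -/
theorem SymInv.eq_two {ord st : ℕ → ℕ} {A B crit : ℕ → ℝ} {lo hi : ℝ}
    (h : T.SymInv ord st A B crit lo hi) (ho : T.IsOrder ord) (hr : 2 ≤ st T.rootN) {v : ℕ}
    (hv : v < n) : st v = 2 := by
  obtain ⟨i, hi, rfl⟩ := ho.surj v hv
  induction i using Nat.strong_induction_on with
  | _ i ih =>
    by_cases hir : ord i = T.rootN
    · have := h.st_le _ hv
      rw [hir] at this ⊢
      omega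
    · obtain ⟨j, hji, hj⟩ := ho.par i hi hir
      have h1 := ih j hji (by omega) (ho.lt j (by omega))
      exact h.child (ord j) (ho.lt j (by omega)) (by omega) (ord i) hv hir hj.symm

/-- At the end of the search, the upper end of the range is the smallest feasible value. -/
theorem SearchState.isLeast {ord wt : ℕ → ℕ} {p Φ : ℕ} {s : State}
    (h : T.SearchState ord wt p Φ s) (ho : T.IsOrder ord) (hp : 1 ≤ p)
    (hr : 2 ≤ s.nat 6 T.rootN) : IsLeast {α | T.Feasible p α} (s.real 14 0) := by
  obtain ⟨a, ha, hmin⟩ := T.exists_isLeast_feasible hp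
  have h2 : a ≤ s.real 14 0 := hmin h.feasible
  rcases h2.eq_or_lt with h3 | h3
  · rw [← h3]
    exact ⟨ha, hmin⟩
  · exfalso
    have hlo : s.real 13 0 < a := by
      by_contra h4
      exact h.infeasible (Feasible.mono ha (not_lt.1 h4))
    have hsym := h.search.sym
    have hst : ∀ v < n, s.nat 6 v = 2 := fun v hv => hsym.eq_two ho hr hv
    have hnn := h.nonneg
    -- Inside the range, the lines describe valid greedy runs, and their signs at both ends of each
    -- edge are constant. So `m` needs no more centers than `a` and would be a smaller feasible
    -- value.
    set m := (s.real 13 0 + a) / 2 with hm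
    have ia : a ∈ Set.Ioo (s.real 13 0) (s.real 14 0) := ⟨hlo, h3⟩
    have im : m ∈ Set.Ioo (s.real 13 0) (s.real 14 0) := ⟨by linarith, by linarith⟩
    have ga := hsym.part.isGreedy hst ia
    have gm := hsym.part.isGreedy hst im
    have hop : ∀ v : Fin n, T.Opens (fun v : Fin n => s.real 7 v * m + s.real 8 v) v →
        T.Opens (fun v : Fin n => s.real 7 v * a + s.real 8 v) v := by
      intro v hv
      have hl : T.lenN v = T.len v := padded_val _ v
      have hs := hsym.sign v v.2 (hst v v.2) m im a ia
      rw [hl] at hs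
      exact ⟨hs.1 hv.1, hv.2.imp id hs.2⟩
    have hcount : T.openCount (fun v : Fin n => s.real 7 v * m + s.real 8 v) ≤
        T.openCount (fun v : Fin n => s.real 7 v * a + s.real 8 v) := by
      classical
      unfold openCount
      refine Finset.card_le_card fun v hv => ?_
      rw [Finset.mem_filter] at hv ⊢
      exact ⟨hv.1, hop v hv.2⟩
    have hfa := (ga.feasible_iff (hnn.trans hlo.le)).1 ha
    have hfm := (gm.feasible_iff (hnn.trans im.1.le)).2 (hcount.trans hfa)
    have := hmin hfm
    linarith

/-- The state after the preparations. -/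
structure Prepared (T : TreeNetwork n) (p : ℕ) (s : State) : Prop where
  input : T.HasInput p s
  reach : T.HasReach s
  valid : T.ValidOut s
  order : T.IsOrder (s.nat 3)
  weight : T.IsWeight (s.nat 5)
  line : ∀ v < n, s.real 7 v = s.real 4 v ∧ s.real 8 v = s.real 5 v
  len : s.real 10 0 = T.totalLen
  wt : s.real 11 0 = ∑ v, T.w v
  st : s.nat 6 = 0
  blk : s.nat 7 = 0
  sorted : s.nat 16 0 = 0
  entries : s.nat 17 0 = 0

theorem Prepared.frame {p : ℕ} {s s' : State} (h : T.Prepared p s) (hv : T.ValidOut s')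
    (h0 : s'.nat 0 = s.nat 0) (h1 : s'.nat 1 = s.nat 1) (h3 : s'.nat 3 = s.nat 3)
    (h5 : s'.nat 5 = s.nat 5) (h6 : s'.nat 6 = s.nat 6) (h7 : s'.nat 7 = s.nat 7)
    (h16 : s'.nat 16 = s.nat 16) (h17 : s'.nat 17 = s.nat 17) (r0 : s'.real 0 = s.real 0)
    (r1 : s'.real 1 = s.real 1) (r4 : s'.real 4 = s.real 4) (r5 : s'.real 5 = s.real 5)
    (r7 : s'.real 7 = s.real 7) (r8 : s'.real 8 = s.real 8) (r10 : s'.real 10 = s.real 10)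
    (r11 : s'.real 11 = s.real 11) : T.Prepared p s' := by
  refine ⟨h.input.frame h0 h1 r0 r1, ?_, hv, ?_, ?_, ?_, ?_, ?_, ?_, ?_, ?_, ?_⟩
  · unfold HasReach
    rw [r4, r5]
    exact h.reach
  · rw [h3]
    exact h.order
  · rw [h5]
    exact h.weight
  · rw [r4, r5, r7, r8]
    exact h.line
  · rw [r10, h.len]
  · rw [r11, h.wt]
  · rw [h6, h.st]
  · rw [h7, h.blk]
  · rw [h16, h.sorted]
  · rw [h17, h.entries]

theorem hasInput_input (p : ℕ) : T.HasInput p (T.input p) :=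
  ⟨rfl, rfl, rfl, rfl, rfl, rfl⟩

theorem prepareProg_spec (p : ℕ) {D : ℕ} (hD : ∀ v < n, T.depthN v ≤ D) :
    Ends prepareProg (T.input p) (D * (80 * n + 20) + 110 * n + 80)
      (fun s => T.Prepared p s ∧ s.real 12 0 = 0) := by
  have key : Ends prepareProg (T.input p) ((50 * n + 10) + ((60 * n + 10) +
      ((D * (80 * n + 20) + 50) + 10))) (fun s => T.Prepared p s ∧ s.real 12 0 = 0) := by
    have in₀ := T.hasInput_input p
    refine Ends.seq (sumProg_spec T in₀ rfl rfl) fun s₁ f₁ ⟨h10, h11⟩ => ?_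
    have in₁ : T.HasInput p s₁ := in₀.frame (f₁.1 0 rfl) (f₁.1 1 rfl) (f₁.2 0 rfl) (f₁.2 1 rfl)
    refine Ends.seq (reachProg_spec T in₁ h10) fun s₂ f₂ ⟨hre, hline⟩ => ?_
    have in₂ : T.HasInput p s₂ := in₁.frame (f₂.1 0 rfl) (f₂.1 1 rfl) (f₂.2 0 rfl) (f₂.2 1 rfl)
    refine Ends.seq (orderProg_spec in₂ (by rw [f₂.1 4 rfl, f₁.1 4 rfl]; rfl) hD)
      fun s₃ f₃ ⟨hord, hwt⟩ => ?_
    refine (ends_exec (P := setR 12 (.lit 0)) rfl s₃).mono (by decide) fun s₄ f₄ h₄ => ?_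
    have hn : ∀ a, sumProg.writesNat a = false → reachProg.writesNat a = false →
        orderProg.writesNat a = false → s₄.nat a = (T.input p).nat a := by
      intro a a1 a2 a3
      rw [f₄.1 a rfl, f₃.1 a a3, f₂.1 a a2, f₁.1 a a1]
    refine ⟨⟨in₂.frame ?_ ?_ ?_ ?_, ?_, ?_, ?_, ?_, ?_, ?_, ?_, hn 6 rfl rfl rfl, hn 7 rfl rfl rfl,
      ?_, ?_⟩, ?_⟩
    · rw [f₄.1 0 rfl, f₃.1 0 rfl]
    · rw [f₄.1 1 rfl, f₃.1 1 rfl]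
    · rw [f₄.2 0 rfl, f₃.2 0 rfl]
    · rw [f₄.2 1 rfl, f₃.2 1 rfl]
    · unfold HasReach
      rw [f₄.2 4 rfl, f₃.2 4 rfl, f₄.2 5 rfl, f₃.2 5 rfl]
      exact hre
    · intro i
      rw [hn 2 rfl rfl rfl, f₄.2 3 rfl, f₃.2 3 rfl, f₂.2 3 rfl, f₁.2 3 rfl]
      exact ⟨Nat.zero_lt_of_lt T.rootN_lt, le_rfl, T.lenN_nonneg _⟩
    · rw [f₄.1 3 rfl]
      exact hord
    · rw [f₄.1 5 rfl]
      exact hwt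
    · rw [f₄.2 7 rfl, f₃.2 7 rfl, f₄.2 8 rfl, f₃.2 8 rfl, f₄.2 4 rfl, f₃.2 4 rfl, f₄.2 5 rfl,
        f₃.2 5 rfl]
      exact hline
    · rw [f₄.2 10 rfl, f₃.2 10 rfl, f₂.2 10 rfl, h10]
    · rw [f₄.2 11 rfl, f₃.2 11 rfl, f₂.2 11 rfl, h11]
    · rw [hn 16 rfl rfl rfl]
      rfl
    · rw [hn 17 rfl rfl rfl]
      rfl
    · rw [h₄]
      simp [Prog.exec, RExp.eval, NExp.eval]
  exact key.mono (by omega) fun _ _ h => h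

/-- The initial state of the search. -/
theorem Prepared.searchInv {p : ℕ} {s : State} (h : T.Prepared p s)
    (hlt : s.real 13 0 < s.real 14 0) :
    T.SearchInv (s.nat 3) (s.nat 5) (∑ v ∈ Finset.range n, 4 * s.nat 5 v) s := by
  have hst : ∀ v, s.nat 6 v = 0 := fun v => by
    rw [h.st]
    rfl
  have hline : ∀ v < n, ∀ α, s.real 7 v * α + s.real 8 v = T.reachN α v := by
    intro v hv α
    rw [(h.line v hv).1, (h.line v hv).2, h.reach v hv]
  refine ⟨hlt, ⟨⟨fun v hv α _ => ?_, fun u _ h2 => ?_, fun v hv => Or.inl fun α _ => hline v hv α⟩,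
    fun v _ => ?_, fun v _ h0 => absurd (hst v) h0, fun i j _ _ h0 => absurd (hst _) h0,
    fun v _ h1 => ?_, fun v _ h2 => ?_, fun v _ h2 => ?_⟩, fun f => ?_, ?_, fun i j hi hij hj => ?_, ?_⟩
  · show Prec (s.real 7 v * α + s.real 8 v) _
    rw [hline v hv α]
    exact Prec.refl _
  · simp only [hst] at h2
    omega
  · rw [hst]
    omega
  · rw [hst] at h1
    omega
  · rw [hst] at h2
    omega
  · rw [hst] at h2
    omega
  · simp [h.entries, hst]
  · rw [h.sorted, h.entries]
  · rw [h.sorted] at hj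
    omega
  · refine Finset.sum_le_sum fun v _ => ?_
    rw [if_pos (hst v)]

theorem positiveProg_spec (hb : T.IsBinary) {p : ℕ} (hp : 1 ≤ p) {s : State} (h : T.Prepared p s)
    (h0 : ¬ T.Feasible p 0) {D L : ℕ} (hD : ∀ v < n, T.depthN v ≤ D) (hL : 4 * n ≤ 2 ^ L) :
    Ends positiveProg s (18 * (L + 2 * D + 1) * (50 * L + 2000 * n + 310) + 800 * n * L +
      510 * n + 40) (fun s' => T.HasInput p s' ∧ T.HasReach s' ∧ T.ValidOut s' ∧
        s'.nat 3 = s.nat 3 ∧ IsLeast {α | T.Feasible p α} (s'.real 14 0)) := by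
  have key : Ends positiveProg s (20 + ((510 * n + 10) +
      (18 * (L + 2 * D + 1) * (50 * L + 2000 * n + 310) + 800 * n * L + 10)))
      (fun s' => T.HasInput p s' ∧ T.HasReach s' ∧ T.ValidOut s' ∧
        s'.nat 3 = s.nat 3 ∧ IsLeast {α | T.Feasible p α} (s'.real 14 0)) := by
    refine Ends.seq (ends_of_exec (Q := fun s' => s'.real 13 0 = 0 ∧
      s'.real 14 0 = T.totalLen * ∑ v, T.w v) rfl (by decide) ?_) fun s₁ f₁ ⟨h13, h14⟩ => ?_
    · simp [Prog.exec, NExp.eval, RExp.eval, h.len, h.wt]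
    have pr₁ : T.Prepared p s₁ := h.frame (by
      unfold ValidOut
      rw [f₁.1 2 rfl, f₁.2 3 rfl]
      exact h.valid) (f₁.1 0 rfl) (f₁.1 1 rfl) (f₁.1 3 rfl) (f₁.1 5 rfl) (f₁.1 6 rfl) (f₁.1 7 rfl)
      (f₁.1 16 rfl) (f₁.1 17 rfl) (f₁.2 0 rfl) (f₁.2 1 rfl) (f₁.2 4 rfl) (f₁.2 5 rfl) (f₁.2 7 rfl)
      (f₁.2 8 rfl) (f₁.2 10 rfl) (f₁.2 11 rfl)
    have hfeas : T.Feasible p (s₁.real 14 0) := by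
      rw [h14]
      exact feasible_totalLen_mul hp
    -- The range is nonempty because its upper end is feasible and `0` is not.
    have hlt : s₁.real 13 0 < s₁.real 14 0 := by
      rw [h13]
      refine lt_of_le_of_ne hfeas.nonneg fun h' => h0 ?_
      rw [h']
      exact hfeas
    refine Ends.seq (scanProg_spec pr₁.order pr₁.input rfl (pr₁.searchInv hlt)
      (fun v _ => by rw [pr₁.blk]; rfl)) fun s₂ f₂ ⟨i₂, b₂, sat₂⟩ => ?_
    have ss₂ : T.SearchState (s₁.nat 3) (s₁.nat 5) p (∑ v ∈ Finset.range n, 4 * s₁.nat 5 v) s₂ := by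
      refine ⟨pr₁.input.frame (f₂.1 0 rfl) (f₂.1 1 rfl) (f₂.2 0 rfl) (f₂.2 1 rfl), ?_, ?_,
        f₂.1 3 rfl, f₂.1 5 rfl, i₂, b₂, sat₂, ?_, ?_, ?_⟩
      · unfold HasReach
        rw [f₂.2 4 rfl, f₂.2 5 rfl]
        exact pr₁.reach
      · unfold ValidOut
        rw [f₂.1 2 rfl, f₂.2 3 rfl]
        exact pr₁.valid
      · rw [f₂.2 13 rfl, h13]
      · rw [f₂.2 13 rfl, h13]
        exact h0
      · rw [f₂.2 14 rfl]
        exact hfeas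
    have hΦ : ∑ v ∈ Finset.range n, 4 * s₁.nat 5 v < 2 ^ (L + 2 * D + 1) := by
      calc ∑ v ∈ Finset.range n, 4 * s₁.nat 5 v ≤ ∑ v ∈ Finset.range n, 4 * 4 ^ D := by
            refine Finset.sum_le_sum fun v hv => Nat.mul_le_mul_left 4 ?_
            rw [Finset.mem_range] at hv
            rw [pr₁.weight.eq_pow hv]
            exact Nat.pow_le_pow_right (by norm_num) (hD v hv)
        _ = 4 * n * 4 ^ D := by
            rw [Finset.sum_const, Finset.card_range, smul_eq_mul]
            ring
        _ ≤ 2 ^ L * 4 ^ D := Nat.mul_le_mul_right _ hL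
        _ = 2 ^ (L + 2 * D) := by
            rw [pow_add, pow_mul]
            norm_num
        _ < 2 ^ (L + 2 * D + 1) := Nat.pow_lt_pow_right (by norm_num) (by omega)
    -- The factor `18` is due to `2 * 25 ^ 18 ≤ 26 ^ 18`: eighteen rounds halve the potential.
    have hr : (∑ v ∈ Finset.range n, 4 * s₁.nat 5 v) * 25 ^ (18 * (L + 2 * D + 1)) <
        26 ^ (18 * (L + 2 * D + 1)) := by
      rw [pow_mul, pow_mul]
      calc _ < 2 ^ (L + 2 * D + 1) * (25 ^ 18) ^ (L + 2 * D + 1) :=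
            Nat.mul_lt_mul_of_pos_right hΦ (by positivity)
        _ = (2 * 25 ^ 18) ^ (L + 2 * D + 1) := (mul_pow _ _ _).symm
        _ ≤ (26 ^ 18) ^ (L + 2 * D + 1) := Nat.pow_le_pow_left (by norm_num) _
    refine (searchProg_spec hb pr₁.order pr₁.weight ss₂ hL hr).mono le_rfl ?_
    rintro s₃ - ⟨⟨Φ, ss₃⟩, hroot⟩
    exact ⟨ss₃.input, ss₃.reach, ss₃.valid, by rw [ss₃.ord_eq, f₁.1 3 rfl],
      ss₃.isLeast pr₁.order hp hroot⟩
  exact key.mono (by omega) fun _ _ h => h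

/-- The value `0` is tested beforehand, as the search needs an infeasible lower end. The test is run
once more at the optimum because the last test of the search may have left the centers of another
value. -/
theorem centerProg_spec (hb : T.IsBinary) {p : ℕ} (hp : 1 ≤ p) {D L : ℕ}
    (hD : ∀ v < n, T.depthN v ≤ D) (hL : 4 * n ≤ 2 ^ L) :
    Ends centerProg (T.input p) (18 * (L + 2 * D + 1) * (50 * L + 2000 * n + 310) + 800 * n * L +
      D * (80 * n + 20) + 1020 * n + 300) (T.IsSolution p) := by
  have key : Ends centerProg (T.input p) ((D * (80 * n + 20) + 110 * n + 80) + ((200 * n + 50) +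
      ((5 + (18 * (L + 2 * D + 1) * (50 * L + 2000 * n + 310) + 800 * n * L + 510 * n + 40)) +
      (10 + ((200 * n + 50) + 10))))) (T.IsSolution p) := by
    refine Ends.seq (prepareProg_spec p hD) fun s₁ f₁ ⟨pr₁, h12⟩ => ?_
    refine Ends.seq (testProg_spec pr₁.order pr₁.input pr₁.reach pr₁.valid rfl h12.ge)
      fun s₂ f₂ ⟨va₂, hiff, _⟩ => ?_
    rw [h12] at hiff
    have pr₂ : T.Prepared p s₂ := pr₁.frame va₂ (f₂.1 0 rfl) (f₂.1 1 rfl) (f₂.1 3 rfl) (f₂.1 5 rfl)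
      (f₂.1 6 rfl) (f₂.1 7 rfl) (f₂.1 16 rfl) (f₂.1 17 rfl) (f₂.2 0 rfl) (f₂.2 1 rfl) (f₂.2 4 rfl)
      (f₂.2 5 rfl) (f₂.2 7 rfl) (f₂.2 8 rfl) (f₂.2 10 rfl) (f₂.2 11 rfl)
    refine Ends.seq (Q := fun s' => T.HasInput p s' ∧ T.HasReach s' ∧ T.ValidOut s' ∧
      s'.nat 3 = s₂.nat 3 ∧ IsLeast {α | T.Feasible p α} (s'.real 14 0))
      ((Ends.ite (fun hc => ?_) fun hc => ?_).mono le_rfl fun _ _ h => h)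
      fun s₃ f₃ ⟨in₃, re₃, va₃, ord₃, hleast⟩ => ?_
    · simp only [Test.Holds, NExp.eval, pr₂.input.p_eq] at hc
      exact positiveProg_spec hb hp pr₂ (fun hf => by
        have := hiff.2 hf
        omega) hD hL
    · simp only [Test.Holds, NExp.eval, pr₂.input.p_eq] at hc
      refine (ends_exec (P := setR 14 (.lit 0)) rfl s₂).mono
        (by simp only [Prog.time, NExp.cost, RExp.cost]; omega) fun s' f' h' => ?_
      refine ⟨pr₂.input.frame (f'.1 0 rfl) (f'.1 1 rfl) (f'.2 0 rfl) (f'.2 1 rfl), ?_, ?_,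
        f'.1 3 rfl, ?_⟩
      · unfold HasReach
        rw [f'.2 4 rfl, f'.2 5 rfl]
        exact pr₂.reach
      · unfold ValidOut
        rw [f'.1 2 rfl, f'.2 3 rfl]
        exact pr₂.valid
      · have e : s'.real 14 0 = 0 := by
          rw [h']
          simp [Prog.exec, RExp.eval, NExp.eval]
        rw [e]
        exact ⟨hiff.1 (not_lt.1 hc), fun α hα => Feasible.nonneg hα⟩
    refine Ends.seq ((ends_exec (P := setR 12 (rv 14)) rfl s₃).mono (by decide) fun _ _ h => h)
      fun s₄ f₄ h₄ => ?_
    have e12 : s₄.real 12 0 = s₃.real 14 0 := by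
      rw [h₄]
      simp [Prog.exec, RExp.eval, NExp.eval]
    refine Ends.seq (testProg_spec (ord := s₂.nat 3) (p := p) (T := T) pr₂.order
      (in₃.frame (f₄.1 0 rfl) (f₄.1 1 rfl) (f₄.2 0 rfl) (f₄.2 1 rfl)) ?_ ?_
      (by rw [f₄.1 3 rfl, ord₃]) (by rw [e12]; exact Feasible.nonneg hleast.1))
      fun s₅ f₅ ⟨_, hiff₅, hc₅⟩ => ?_
    · unfold HasReach
      rw [f₄.2 4 rfl, f₄.2 5 rfl]
      exact re₃
    · unfold ValidOut
      rw [f₄.1 2 rfl, f₄.2 3 rfl]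
      exact va₃
    rw [e12] at hiff₅ hc₅
    refine (ends_exec (P := setR 2 (rv 14)) rfl s₅).mono (by decide) fun s₆ f₆ h₆ => ?_
    have e2 : s₆.real 2 0 = s₃.real 14 0 := by
      rw [h₆]
      simp only [Prog.exec, RExp.eval, NExp.eval, State.putReal_real, if_true]
      rw [f₅.2 14 rfl, f₄.2 14 rfl]
    unfold IsSolution
    rw [e2, f₆.1 2 rfl, f₆.2 3 rfl]
    exact ⟨hleast, hc₅ (hiff₅.2 hleast.1)⟩
  refine key.mono ?_ fun _ _ h => h
  omega

/-- The running time in terms of the height of the tree. -/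
theorem centerProg_run (hb : T.IsBinary) {p : ℕ} (hp : 1 ≤ p) {D : ℕ}
    (hD : ∀ v < n, T.depthN v ≤ D) :
    Ends centerProg (T.input p) (100000 * (n * (Nat.log 2 n + D + 4))) (T.IsSolution p) := by
  have hn : 1 ≤ n := Nat.zero_lt_of_lt T.rootN_lt
  -- One factor `2` makes up for rounding down the logarithm, two for the four critical values per
  -- vertex.
  have hL : 4 * n ≤ 2 ^ (Nat.log 2 n + 3) := by
    have := Nat.lt_pow_succ_log_self (b := 2) (by norm_num) n
    rw [pow_succ] at this
    rw [pow_add]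
    omega
  refine (centerProg_spec hb hp hD hL).mono ?_ fun _ _ h => h
  have hlog : Nat.log 2 n < n := Nat.log_lt_self 2 (by omega)
  set l := Nat.log 2 n
  have h1 : 50 * (l + 3) + 2000 * n + 310 ≤ 2510 * n := by omega
  have h2 : 18 * (l + 3 + 2 * D + 1) * (50 * (l + 3) + 2000 * n + 310) ≤
      18 * (l + 3 + 2 * D + 1) * (2510 * n) := Nat.mul_le_mul_left _ h1
  have h3 : D * (80 * n + 20) ≤ D * (100 * n) := Nat.mul_le_mul_left _ (by omega)
  nlinarith [Nat.zero_le (n * l), Nat.zero_le (n * D)]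

end TreeNetwork

/-! ### The bound in terms of the natural logarithm -/

theorem natLog_le_two_mul_log (n : ℕ) : (Nat.log 2 n : ℝ) ≤ 2 * Real.log n := by
  rcases Nat.eq_zero_or_pos n with rfl | hn
  · simp
  have h1 : ((2 ^ Nat.log 2 n : ℕ) : ℝ) ≤ n := by
    exact_mod_cast Nat.pow_log_le_self 2 hn.ne'
  have h2 := Real.log_le_log (by positivity) h1
  push_cast at h2
  rw [Real.log_pow] at h2
  have h3 := Real.log_two_gt_d9
  have h4 : (0 : ℝ) ≤ Nat.log 2 n := Nat.cast_nonneg _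
  nlinarith

theorem theorem3 :
    ∃ P : RealRAM.Prog, ∀ κ : ℝ, ∃ C : ℝ, ∀ (n p : ℕ) (T : TreeNetwork n),
      T.IsBinary → T.IsBalanced κ → 1 ≤ p → p ≤ n →
        ∃ (t : ℕ) (s : RealRAM.State),
          RealRAM.Run P (T.input p) t s ∧ T.IsSolution p s ∧
            (t : ℝ) ≤ C * (n * Real.log n +
              p * Real.log n ^ 2 * Real.log ((n : ℝ) / (p : ℝ)) + 1) := by
  refine ⟨centerProg, fun κ => ⟨100000 * (10 + |κ|), fun n p T hb hκ hp hpn => ?_⟩⟩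
  have hn1 : (1 : ℝ) ≤ n := by exact_mod_cast hp.trans hpn
  have hlog : 0 ≤ Real.log n := Real.log_nonneg hn1
  set D := ⌊κ * Real.log n⌋₊ with hDdef
  have hD : ∀ v < n, T.depthN v ≤ D := by
    intro v hv
    have e : T.depthN v = T.depth ⟨v, hv⟩ := TreeNetwork.padded_val T.depth ⟨v, hv⟩
    rw [e]
    exact Nat.le_floor (hκ _)
  obtain ⟨t, s, hrun, ht, hs⟩ := TreeNetwork.centerProg_run hb hp hD
  refine ⟨t, s, hrun, hs, ?_⟩
  have hDle : (D : ℝ) ≤ |κ| * Real.log n := by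
    have h1 : κ * Real.log n ≤ |κ| * Real.log n :=
      mul_le_mul_of_nonneg_right (le_abs_self κ) hlog
    exact (Nat.cast_le.2 (Nat.floor_mono h1)).trans (Nat.floor_le (by positivity))
  have hl := natLog_le_two_mul_log n
  have hp0 : (0 : ℝ) < p := by exact_mod_cast hp
  -- As `p ≤ n`, this term is nonnegative and can be added at the end; the other two already bound
  -- the running time.
  have hterm : 0 ≤ (p : ℝ) * Real.log n ^ 2 * Real.log ((n : ℝ) / (p : ℝ)) := by
    have h1 : (1 : ℝ) ≤ (n : ℝ) / p := by
      rw [one_le_div hp0]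
      exact_mod_cast hpn
    have := Real.log_nonneg h1
    positivity
  -- For `n = 1` the logarithm vanishes, and only the constant summand of the bound is left; for
  -- larger `n` it is more than one half.
  have h4 : 4 * (n : ℝ) ≤ 8 * (n * Real.log n) + 4 := by
    rcases (hp.trans hpn).eq_or_lt with h1 | h1
    · rw [← h1]
      simp
    · have h2 : Real.log 2 ≤ Real.log n :=
        Real.log_le_log (by norm_num) (by exact_mod_cast h1)
      have h3 := Real.log_two_gt_d9
      nlinarith
  have htR : (t : ℝ) ≤ 100000 * (n * (Nat.log 2 n + D + 4)) := by exact_mod_cast ht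
  have h5 : (n : ℝ) * (Nat.log 2 n + D) ≤ n * ((2 + |κ|) * Real.log n) :=
    mul_le_mul_of_nonneg_left (by linarith) (by linarith)
  have hκ0 := abs_nonneg κ
  have h6 : 0 ≤ |κ| * ((p : ℝ) * Real.log n ^ 2 * Real.log ((n : ℝ) / (p : ℝ))) :=
    mul_nonneg hκ0 hterm
  calc (t : ℝ) ≤ 100000 * (n * (Nat.log 2 n + D + 4)) := htR
    _ ≤ 100000 * ((10 + |κ|) * (n * Real.log n + 1)) := by nlinarith
    _ ≤ _ := by nlinarith
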